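/- **Setting.** A Boltzmann machine has $n_v$ visible and $n_h$ hidden binary units, which are the vertices of a connected graph $G$ with $E\ge 1$ edges, real biases $b_i,d_j$, and real weights $w=(w^{vh},w^v,w^h)$ supported on the edges of $G$. Its energy is $$E(v,h)=-\sum_i v_ib_i-\sum_j h_jd_j-\sum_{i,j}w^{vh}_{ij}v_ih_j-\sum_{i,j}w^{v}_{ij}v_iv_j-\sum_{i,j}w^{h}_{ij}h_ih_j ,$$ and $P(v,h)=e^{-E(v,h)}/Z$. For training vectors $x_1,\dots,x_N\in\{0,1\}^{n_v}$ ($N\ge1$) and $\lambda\in\mathbb R$, $$O_{\rm ML}=\frac1N\sum_{p=1}^N\log\Big(\sum_{h\in\{0,1\}^{n_h}}P(x_p,h)\Big)-\frac\lambda2\,w^Tw .$$ Let $Q$ be the mean-field approximation of $P$ (a product distribution minimizing $\mathrm{KL}(Q\|P)$, with parameters $\mu_i,\nu_j$), and $Q_x$ the mean-field approximation on the hidden units of the machine with visible units clamped to $x$ (with parameters $\nu_j(x)$). Put $$\log Z_Q=\sum_{v,h}Q(v,h)\log\frac{e^{-E(v,h)}}{Q(v,h)},\qquad \log Z_{x,Q}=\sum_hQ_x(h)\log\frac{e^{-E(x,h)}}{Q_x(h)}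 .$$ Constants $\kappa>0$ and $\kappa_{x_p}>0$ are promised to satisfy $e^{-E(v,h)}/Z_Q\le\kappa\,Q(v,h)$ for all $(v,h)$, and $e^{-E(x_p,h)}/Z_{x_p,Q}\le\kappa_{x_p}Q_{x_p}(h)$ for all $p$ and $h$. Write $\kappa_{\max}=\max_p\kappa_{x_p}$, and let $W\ge 0$ bound the absolute values of all weights and biases. **Computational model.** A quantum algorithm is a circuit acting on qubits initialized to $|0\rangle$, followed by a measurement of $m$ qubits and classical post-processing of the $m$ measured bits; the post-processing may also use the current value of the parameter with respect to which one differentiates. The operations are: * fixed one-qubit gates, CNOT and Toffoli gates (cost 1); * one-qubit gates that are a function of a single number among the weights, the biases, $\mu_i$, $\nu_j$ and $Z_Q$ (cost 1); * queries $U_O|p\rangle|y\rangle=|p\rangle|y\oplus x_p\rangle$ (cost 1, and counted separately as queries), acting trivially on index strings that label no training vector; * coherent evaluations of the clamped mean field, $|x\rangle|y\rangle\mapsto|x\rangle|y\oplus \mathrm{enc}(x)\rangle$, where $\mathrm{enc}(x)$ consists of $\ell$-bit encodings of each of $\nu_1(x),\dots,\nu_{n_h}(x),Z_{x,Q}$ (cost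 $E\ell$). The circuit and the post-processing may depend on $G$, $N$, $W$, $\kappa$, $\kappa_{\max}$, $\delta$, $r$, $\lambda$, the failure probability and the choice of gradient component, but not on the weights, the biases, the mean-field parameters or the training vectors, except through the operations and the post-processing input just listed. **Theorem.** For every learning rate $r\in\mathbb R$ and every $\eta>0$ there are constants $C,k$, depending only on $r$ and $\eta$, such that the following holds. For all $n_v,n_h,G,N,W,\lambda,\kappa,\kappa_{\max}$ as above, all $\delta>0$ and every parameter $\theta_c$ of the machine ($w_{ij}$ for a visible/hidden pair, $b_i$ or $d_j$; also a visible/visible or hidden/hidden weight) there is a quantum algorithm that, on every machine and every training set satisfying the above promises, outputs with probability at least $1-\eta$ a number $z$ with $$\Big|z-r\,\frac{\partial O_{\rm ML}}{\partial\theta_c}\Big|\le\delta .$$ Its number of queries to $U_O$ (in the worst case, hence also in expectation) is at most $$C\,\frac{\kappa+\kappa_{\max}}{\delta}\,\log^k\!\Big(2+\frac{\kappa+\kappa_{\max}}{\delta}\Big),$$ its total number of quantum operations is at most $$C\,\frac{E(\kappa+\kappa_{\max})}{\delta}\,\log^k\!\Big(2+E+N+W+\frac{\kappa+\kappa_{\max}}{\delta}\Big),$$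 and it measures at most $C\log\big(2+(\kappa+\kappa_{\max})/\delta\big)$ qubits. -/

import Mathlib

namespace QBM

noncomputable section

/-! Boltzmann machines -/

/-- A configuration of `n` binary units, and also a computational basis state of `n` qubits. -/
abbrev Config (n : ℕ) : Type := Fin n → Bool

/-- The numerical value (0 or 1) of a unit. -/
def bit (s : Bool) : ℝ := if s then 1 else 0

/-- The names of the real parameters of a Boltzmann machine with `nv` visible and `nh` hidden
units: visible biases, hidden biases and the three blocks of weights. -/
inductive Coord (nv nh : ℕ) : Type
  | b (i : Fin nv)
  | d (j : Fin nh)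
  | wvh (i : Fin nv) (j : Fin nh)
  | wv (i i' : Fin nv)
  | wh (j j' : Fin nh)
  deriving DecidableEq

/-- The parameters (biases and weights) of a Boltzmann machine. -/
abbrev Params (nv nh : ℕ) : Type := Coord nv nh → ℝ

variable {nv nh : ℕ}

/-- The energy of a configuration. -/
def energy (θ : Params nv nh) (v : Config nv) (h : Config nh) : ℝ :=
  - (∑ i, bit (v i) * θ (.b i)) - (∑ j, bit (h j) * θ (.d j))
    - (∑ i, ∑ j, θ (.wvh i j) * bit (v i) * bit (h j))
    - (∑ i, ∑ i', θ (.wv i i') * bit (v i) * bit (v i'))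
    - (∑ j, ∑ j', θ (.wh j j') * bit (h j) * bit (h j'))

/-- The weights live on the edges of the graph `G`, whose vertices are the units. -/
def WeightsOn (G : SimpleGraph (Fin nv ⊕ Fin nh)) (θ : Params nv nh) : Prop :=
  (∀ i j, ¬ G.Adj (.inl i) (.inr j) → θ (.wvh i j) = 0) ∧
  (∀ i i', ¬ G.Adj (.inl i) (.inl i') → θ (.wv i i') = 0) ∧
  (∀ j j', ¬ G.Adj (.inr j) (.inr j') → θ (.wh j j') = 0)

/-- The partition function `Z`. -/
def partition (θ : Params nv nh) : ℝ :=
  ∑ v : Config nv, ∑ h : Config nh, Real.exp (- energy θ v h)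

/-- The Gibbs distribution `P(v,h)`. -/
def gibbs (θ : Params nv nh) (v : Config nv) (h : Config nh) : ℝ :=
  Real.exp (- energy θ v h) / partition θ

/-- The partition function `Z_x` of the machine with visible units clamped to `x`. -/
def clampedPartition (θ : Params nv nh) (x : Config nv) : ℝ :=
  ∑ h : Config nh, Real.exp (- energy θ x h)

/-- The Gibbs distribution of the hidden units with visible units clamped to `x`. -/
def clampedGibbs (θ : Params nv nh) (x : Config nv) (h : Config nh) : ℝ :=
  Real.exp (- energy θ x h) / clampedPartition θ x

/-- The squared Euclidean norm of the vector of all weights (biases not included). -/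
def weightNormSq (θ : Params nv nh) : ℝ :=
  (∑ i, ∑ j, θ (.wvh i j) ^ 2) + (∑ i, ∑ i', θ (.wv i i') ^ 2) + (∑ j, ∑ j', θ (.wh j j') ^ 2)

/-- The regularized maximum-likelihood objective for the training vectors `x`. -/
def objective {N : ℕ} (lam : ℝ) (x : Fin N → Config nv) (θ : Params nv nh) : ℝ :=
  (1 / (N : ℝ)) * (∑ p, Real.log (∑ h : Config nh, gibbs θ (x p) h))
    - lam / 2 * weightNormSq θ

/-! Mean-field approximation -/

/-- The product distribution with `P(s_i = 1) = μ i`. -/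
def bernoulliProd {n : ℕ} (μ : Fin n → ℝ) (s : Config n) : ℝ :=
  ∏ i, if s i then μ i else 1 - μ i

/-- Kullback--Leibler divergence `KL(Q‖P)`. -/
def klDivSum {α : Type} [Fintype α] (Q P : α → ℝ) : ℝ :=
  ∑ a, Q a * Real.log (Q a / P a)

/-- `(μ, ν)` are mean-field parameters: the product distribution they define minimizes
`KL(Q‖P)` among all product distributions. -/
def IsMeanField (θ : Params nv nh) (μ : Fin nv → ℝ) (ν : Fin nh → ℝ) : Prop :=
  (∀ i, μ i ∈ Set.Icc 0 1) ∧ (∀ j, ν j ∈ Set.Icc 0 1) ∧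
  ∀ (μ' : Fin nv → ℝ) (ν' : Fin nh → ℝ),
    (∀ i, μ' i ∈ Set.Icc 0 1) → (∀ j, ν' j ∈ Set.Icc 0 1) →
    klDivSum (fun s : Config nv × Config nh => bernoulliProd μ s.1 * bernoulliProd ν s.2)
        (fun s => gibbs θ s.1 s.2) ≤
      klDivSum (fun s : Config nv × Config nh => bernoulliProd μ' s.1 * bernoulliProd ν' s.2)
        (fun s => gibbs θ s.1 s.2)

/-- `ν` are mean-field parameters of the hidden units for visible units clamped to `x`. -/
def IsClampedMeanField (θ : Params nv nh) (x : Config nv) (ν : Fin nh → ℝ) : Prop :=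
  (∀ j, ν j ∈ Set.Icc 0 1) ∧
  ∀ ν' : Fin nh → ℝ, (∀ j, ν' j ∈ Set.Icc 0 1) →
    klDivSum (bernoulliProd ν) (clampedGibbs θ x) ≤
      klDivSum (bernoulliProd ν') (clampedGibbs θ x)

/-- The variational approximation `Z_Q` to the partition function,
`log Z_Q = ∑ Q log (exp (-E) / Q)`. -/
def zQ (θ : Params nv nh) (μ : Fin nv → ℝ) (ν : Fin nh → ℝ) : ℝ :=
  Real.exp (∑ v : Config nv, ∑ h : Config nh, (bernoulliProd μ v * bernoulliProd ν h) *
    Real.log (Real.exp (- energy θ v h) / (bernoulliProd μ v * bernoulliProd ν h)))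

/-- The variational approximation `Z_{x,Q}` to the clamped partition function. -/
def clampedZQ (θ : Params nv nh) (x : Config nv) (ν : Fin nh → ℝ) : ℝ :=
  Real.exp (∑ h : Config nh, bernoulliProd ν h *
    Real.log (Real.exp (- energy θ x h) / bernoulliProd ν h))

/-- `κ` bounds the ratio of `exp (-E) / Z_Q` to the mean-field distribution. -/
def KappaBound (θ : Params nv nh) (μ : Fin nv → ℝ) (ν : Fin nh → ℝ) (κ : ℝ) : Prop :=
  ∀ v h, Real.exp (- energy θ v h) / zQ θ μ ν ≤ κ * (bernoulliProd μ v * bernoulliProd ν h)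

/-- The analogue of `KappaBound` with visible units clamped to `x`. -/
def ClampedKappaBound (θ : Params nv nh) (x : Config nv) (ν : Fin nh → ℝ) (κ : ℝ) : Prop :=
  ∀ h, Real.exp (- energy θ x h) / clampedZQ θ x ν ≤ κ * bernoulliProd ν h

/-! Quantum circuits -/

/-- The data of a training problem: machine, training vectors, mean-field parameters `μ`, `ν`
of the machine, and mean-field parameters `νx x` of the machine clamped to `x`. -/
structure Instance (nv nh N : ℕ) where
  θ : Params nv nh
  x : Fin N → Config nv
  μ : Fin nv → ℝ
  ν : Fin nh → ℝ
  νx : Config nv → Fin nh → ℝ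

/-- The names of the real numbers that are available as classical data. -/
inductive Datum (nv nh : ℕ) : Type
  | coord (c : Coord nv nh)
  | mfV (i : Fin nv)
  | mfH (j : Fin nh)
  | zQ

/-- The value of a classical datum. -/
def Instance.value {N : ℕ} (I : Instance nv nh N) : Datum nv nh → ℝ
  | .coord c => I.θ c
  | .mfV i => I.μ i
  | .mfH j => I.ν j
  | .zQ => QBM.zQ I.θ I.μ I.ν

/-- The numbers returned by a mean-field evaluation at `x`: the `j`-th clamped mean-field
parameter for `some j`, and `Z_{x,Q}` for `none`. -/
def Instance.clampedValue {N : ℕ} (I : Instance nv nh N) (x : Config nv) : Option (Fin nh) → ℝ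
  | some j => I.νx x j
  | none => clampedZQ I.θ x (I.νx x)

/-- One-qubit unitaries. -/
abbrev U2 : Type := Matrix.unitaryGroup Bool ℂ

/-- The operations of a circuit on `q` qubits.
* `one`: a fixed one-qubit gate; `cnot`, `toffoli`: the usual gates, the last qubit is the target;
* `param`: a one-qubit gate that is a function of a single classical datum;
* `query`: the data oracle `|p⟩|y⟩ ↦ |p⟩|y ⊕ x_p⟩` on an index and a data register;
* `meanField`: for `x` in a register of `nv` qubits, XOR the `len`-bit encodings of the clamped
  mean-field parameters and of `Z_{x,Q}` into an output register. -/
inductive Gate (nv nh N q : ℕ) : Type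
  | one (U : U2) (a : Fin q)
  | cnot (a b : Fin q) (hab : a ≠ b)
  | toffoli (a b c : Fin q) (hab : a ≠ b) (hac : a ≠ c) (hbc : b ≠ c)
  | param (k : Datum nv nh) (U : ℝ → U2) (a : Fin q)
  | query (e : Fin (Nat.clog 2 N) ⊕ Fin nv ↪ Fin q)
  | meanField (len : ℕ) (enc : Option (Fin nh) → ℝ → Fin len → Bool)
      (e : Fin nv ⊕ (Option (Fin nh) × Fin len) ↪ Fin q)

/-- State vectors of `q` qubits. -/
abbrev State (q : ℕ) : Type := Config q → ℂ

/-- Action of a one-qubit gate on qubit `a`. -/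
def applyOne {q : ℕ} (U : U2) (a : Fin q) (ψ : State q) : State q :=
  fun s => ∑ t : Bool, (U : Matrix Bool Bool ℂ) (s a) t * ψ (Function.update s a t)

open Classical in
/-- XOR the bit string `f` into the qubits of `s` singled out by `e`. -/
def xorInto {q : ℕ} {α : Type} (e : α → Fin q) (f : α → Bool) (s : Config q) : Config q :=
  fun t => xor (s t) (decide (∃ k, e k = t ∧ f k = true))

/-- The number with the given binary digits, least significant digit first. -/
def binValue {l : ℕ} (s : Fin l → Bool) : ℕ := ∑ k, if s k then 2 ^ (k : ℕ) else 0

/-- The training vector with index `p`; no vector (all zeros) if the index is out of range. -/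
def trainingVector {N : ℕ} (x : Fin N → Config nv) (p : ℕ) : Config nv :=
  if hp : p < N then x ⟨p, hp⟩ else fun _ => false

/-- Action of an operation on state vectors.  The permutations of basis states that occur are
involutions. -/
def Gate.apply {N q : ℕ} (I : Instance nv nh N) : Gate nv nh N q → State q → State q
  | .one U a, ψ => applyOne U a ψ
  | .cnot a b _, ψ => fun s => ψ (Function.update s b (xor (s b) (s a)))
  | .toffoli a b c _ _ _, ψ => fun s => ψ (Function.update s c (xor (s c) (s a && s b)))
  | .param k U a, ψ => applyOne (U (I.value k)) a ψ
  | .query e, ψ => fun s =>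
      ψ (xorInto (fun i => e (.inr i))
        (trainingVector I.x (binValue fun k => s (e (.inl k)))) s)
  | .meanField _ enc e, ψ => fun s =>
      ψ (xorInto (fun k => e (.inr k))
        (fun k => enc k.1 (I.clampedValue (fun i => s (e (.inl i))) k.1) k.2) s)

/-- Number of oracle queries of an operation. -/
def Gate.queries {N q : ℕ} : Gate nv nh N q → ℕ
  | .query _ => 1
  | _ => 0

/-- Cost of an operation for a machine with `E` edges: one for each gate and each query, and `E`
per bit of precision for a mean-field evaluation. -/
def Gate.cost {N q : ℕ} (E : ℕ) : Gate nv nh N q → ℕ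
  | .meanField len _ _ => E * len
  | _ => 1

/-- A quantum algorithm: a circuit on `q` qubits that starts in the all-zero state and ends with the
measurement of `m` qubits, and classical post-processing of the `m` measured bits, which may use
one further real number (the value of the parameter with respect to which one differentiates). -/
structure QAlgorithm (nv nh N : ℕ) where
  q : ℕ
  circuit : List (Gate nv nh N q)
  m : ℕ
  measured : Fin m ↪ Fin q
  post : ℝ → Config m → ℝ

/-- Total number of queries. -/
def QAlgorithm.queries {N : ℕ} (A : QAlgorithm nv nh N) : ℕ :=
  (A.circuit.map Gate.queries).sum

/-- Total number of quantum operations for a machine with `E` edges. -/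
def QAlgorithm.cost {N : ℕ} (A : QAlgorithm nv nh N) (E : ℕ) : ℕ :=
  (A.circuit.map (Gate.cost E)).sum

/-- The final state of the circuit on an instance. -/
def QAlgorithm.finalState {N : ℕ} (A : QAlgorithm nv nh N) (I : Instance nv nh N) : State A.q :=
  A.circuit.foldl (fun ψ g => g.apply I ψ) (fun s => if s = (fun _ => false) then 1 else 0)

open Classical in
/-- The probability that the output lies in `S`, when the real number `w` is given to the
post-processing. -/
def QAlgorithm.outputProb {N : ℕ} (A : QAlgorithm nv nh N) (I : Instance nv nh N) (w : ℝ)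
    (S : Set ℝ) : ℝ :=
  ∑ s : Config A.q,
    if A.post w (fun k => s (A.measured k)) ∈ S then ‖A.finalState I s‖ ^ 2 else 0

end

end QBM

/-!
The gradient component is `E_{P(h|x)} [m] - E_P [m]`, averaged over the training vectors `x`, minus
the derivative of the regularization, where `m` is the product of units that the parameter
multiplies in the energy (`hasDerivAt_objective`). The regularization term is known to the
post-processing. The two expectations are encoded in the probability of one qubit of a quantum
circuit, and this probability is found by amplitude estimation.

*The sampling circuit* (`SamplerSpec.srcs`, `SamplerSpec.crun_flag`, `bexp_flag`) is a classical
reversible circuit that acts on qubits prepared as independent coins. It draws a training index and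
a bit `side` that decides between the clamped and the unclamped machine, and then performs rejection
sampling: `K` times it proposes a configuration from the mean-field distribution `Q` and accepts it
with probability `exp (-E) / (κ Z_Q Q)`, which is at most `1` by the promise on `κ`. The
acceptance probability is at least `1 / κ`, because `Z_Q ≤ Z` by Gibbs' inequality
(`exp_sum_mul_log_div_le`), so that `K = O(κ log (1 / δ))` trials suffice. The flag is the value of
`m` in the first accepted trial on the clamped side, and its negation on the other side.

*Arithmetic.* All probabilities are of the form `exp (-y / 2 ^ f)` with an integer `y`, and such an
event is obtained by tossing one coin for each binary digit of `y` (`bexp_digit_coins`). The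
exponent of the acceptance probability is a sum of `O(E)` terms for the units and edges, so that it
only has to be added up, in fixed-point arithmetic modulo `2 ^ l`; the weights, biases and
mean-field data enter through their digits, each of which is a function of a single number. For each
unit, the mean-field probability of the less likely value is rounded down to the form above, and the
terms of the exponent are computed from the rounded probabilities, so that the accepted distribution
is proportional to the Boltzmann distribution up to a factor `exp (-O(E) / 2 ^ f)`
(`accepted_weight_bounds`, `abs_resultProb_sub_le`).

*Amplitude estimation* (`exists_phase_estimator`, `sum_groverOps`) needs no Fourier transform: the
flag is measured after `k` Grover iterations, in independent copies, for `O(log (1 / δ))` numbers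
`k = O(1 / δ)`. The outcomes are coins with parameters `sin² ((2 k + 1) θ)`, where `sin² θ` is the
probability of the flag. The maximum likelihood estimate of `θ` on a fine grid is accurate, because
the Bhattacharyya coefficients of the distributions that belong to distant angles are small. The
probability is kept at most `1 / 4` by two further coins, so that `θ ≤ π / 6`.
-/

namespace QBM

noncomputable section

set_option linter.unusedSectionVars false

/-! ### Products of Bernoulli distributions -/

/-- The probability of the bit `b` under the Bernoulli distribution with parameter `p`. -/
def bern (p : ℝ) (b : Bool) : ℝ := if b then p else 1 - p

/-- The expectation of `F` under independent bits with `P(s i = 1) = p i`. -/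
def bexp {ι : Type} [Fintype ι] [DecidableEq ι] (p : ι → ℝ) (F : (ι → Bool) → ℝ) : ℝ :=
  ∑ s : ι → Bool, (∏ i, bern (p i) (s i)) * F s

section

variable {ι β γ : Type} [Fintype ι] [DecidableEq ι] [Fintype β] [DecidableEq β]
  [Fintype γ] [DecidableEq γ]

theorem bern_nonneg {p : ℝ} (h0 : 0 ≤ p) (h1 : p ≤ 1) (b : Bool) : 0 ≤ bern p b := by
  cases b <;> simp [bern] <;> linarith

theorem sum_bern (p : ℝ) : ∑ b, bern p b = 1 := by simp [bern]

theorem prod_bern_nonneg {p : ι → ℝ} (h0 : ∀ i, 0 ≤ p i) (h1 : ∀ i, p i ≤ 1) (s : ι → Bool) :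
    0 ≤ ∏ i, bern (p i) (s i) :=
  Finset.prod_nonneg fun i _ => bern_nonneg (h0 i) (h1 i) _

theorem sum_prod_eq_prod_sum (w : ι → γ → ℝ) :
    ∑ c : ι → γ, ∏ i, w i (c i) = ∏ i, ∑ g, w i g :=
  (Fintype.prod_sum w).symm

theorem sum_prod_bern (p : ι → ℝ) : ∑ s : ι → Bool, ∏ i, bern (p i) (s i) = 1 := by
  rw [sum_prod_eq_prod_sum]; simp only [sum_bern, Finset.prod_const_one]

/-- Independent random variables are distributed according to the product of their marginals. -/
theorem sum_prod_pushforward (w : ι → γ → ℝ) (g : ι → γ → β) (F : (ι → β) → ℝ) :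
    ∑ c : ι → γ, (∏ i, w i (c i)) * F (fun i => g i (c i)) =
      ∑ x : ι → β, (∏ i, ∑ y, if g i y = x i then w i y else 0) * F x := by
  have h : ∀ x : ι → β, (∏ i, ∑ y, if g i y = x i then w i y else 0) * F x =
      ∑ c : ι → γ, if (fun i => g i (c i)) = x then (∏ i, w i (c i)) * F x else 0 := by
    intro x
    rw [← sum_prod_eq_prod_sum, Finset.sum_mul]
    refine Finset.sum_congr rfl fun c _ => ?_
    by_cases hc : (fun i => g i (c i)) = x
    · subst hc; simp
    · rw [if_neg hc]
      obtain ⟨i, hi⟩ := Function.ne_iff.mp hc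
      rw [Finset.prod_eq_zero (Finset.mem_univ i), zero_mul]
      exact if_neg hi
  simp_rw [h]
  rw [Finset.sum_comm]
  simp

theorem bexp_const (p : ι → ℝ) (a : ℝ) : bexp p (fun _ => a) = a := by
  unfold bexp; rw [← Finset.sum_mul, sum_prod_bern, one_mul]

theorem bexp_mul_left (p : ι → ℝ) (a : ℝ) (F : (ι → Bool) → ℝ) :
    bexp p (fun s => a * F s) = a * bexp p F := by
  unfold bexp; rw [Finset.mul_sum]; exact Finset.sum_congr rfl fun _ _ => by ring

theorem bexp_one_sub (p : ι → ℝ) (F : (ι → Bool) → ℝ) :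
    bexp p (fun s => 1 - F s) = 1 - bexp p F := by
  unfold bexp; simp only [mul_sub, mul_one, Finset.sum_sub_distrib, sum_prod_bern]

theorem bexp_congr {p : ι → ℝ} {F G : (ι → Bool) → ℝ} (h : ∀ s, F s = G s) :
    bexp p F = bexp p G := by
  unfold bexp; exact Finset.sum_congr rfl fun s _ => by rw [h s]

theorem bexp_sum (p : ι ⊕ γ → ℝ) (F : (ι ⊕ γ → Bool) → ℝ) :
    bexp p F = bexp (fun i => p (.inl i)) fun a => bexp (fun j => p (.inr j)) fun b =>
      F (Sum.elim a b) := by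
  unfold bexp
  rw [← (Equiv.sumArrowEquivProdArrow ι γ Bool).symm.sum_comp, Fintype.sum_prod_type]
  refine Finset.sum_congr rfl fun a _ => ?_
  rw [Finset.mul_sum]
  refine Finset.sum_congr rfl fun b _ => ?_
  rw [Fintype.prod_sum_type]
  simp only [Equiv.sumArrowEquivProdArrow_symm_apply_inl,
    Equiv.sumArrowEquivProdArrow_symm_apply_inr]
  rw [mul_assoc]
  rfl

/-- The bits of a two-dimensional array, as a family of rows. -/
theorem bexp_curry (p : ι × γ → ℝ) (F : (ι → γ → Bool) → ℝ) :
    bexp p (fun s => F fun i j => s (i, j)) =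
      ∑ c : ι → γ → Bool, (∏ i, ∏ j, bern (p (i, j)) (c i j)) * F c := by
  unfold bexp
  rw [← (Equiv.curry ι γ Bool).symm.sum_comp]
  refine Finset.sum_congr rfl fun c _ => ?_
  rw [Fintype.prod_prod_type]
  rfl

/-- Bits with parameter zero may be dropped. -/
theorem bexp_extend (g : β → ι) (hg : Function.Injective g) (p : ι → ℝ)
    (hp : ∀ i, i ∉ Set.range g → p i = 0) (F : (ι → Bool) → ℝ) :
    bexp p F = bexp (fun b => p (g b)) fun t => F (Function.extend g t fun _ => false) := by
  unfold bexp
  symm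
  refine Fintype.sum_of_injective (fun t => Function.extend g t fun _ => false) ?_ _ _ ?_ ?_
  · intro t t' h
    funext b
    have := congrFun h (g b)
    simpa [hg.extend_apply] using this
  · intro s hs
    have : ∃ i, i ∉ Set.range g ∧ s i = true := by
      by_contra! hcon
      refine hs ⟨fun b => s (g b), ?_⟩
      funext i
      by_cases hi : i ∈ Set.range g
      · obtain ⟨b, rfl⟩ := hi
        simp [hg.extend_apply]
      · simp only
        rw [Function.extend_apply' _ _ _ (by simpa using hi)]
        have := hcon i hi
        simpa using this.symm
    obtain ⟨i, hi, hsi⟩ := this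
    rw [Finset.prod_eq_zero (Finset.mem_univ i), zero_mul]
    simp [bern, hsi, hp i hi]
  · intro t
    congr 1
    refine Fintype.prod_of_injective g hg _ _ ?_ ?_
    · intro i hi
      rw [Function.extend_apply' _ _ _ (by simpa using hi), hp i hi]
      simp [bern]
    · intro b
      rw [hg.extend_apply]

theorem bexp_le_one {p : ι → ℝ} (h0 : ∀ i, 0 ≤ p i) (h1 : ∀ i, p i ≤ 1) {F : (ι → Bool) → ℝ}
    (hF : ∀ s, F s ≤ 1) : bexp p F ≤ 1 := by
  rw [← sum_prod_bern p]
  exact Finset.sum_le_sum fun s _ => mul_le_of_le_one_right (prod_bern_nonneg h0 h1 s) (hF s)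

theorem bexp_nonneg {p : ι → ℝ} (h0 : ∀ i, 0 ≤ p i) (h1 : ∀ i, p i ≤ 1) {F : (ι → Bool) → ℝ}
    (hF : ∀ s, 0 ≤ F s) : 0 ≤ bexp p F :=
  Finset.sum_nonneg fun s _ => mul_nonneg (prod_bern_nonneg h0 h1 s) (hF s)

theorem bexp_mono {p : ι → ℝ} (h0 : ∀ i, 0 ≤ p i) (h1 : ∀ i, p i ≤ 1) {F G : (ι → Bool) → ℝ}
    (hF : ∀ s, F s ≤ G s) : bexp p F ≤ bexp p G :=
  Finset.sum_le_sum fun s _ => mul_le_mul_of_nonneg_left (hF s) (prod_bern_nonneg h0 h1 s)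

/-- Expectations of `[0,1]`-valued functions depend Lipschitz continuously on the parameters. -/
theorem abs_bexp_sub_bexp_le {n : ℕ} (a b : Fin n → ℝ) (ha0 : ∀ i, 0 ≤ a i) (ha1 : ∀ i, a i ≤ 1)
    (hb0 : ∀ i, 0 ≤ b i) (hb1 : ∀ i, b i ≤ 1) (F : (Fin n → Bool) → ℝ)
    (hF0 : ∀ s, 0 ≤ F s) (hF1 : ∀ s, F s ≤ 1) :
    |bexp a F - bexp b F| ≤ ∑ i, |a i - b i| := by
  induction n with
  | zero => simp [bexp]
  | succ n ih =>
    -- Condition on the first bit.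
    have key : ∀ c : Fin (n + 1) → ℝ, bexp c F =
        c 0 * bexp (fun i => c i.succ) (fun s => F (Fin.cons true s)) +
          (1 - c 0) * bexp (fun i => c i.succ) (fun s => F (Fin.cons false s)) := by
      intro c
      unfold bexp
      rw [← (Fin.consEquiv fun _ => Bool).sum_comp, Fintype.sum_prod_type]
      simp only [Fintype.sum_bool, Fin.prod_univ_succ, Finset.mul_sum, Fin.consEquiv_apply,
        Fin.cons_zero, Fin.cons_succ]
      congr 1 <;> exact Finset.sum_congr rfl fun _ _ => by simp [bern, Fin.consEquiv]; ring
    rw [key a, key b, Fin.sum_univ_succ]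
    have h1 := ih (fun i => a i.succ) (fun i => b i.succ) (fun i => ha0 _) (fun i => ha1 _)
      (fun i => hb0 _) (fun i => hb1 _) (fun s => F (Fin.cons true s)) (fun s => hF0 _)
      (fun s => hF1 _)
    have h2 := ih (fun i => a i.succ) (fun i => b i.succ) (fun i => ha0 _) (fun i => ha1 _)
      (fun i => hb0 _) (fun i => hb1 _) (fun s => F (Fin.cons false s)) (fun s => hF0 _)
      (fun s => hF1 _)
    set X := bexp (fun i => a i.succ) (fun s => F (Fin.cons true s))
    set Y := bexp (fun i => a i.succ) (fun s => F (Fin.cons false s))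
    set X' := bexp (fun i => b i.succ) (fun s => F (Fin.cons true s)) with hX'
    set Y' := bexp (fun i => b i.succ) (fun s => F (Fin.cons false s)) with hY'
    have hX0 : 0 ≤ X' := bexp_nonneg (fun i => hb0 _) (fun i => hb1 _) (fun s => hF0 _)
    have hX1 : X' ≤ 1 := bexp_le_one (fun i => hb0 _) (fun i => hb1 _) (fun s => hF1 _)
    have hY0 : 0 ≤ Y' := bexp_nonneg (fun i => hb0 _) (fun i => hb1 _) (fun s => hF0 _)
    have hY1 : Y' ≤ 1 := bexp_le_one (fun i => hb0 _) (fun i => hb1 _) (fun s => hF1 _)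
    set D := ∑ i : Fin n, |a i.succ - b i.succ|
    have e : a 0 * X + (1 - a 0) * Y - (b 0 * X' + (1 - b 0) * Y') =
      (a 0 - b 0) * (X' - Y') + (a 0 * (X - X') + (1 - a 0) * (Y - Y')) := by ring
    rw [e]
    refine (abs_add_le _ _).trans (add_le_add ?_ ?_)
    · rw [abs_mul]
      refine mul_le_of_le_one_right (abs_nonneg _) ?_
      rw [abs_le]; constructor <;> linarith
    · refine (abs_add_le _ _).trans ?_
      rw [abs_mul, abs_mul, abs_of_nonneg (ha0 0), abs_of_nonneg (sub_nonneg.2 (ha1 0))]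
      nlinarith [ha0 0, ha1 0]

end

/-! ### Amplitude estimation from independent Bernoulli samples -/

/-- The Bhattacharyya coefficient of the Bernoulli distributions with parameters `a` and `b`. -/
def bhatt (a b : ℝ) : ℝ := √(a * b) + √((1 - a) * (1 - b))

theorem bhatt_nonneg (a b : ℝ) : 0 ≤ bhatt a b := by unfold bhatt; positivity

theorem bhatt_le {a b : ℝ} (ha0 : 0 ≤ a) (ha1 : a ≤ 1) (hb0 : 0 ≤ b) (hb1 : b ≤ 1) :
    bhatt a b ≤ 1 - (a - b) ^ 2 / 2 := by
  unfold bhatt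
  rw [Real.sqrt_mul ha0, Real.sqrt_mul (sub_nonneg.2 ha1)]
  have h1 := Real.sq_sqrt ha0
  have h2 := Real.sq_sqrt hb0
  have h3 := Real.sq_sqrt (sub_nonneg.2 ha1)
  have h4 := Real.sq_sqrt (sub_nonneg.2 hb1)
  have p1 := Real.sqrt_nonneg a
  have p2 := Real.sqrt_nonneg b
  have p3 := Real.sqrt_nonneg (1 - a)
  have p4 := Real.sqrt_nonneg (1 - b)
  set u := √a
  set u' := √b
  set v := √(1 - a)
  set v' := √(1 - b)
  have hab : a - b = (u * v' - u' * v) * (u * v' + u' * v) := by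
    have : (u * v' - u' * v) * (u * v' + u' * v) = u ^ 2 * v' ^ 2 - u' ^ 2 * v ^ 2 := by ring
    rw [this, h1, h2, h3, h4]; ring
  have lag : (u * u' + v * v') ^ 2 + (u * v' - u' * v) ^ 2 = 1 := by
    have : (u * u' + v * v') ^ 2 + (u * v' - u' * v) ^ 2 = (u ^ 2 + v ^ 2) * (u' ^ 2 + v' ^ 2) := by
      ring
    rw [this, h1, h2, h3, h4]; ring
  have lag2 : (u * v' + u' * v) ^ 2 + (u * u' - v * v') ^ 2 = 1 := by
    have : (u * v' + u' * v) ^ 2 + (u * u' - v * v') ^ 2 = (u ^ 2 + v ^ 2) * (u' ^ 2 + v' ^ 2) := by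
      ring
    rw [this, h1, h2, h3, h4]; ring
  have hle : (a - b) ^ 2 ≤ (u * v' - u' * v) ^ 2 := by
    rw [hab, mul_pow]
    exact mul_le_of_le_one_right (sq_nonneg _) (by nlinarith [sq_nonneg (u * u' - v * v')])
  have hb : u * u' + v * v' ≤ 1 := by nlinarith [sq_nonneg (u * v' - u' * v)]
  nlinarith [mul_nonneg p1 p2, mul_nonneg p3 p4]

/-- The affinity of two product distributions is the product of the Bhattacharyya
coefficients. -/
theorem sum_sqrt_prod_bern {n : ℕ} (a b : Fin n → ℝ) (ha0 : ∀ i, 0 ≤ a i) (ha1 : ∀ i, a i ≤ 1)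
    (hb0 : ∀ i, 0 ≤ b i) (hb1 : ∀ i, b i ≤ 1) :
    ∑ x : Fin n → Bool, √((∏ i, bern (a i) (x i)) * ∏ i, bern (b i) (x i)) =
      ∏ i, bhatt (a i) (b i) := by
  have : ∀ x : Fin n → Bool, √((∏ i, bern (a i) (x i)) * ∏ i, bern (b i) (x i)) =
      ∏ i, √(bern (a i) (x i) * bern (b i) (x i)) := by
    intro x
    rw [← Finset.prod_mul_distrib, Real.sqrt_prod]
    exact fun i _ => mul_nonneg (bern_nonneg (ha0 i) (ha1 i) _) (bern_nonneg (hb0 i) (hb1 i) _)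
  simp_rw [this]
  rw [sum_prod_eq_prod_sum (fun i c => √(bern (a i) c * bern (b i) c))]
  simp [bern, bhatt]

/-- Error bound for the maximum likelihood estimator over a finite family of distributions. -/
theorem sum_likelihood_le {G X : Type} [Fintype G] [Fintype X] (P : G → X → ℝ)
    (hP : ∀ g x, 0 ≤ P g x) (est : X → G) (hest : ∀ g x, P g x ≤ P (est x) x) (g₀ : G)
    (bad : G → Prop) [DecidablePred bad] :
    ∑ x, P g₀ x * (if bad (est x) then 1 else 0) ≤
      ∑ g, if bad g then ∑ x, √(P g x * P g₀ x) else 0 := by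
  have h : ∀ x, P g₀ x * (if bad (est x) then 1 else 0) ≤
      ∑ g, if bad g then √(P g x * P g₀ x) else 0 := by
    intro x
    have hpos : ∀ g, 0 ≤ if bad g then √(P g x * P g₀ x) else 0 := by
      intro g; split_ifs <;> positivity
    split_ifs with hb
    · refine le_trans ?_ (Finset.single_le_sum (fun g _ => hpos g) (Finset.mem_univ (est x)))
      rw [if_pos hb, mul_one]
      apply Real.le_sqrt_of_sq_le
      rw [sq]
      exact mul_le_mul_of_nonneg_right (hest g₀ x) (hP g₀ x)
    · rw [mul_zero]; exact Finset.sum_nonneg fun g _ => hpos g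
  refine (Finset.sum_le_sum fun x _ => h x).trans (le_of_eq ?_)
  rw [Finset.sum_comm]
  refine Finset.sum_congr rfl fun g _ => ?_
  split_ifs <;> simp

/-- First moment method: some sequence in `Fin L` does at least as well as the average one. -/
theorem exists_seq_sum_prod_le {R : Type} (T : Finset R) {L S : ℕ} (hL : 0 < L)
    (β : R → Fin L → ℝ) (hβ : ∀ g k, 0 ≤ β g k) (c : ℝ) (hc : ∀ g ∈ T, ∑ k, β g k ≤ c * L) :
    ∃ M : Fin S → Fin L, ∑ g ∈ T, ∏ s, β g (M s) ≤ T.card * c ^ S := by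
  have hL' : (0 : ℝ) < L := by exact_mod_cast hL
  have : Nonempty (Fin L) := ⟨⟨0, hL⟩⟩
  have key : ∑ M : Fin S → Fin L, ∑ g ∈ T, ∏ s, β g (M s) ≤
      ∑ _M : Fin S → Fin L, (T.card * c ^ S : ℝ) := by
    rw [Finset.sum_comm, Finset.sum_const, Finset.card_univ, Fintype.card_fun, Fintype.card_fin,
      Fintype.card_fin, nsmul_eq_mul]
    refine (Finset.sum_le_sum (g := fun _ => (c * L) ^ S) fun g hg => ?_).trans (le_of_eq ?_)
    · rw [sum_prod_eq_prod_sum (fun (_ : Fin S) k => β g k), Finset.prod_const, Finset.card_univ,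
        Fintype.card_fin]
      exact pow_le_pow_left₀ (Finset.sum_nonneg fun k _ => hβ g k) (hc g hg) S
    · rw [Finset.sum_const, nsmul_eq_mul, mul_pow]; push_cast; ring
  obtain ⟨M, -, hM⟩ := Finset.exists_le_of_sum_le Finset.univ_nonempty key
  exact ⟨M, hM⟩

theorem sum_cos_odd (L : ℕ) (x : ℝ) :
    (∑ k ∈ Finset.range L, Real.cos ((2 * k + 1) * x)) * (2 * Real.sin x) =
      Real.sin (2 * L * x) := by
  induction L with
  | zero => simp
  | succ L ih =>
    rw [Finset.sum_range_succ, add_mul, ih]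
    have h1 : 2 * ((L + 1 : ℕ) : ℝ) * x = (2 * L + 1) * x + x := by push_cast; ring
    have h2 : 2 * (L : ℝ) * x = (2 * L + 1) * x - x := by ring
    rw [h1, h2, Real.sin_add, Real.sin_sub]; ring

theorem abs_sum_cos_odd_le (L : ℕ) {x ε : ℝ} (hε : 0 < ε) (hx : ε ≤ |Real.sin x|) :
    |∑ k ∈ Finset.range L, Real.cos ((2 * k + 1) * x)| ≤ 1 / (2 * ε) := by
  have h := congrArg abs (sum_cos_odd L x)
  rw [abs_mul, abs_mul, abs_two] at h
  have h1 := Real.abs_sin_le_one (2 * L * x)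
  rw [le_div_iff₀ (by positivity)]
  nlinarith [abs_nonneg (∑ k ∈ Finset.range L, Real.cos ((2 * k + 1) * x))]

theorem sin_sq_sub_sin_sq (x y : ℝ) :
    Real.sin x ^ 2 - Real.sin y ^ 2 = Real.sin (x + y) * Real.sin (x - y) := by
  rw [Real.sin_add, Real.sin_sub]
  have h1 := Real.sin_sq_add_cos_sq x
  have h2 := Real.sin_sq_add_cos_sq y
  linear_combination (Real.sin x ^ 2) * (-h2) + (Real.sin y ^ 2) * h1

/-- On average over the odd multiples, the outcome probabilities of two angles differ by a
constant. The range `[0, π/6]` excludes the aliases of an angle under odd multiplication. -/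
theorem sum_sq_sin_sq_sub_ge {θ θ' ε : ℝ} (h0 : 0 ≤ θ) (h1 : θ ≤ Real.pi / 6) (h0' : 0 ≤ θ')
    (h1' : θ' ≤ Real.pi / 6) (hε : 0 < ε) (hd : ε ≤ |Real.sin θ ^ 2 - Real.sin θ' ^ 2|) {L : ℕ}
    (hL : 5 / ε ≤ L) :
    (L : ℝ) / 16 ≤ ∑ k ∈ Finset.range L,
      (Real.sin ((2 * k + 1) * θ) ^ 2 - Real.sin ((2 * k + 1) * θ') ^ 2) ^ 2 := by
  wlog hle : θ' ≤ θ generalizing θ θ'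
  · have := this h0' h1' h0 h1 (by rwa [abs_sub_comm]) (le_of_not_ge hle)
    refine this.trans (le_of_eq (Finset.sum_congr rfl fun k _ => by ring))
  have hpi := Real.pi_pos
  -- Expanded into cosines of `(2 k + 1) x`, the square has the mean `1 / 4`, and the sums of the
  -- cosines are bounded, except for `x = 4 θ'`: this angle may vanish, but its term is
  -- at least `-1 / 8`.
  have hexp : ∀ k : ℕ,
      (Real.sin ((2 * k + 1) * θ) ^ 2 - Real.sin ((2 * k + 1) * θ') ^ 2) ^ 2 =
      1 / 4 * (1 + 1 / 2 * Real.cos ((2 * k + 1) * (4 * θ))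
        + 1 / 2 * Real.cos ((2 * k + 1) * (4 * θ'))
        - Real.cos ((2 * k + 1) * (2 * θ + 2 * θ')) - Real.cos ((2 * k + 1) * (2 * θ - 2 * θ'))) := by
    intro k
    have e1 : (2 * k + 1) * (4 * θ) = 2 * (2 * ((2 * k + 1) * θ)) := by ring
    have e2 : (2 * k + 1) * (4 * θ') = 2 * (2 * ((2 * k + 1) * θ')) := by ring
    have e3 : (2 * k + 1) * (2 * θ + 2 * θ') = 2 * ((2 * k + 1) * θ) + 2 * ((2 * k + 1) * θ') := by
      ring
    have e4 : (2 * k + 1) * (2 * θ - 2 * θ') = 2 * ((2 * k + 1) * θ) - 2 * ((2 * k + 1) * θ') := by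
      ring
    rw [e1, e2, e3, e4, Real.cos_add, Real.cos_sub, Real.cos_two_mul (2 * _),
      Real.cos_two_mul (2 * ((2 * k + 1) * θ')), Real.sin_sq, Real.sin_sq]
    have f1 := Real.cos_two_mul ((2 * k + 1) * θ)
    have f2 := Real.cos_two_mul ((2 * k + 1) * θ')
    rw [f1, f2]; ring
  simp_rw [hexp]
  rw [← Finset.mul_sum, Finset.sum_sub_distrib, Finset.sum_sub_distrib, Finset.sum_add_distrib,
    Finset.sum_add_distrib, ← Finset.mul_sum, ← Finset.mul_sum]
  rw [sin_sq_sub_sin_sq, abs_mul] at hd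
  have hcos : ∀ {x : ℝ}, |x| ≤ Real.pi / 3 → 1 / 2 ≤ Real.cos x := by
    intro x hx
    rw [← Real.cos_pi_div_three, ← Real.cos_abs x]
    exact Real.cos_le_cos_of_nonneg_of_le_pi (abs_nonneg _) (by linarith) hx
  have s1 : ε ≤ |Real.sin (θ + θ')| := by
    nlinarith [Real.abs_sin_le_one (θ - θ'), abs_nonneg (Real.sin (θ + θ'))]
  have s2 : ε ≤ |Real.sin (θ - θ')| := by
    nlinarith [Real.abs_sin_le_one (θ + θ'), abs_nonneg (Real.sin (θ - θ'))]
  -- Doubling an angle of size at most `π / 3` does not decrease its sine.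
  have dbl : ∀ {x : ℝ}, |x| ≤ Real.pi / 3 → ε ≤ |Real.sin x| → ε ≤ |Real.sin (2 * x)| := by
    intro x hx hs
    rw [Real.sin_two_mul, abs_mul, abs_mul, abs_two]
    have := (hcos hx).trans (le_abs_self _)
    nlinarith [abs_nonneg (Real.sin x)]
  have t1 : ε ≤ |Real.sin (2 * θ + 2 * θ')| := by
    rw [← mul_add]; exact dbl (by rw [abs_of_nonneg] <;> linarith) s1
  have t2 : ε ≤ |Real.sin (2 * θ - 2 * θ')| := by
    rw [← mul_sub]; exact dbl (by rw [abs_of_nonneg] <;> linarith) s2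
  have t3 : ε ≤ |Real.sin (4 * θ)| := by
    have : 4 * θ = 2 * (2 * θ) := by ring
    rw [this]
    refine dbl (by rw [abs_of_nonneg] <;> linarith) (s1.trans ?_)
    rw [abs_of_nonneg (Real.sin_nonneg_of_nonneg_of_le_pi (by linarith) (by linarith)),
      abs_of_nonneg (Real.sin_nonneg_of_nonneg_of_le_pi (by linarith) (by linarith))]
    exact Real.sin_le_sin_of_le_of_le_pi_div_two (by linarith) (by linarith) (by linarith)
  have b1 := abs_le.1 (abs_sum_cos_odd_le L hε t1)
  have b2 := abs_le.1 (abs_sum_cos_odd_le L hε t2)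
  have b3 := abs_le.1 (abs_sum_cos_odd_le L hε t3)
  have b4 : -(L : ℝ) ≤ ∑ k ∈ Finset.range L, Real.cos ((2 * k + 1) * (4 * θ')) := by
    have := Finset.sum_le_sum (s := Finset.range L) (f := fun _ => (-1 : ℝ))
      (g := fun k : ℕ => Real.cos ((2 * k + 1) * (4 * θ'))) fun k _ => Real.neg_one_le_cos _
    simpa using this
  have hone : ∑ _k ∈ Finset.range L, (1 : ℝ) = L := by simp
  rw [hone]
  have hL2 : 1 / (2 * ε) = 5 / ε / 10 := by field_simp; norm_num
  rw [hL2] at b1 b2 b3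
  linarith [b1.1, b1.2, b2.1, b2.2, b3.1, b3.2]

theorem sum_bhatt_le {θ θ' ε : ℝ} (h0 : 0 ≤ θ) (h1 : θ ≤ Real.pi / 6) (h0' : 0 ≤ θ')
    (h1' : θ' ≤ Real.pi / 6) (hε : 0 < ε) (hd : ε ≤ |Real.sin θ ^ 2 - Real.sin θ' ^ 2|) {L : ℕ}
    (hL : 5 / ε ≤ L) :
    ∑ k : Fin L, bhatt (Real.sin ((2 * (k : ℕ) + 1) * θ) ^ 2)
      (Real.sin ((2 * (k : ℕ) + 1) * θ') ^ 2) ≤ 31 / 32 * L := by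
  rw [Fin.sum_univ_eq_sum_range (fun k : ℕ => bhatt (Real.sin ((2 * (k : ℕ) + 1) * θ) ^ 2)
      (Real.sin ((2 * (k : ℕ) + 1) * θ') ^ 2))]
  have h := sum_sq_sin_sq_sub_ge h0 h1 h0' h1' hε hd hL
  refine (Finset.sum_le_sum fun k _ =>
    bhatt_le (sq_nonneg _) (Real.sin_sq_le_one _) (sq_nonneg _) (Real.sin_sq_le_one _)).trans ?_
  rw [Finset.sum_sub_distrib, ← Finset.sum_div]
  simp only [Finset.sum_const, Finset.card_range, nsmul_eq_mul, mul_one]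
  linarith

theorem abs_sin_sq_sub_sin_sq_le (x y : ℝ) :
    |Real.sin x ^ 2 - Real.sin y ^ 2| ≤ |x - y| := by
  rw [sin_sq_sub_sin_sq, abs_mul]
  refine (mul_le_of_le_one_left (abs_nonneg _) (Real.abs_sin_le_one _)).trans ?_
  exact Real.abs_sin_le_abs

/-- Angles `θ ∈ [0, π/6]` can be told apart from independent bits with parameters
`sin² ((2 k + 1) θ)`, for a fixed sequence of `O(J)` numbers `k = O(2 ^ J)`: the quantity `sin² θ`
is found to accuracy `2 ^ (-J)` with probability at least `1 - η`. The estimator is the maximum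
likelihood estimator over a grid of angles. -/
theorem exists_phase_estimator {η : ℝ} (hη : 0 < η) :
    ∃ a : ℕ, ∀ J : ℕ, ∃ (S : ℕ) (k : Fin S → ℕ) (est : (Fin S → Bool) → ℝ),
      S ≤ a * (J + 1) ∧ (∀ s, k s < 2 ^ (J + 4)) ∧
      ∀ θ : ℝ, 0 ≤ θ → θ ≤ Real.pi / 6 →
        bexp (fun s => Real.sin ((2 * (k s : ℝ) + 1) * θ) ^ 2)
          (fun x => if |est x - Real.sin θ ^ 2| ≤ (1 / 2) ^ J then 0 else 1) ≤ η := by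
  classical
  obtain ⟨u, hu⟩ := exists_pow_lt_of_lt_one (half_pos hη) (by norm_num : (1 / 2 : ℝ) < 1)
  refine ⟨22 * (5 * u + 68), fun J => ?_⟩
  -- The grid has `2 ^ H + 1` points; `22` samples halve the affinity of two distant grid points.
  obtain ⟨H, hH⟩ : ∃ H, H = 3 * J + (2 * u + 30) := ⟨_, rfl⟩
  obtain ⟨S, hS⟩ : ∃ S, S = 22 * (2 * H + 2 + u) := ⟨_, rfl⟩
  have hpi := Real.pi_pos
  have hpi4 := Real.pi_le_four
  have h2H : (0 : ℝ) < 2 ^ H := by positivity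
  set L : ℕ := 2 ^ (J + 4) with hL
  set ε : ℝ := (1 / 2) ^ J / 2 with hε
  have hε0 : 0 < ε := by positivity
  have h5 : 5 / ε ≤ L := by
    rw [hε, hL, div_le_iff₀ (by positivity), one_div, inv_pow]
    push_cast
    rw [pow_add]
    have : (2 : ℝ) ^ J * (2 ^ J)⁻¹ = 1 := mul_inv_cancel₀ (by positivity)
    nlinarith
  let ang : Fin (2 ^ H + 1) → ℝ := fun g => (g : ℕ) * (Real.pi / 6) / 2 ^ H
  have ang0 : ∀ g, 0 ≤ ang g := fun g => by positivity
  have ang1 : ∀ g, ang g ≤ Real.pi / 6 := by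
    intro g
    have : ((g : ℕ) : ℝ) ≤ 2 ^ H := by
      have := g.2
      exact_mod_cast Nat.lt_succ_iff.1 this
    simp only [ang]
    rw [div_le_iff₀ h2H]
    nlinarith
  let T : Finset (Fin (2 ^ H + 1) × Fin (2 ^ H + 1)) :=
    Finset.univ.filter fun g => ε ≤ |Real.sin (ang g.1) ^ 2 - Real.sin (ang g.2) ^ 2|
  -- A fixed choice of `S` multiples that tells apart all pairs of grid points with distant values.
  obtain ⟨M, hM⟩ := exists_seq_sum_prod_le (S := S) T (L := L) (by positivity)
    (fun g k => bhatt (Real.sin ((2 * (k : ℕ) + 1) * ang g.1) ^ 2)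
      (Real.sin ((2 * (k : ℕ) + 1) * ang g.2) ^ 2)) (fun _ _ => bhatt_nonneg _ _) (31 / 32)
    (fun g hg => sum_bhatt_le (ang0 _) (ang1 _) (ang0 _) (ang1 _) hε0
      (Finset.mem_filter.1 hg).2 h5)
  have hsmall : (T.card : ℝ) * (31 / 32) ^ S ≤ η / 2 := by
    have hcard : (T.card : ℝ) ≤ (2 ^ H + 1) * (2 ^ H + 1) := by
      have := Finset.card_le_univ T
      rw [Fintype.card_prod, Fintype.card_fin] at this
      exact_mod_cast this
    have h22 : (31 / 32 : ℝ) ^ S ≤ (1 / 2) ^ (2 * H + 2 + u) := by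
      rw [hS, pow_mul]
      exact pow_le_pow_left₀ (by positivity) (by norm_num) _
    have h1H : (1 : ℝ) ≤ 2 ^ H := one_le_pow₀ (by norm_num)
    calc (T.card : ℝ) * (31 / 32) ^ S
        ≤ ((2 ^ H + 2 ^ H) * (2 ^ H + 2 ^ H)) * (1 / 2) ^ (2 * H + 2 + u) := by
          refine mul_le_mul (hcard.trans ?_) h22 (by positivity) (by positivity)
          gcongr
      _ = (1 / 2) ^ u := by
          rw [pow_add, pow_add, two_mul H, pow_add, one_div_pow, one_div_pow]
          field_simp
          ring
      _ ≤ η / 2 := hu.le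
  let par : Fin (2 ^ H + 1) → Fin S → ℝ :=
    fun g s => Real.sin ((2 * ((M s : ℕ) : ℝ) + 1) * ang g) ^ 2
  have par0 : ∀ g s, 0 ≤ par g s := fun _ _ => sq_nonneg _
  have par1 : ∀ g s, par g s ≤ 1 := fun _ _ => Real.sin_sq_le_one _
  let P : Fin (2 ^ H + 1) → (Fin S → Bool) → ℝ := fun g x => ∏ s, bern (par g s) (x s)
  have hmax : ∀ x, ∃ g, ∀ g', P g' x ≤ P g x := fun x => Finite.exists_max fun g => P g x
  choose ml hml using hmax
  refine ⟨S, fun s => M s, fun x => Real.sin (ang (ml x)) ^ 2, ?_, fun s => (M s).2, ?_⟩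
  · rw [hS, hH]; nlinarith
  intro θ hθ0 hθ1
  -- the grid point below `θ`
  have hfl : ⌊θ * 2 ^ H / (Real.pi / 6)⌋₊ < 2 ^ H + 1 := by
    rw [Nat.lt_succ_iff]
    refine Nat.floor_le_of_le ?_
    push_cast
    rw [div_le_iff₀ (by positivity)]
    nlinarith
  let g₀ : Fin (2 ^ H + 1) := ⟨_, hfl⟩
  have hclose : |θ - ang g₀| ≤ 1 / 2 ^ H := by
    have f1 := Nat.floor_le (a := θ * 2 ^ H / (Real.pi / 6)) (by positivity)
    have f2 := Nat.lt_floor_add_one (θ * 2 ^ H / (Real.pi / 6))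
    have e1 : ang g₀ = ⌊θ * 2 ^ H / (Real.pi / 6)⌋₊ * (Real.pi / 6) / 2 ^ H := rfl
    rw [le_div_iff₀ (by positivity)] at f1
    rw [div_lt_iff₀ (by positivity)] at f2
    rw [abs_le, e1]
    constructor
    · rw [neg_le_sub_iff_le_add, div_le_iff₀ h2H, add_mul, one_div, inv_mul_cancel₀ h2H.ne']
      linarith
    · rw [sub_le_iff_le_add, ← add_div, le_div_iff₀ h2H]
      linarith
  -- The true angle may be replaced with the grid point at the cost `η / 2`.
  have htv := abs_bexp_sub_bexp_le (fun s => Real.sin ((2 * ((M s : ℕ) : ℝ) + 1) * θ) ^ 2)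
    (par g₀) (fun _ => sq_nonneg _) (fun _ => Real.sin_sq_le_one _) (par0 _) (par1 _)
    (fun x => if |Real.sin (ang (ml x)) ^ 2 - Real.sin θ ^ 2| ≤ (1 / 2) ^ J then 0 else 1)
    (fun x => by positivity) (fun x => by split_ifs <;> norm_num)
  have htv2 : ∑ s, |Real.sin ((2 * ((M s : ℕ) : ℝ) + 1) * θ) ^ 2 - par g₀ s| ≤ η / 2 := by
    have : ∀ s, |Real.sin ((2 * ((M s : ℕ) : ℝ) + 1) * θ) ^ 2 - par g₀ s| ≤
        2 ^ (J + 5) / 2 ^ H := by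
      intro s
      refine (abs_sin_sq_sub_sin_sq_le _ _).trans ?_
      rw [← mul_sub, abs_mul, abs_of_nonneg (by positivity), div_eq_mul_one_div]
      refine mul_le_mul ?_ hclose (abs_nonneg _) (by positivity)
      have h1 : (M s : ℕ) + 1 ≤ 2 ^ (J + 4) := (M s).2
      have h2 : (((M s : ℕ) : ℝ)) + 1 ≤ 2 ^ (J + 4) := by exact_mod_cast h1
      have h3 : (2 : ℝ) ^ (J + 5) = 2 * 2 ^ (J + 4) := by ring
      linarith
    refine (Finset.sum_le_sum fun s _ => this s).trans ?_
    rw [Finset.sum_const, Finset.card_univ, Fintype.card_fin, nsmul_eq_mul]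
    refine le_trans ?_ hu.le
    rw [← mul_div_assoc, div_le_iff₀ h2H]
    have hJ : (J : ℝ) + 1 ≤ 2 ^ J := by exact_mod_cast Nat.lt_two_pow_self
    have hU : (u : ℝ) + 1 ≤ 2 ^ u := by exact_mod_cast Nat.lt_two_pow_self
    have e1 : (S : ℝ) = 22 * (6 * J + 5 * u + 62) := by
      rw [hS, hH]; push_cast; ring
    have e2 : (1 / 2 : ℝ) ^ u * 2 ^ H = 2 ^ J * (2 ^ J * 2 ^ J * 2 ^ u * 2 ^ 30) := by
      rw [hH, one_div_pow, pow_add, pow_add, pow_mul', pow_mul' (2 : ℝ) 2 u]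
      field_simp
    rw [e1, e2]
    have e3 : (2 : ℝ) ^ (J + 5) = 2 ^ J * 32 := by rw [pow_add]; norm_num
    rw [e3]
    have h1J : (1 : ℝ) ≤ 2 ^ J := one_le_pow₀ (by norm_num)
    have h1U : (1 : ℝ) ≤ 2 ^ u := one_le_pow₀ (by norm_num)
    have m1 : (1 : ℝ) * 2 ^ J ≤ 2 ^ u * 2 ^ J := mul_le_mul_of_nonneg_right h1U (by positivity)
    have m2 : (2 : ℝ) ^ u * 1 ≤ 2 ^ u * 2 ^ J := mul_le_mul_of_nonneg_left h1J (by positivity)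
    have m3 : (2 : ℝ) ^ u * 2 ^ J * 1 ≤ 2 ^ u * 2 ^ J * 2 ^ J :=
      mul_le_mul_of_nonneg_left h1J (by positivity)
    have key : 22 * (6 * (J : ℝ) + 5 * u + 62) * 32 ≤ 2 ^ J * 2 ^ J * 2 ^ u * 2 ^ 30 := by
      have : (2 : ℝ) ^ J * 2 ^ J * 2 ^ u * 2 ^ 30 = 2 ^ u * 2 ^ J * 2 ^ J * 2 ^ 30 := by ring
      rw [this]
      norm_num
      nlinarith
    calc 22 * (6 * (J : ℝ) + 5 * u + 62) * (2 ^ J * 32)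
        = 2 ^ J * (22 * (6 * (J : ℝ) + 5 * u + 62) * 32) := by ring
      _ ≤ _ := mul_le_mul_of_nonneg_left key (by positivity)
  have hgrid : |Real.sin (ang g₀) ^ 2 - Real.sin θ ^ 2| ≤ ε := by
    refine (abs_sin_sq_sub_sin_sq_le _ _).trans ?_
    rw [abs_sub_comm]
    refine hclose.trans ?_
    rw [hε, ← one_div_pow, hH]
    have : (1 / 2 : ℝ) ^ (3 * J + (2 * u + 30)) ≤ (1 / 2) ^ (J + 1) :=
      pow_le_pow_of_le_one (by norm_num) (by norm_num) (by omega)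
    refine this.trans (le_of_eq ?_)
    ring
  -- At the grid point, an error means that a distant grid point is at least as likely.
  have hlik := sum_likelihood_le P (fun g x => prod_bern_nonneg (par0 g) (par1 g) x) ml
    (fun g x => hml x g) g₀ (fun g => (g, g₀) ∈ T)
  have hlik2 : (∑ g, if (g, g₀) ∈ T then ∑ x, √(P g x * P g₀ x) else 0) ≤ η / 2 := by
    refine le_trans ?_ (hM.trans hsmall)
    have e : ∀ g, ∑ x, √(P g x * P g₀ x) = ∏ s, bhatt (par g s) (par g₀ s) := fun g =>
      sum_sqrt_prod_bern _ _ (par0 g) (par1 g) (par0 g₀) (par1 g₀)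
    simp_rw [e]
    rw [← Finset.sum_filter]
    refine le_trans (le_of_eq ?_) (Finset.sum_le_sum_of_subset_of_nonneg
      (s := (Finset.univ.filter fun g => (g, g₀) ∈ T).image fun g => (g, g₀)) ?_ ?_)
    · rw [Finset.sum_image (fun a _ b _ h => (Prod.ext_iff.1 h).1)]
    · intro q hq
      obtain ⟨g, hg, rfl⟩ := Finset.mem_image.1 hq
      exact (Finset.mem_filter.1 hg).2
    · intro q _ _
      exact Finset.prod_nonneg fun s _ => bhatt_nonneg _ _
  have hmono : bexp (par g₀)
      (fun x => if |Real.sin (ang (ml x)) ^ 2 - Real.sin θ ^ 2| ≤ (1 / 2) ^ J then 0 else 1) ≤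
      ∑ x, P g₀ x * (if (ml x, g₀) ∈ T then 1 else 0) := by
    unfold bexp
    refine Finset.sum_le_sum fun x _ => ?_
    refine mul_le_mul_of_nonneg_left ?_ (prod_bern_nonneg (par0 g₀) (par1 g₀) x)
    beta_reduce
    by_cases ha : |Real.sin (ang (ml x)) ^ 2 - Real.sin θ ^ 2| ≤ (1 / 2) ^ J
    · rw [if_pos ha]; split_ifs <;> norm_num
    rw [if_neg ha, if_pos]
    rw [Finset.mem_filter]
    refine ⟨Finset.mem_univ _, ?_⟩
    simp only
    by_contra hcon
    push Not at ha hcon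
    have := abs_sub_le (Real.sin (ang (ml x)) ^ 2) (Real.sin (ang g₀) ^ 2) (Real.sin θ ^ 2)
    have e : (1 / 2 : ℝ) ^ J = ε + ε := by rw [hε]; ring
    rw [e] at ha
    linarith
  have := (abs_le.1 htv).2
  linarith

/-! ### Operations on an arbitrary finite set of wires -/

/-- The bit flip. -/
def xGate : U2 :=
  ⟨Matrix.of fun i j => if i = j then 0 else 1, by
    rw [Matrix.mem_unitaryGroup_iff]
    ext i j
    cases i <;> cases j <;> simp [Matrix.mul_apply, Matrix.star_apply]⟩

/-- The phase flip. -/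
def zGate : U2 :=
  ⟨Matrix.of fun i j => if i = j then (if i then -1 else 1) else 0, by
    rw [Matrix.mem_unitaryGroup_iff]
    ext i j
    cases i <;> cases j <;> simp [Matrix.mul_apply, Matrix.star_apply]⟩

/-- The rotation that turns `|0⟩` into a bit which is `1` with probability `p`
(the identity unless `0 ≤ p ≤ 1`). -/
def coinGate (p : ℝ) : U2 :=
  if h : 0 ≤ p ∧ p ≤ 1 then
    ⟨Matrix.of fun i j => if i = j then ((√(1 - p) : ℝ) : ℂ) else
        if i then ((√p : ℝ) : ℂ) else -((√p : ℝ) : ℂ), by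
      have h1 : ((√p : ℝ) : ℂ) * ((√p : ℝ) : ℂ) = p := by
        rw [← Complex.ofReal_mul, Real.mul_self_sqrt h.1]
      have h2 : ((√(1 - p) : ℝ) : ℂ) * ((√(1 - p) : ℝ) : ℂ) = 1 - p := by
        rw [← Complex.ofReal_mul, Real.mul_self_sqrt (by linarith [h.2])]; simp
      rw [Matrix.mem_unitaryGroup_iff]
      ext i j
      cases i <;> cases j <;>
        simp [Matrix.mul_apply, Matrix.star_apply, h1, h2, mul_comm]⟩
  else 1

section

variable {nv nh N : ℕ} {α β : Type}

/-- Classical reversible operations on wires `α`; `load` flips a wire if a bit of a classical datum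
is set, the others are as in `Gate`. -/
inductive COp (nv nh N : ℕ) (α : Type) : Type
  | load (k : Datum nv nh) (f : ℝ → Bool) (a : α)
  | cnot (a b : α) (hab : a ≠ b)
  | toffoli (a b c : α) (hab : a ≠ b) (hac : a ≠ c) (hbc : b ≠ c)
  | query (e : Fin (Nat.clog 2 N) ⊕ Fin nv ↪ α)
  | meanField (len : ℕ) (enc : Option (Fin nh) → ℝ → Fin len → Bool)
      (e : Fin nv ⊕ (Option (Fin nh) × Fin len) ↪ α)

/-- The operations that are needed: fixed one-qubit gates and classical reversible operations. -/
inductive Op (nv nh N : ℕ) (α : Type) : Type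
  | one (U : U2) (a : α)
  | cls (c : COp nv nh N α)

/-- Rename the wires. -/
def COp.map (e : α ↪ β) : COp nv nh N α → COp nv nh N β
  | .load k f a => .load k f (e a)
  | .cnot a b h => .cnot (e a) (e b) (e.injective.ne h)
  | .toffoli a b c h1 h2 h3 =>
      .toffoli (e a) (e b) (e c) (e.injective.ne h1) (e.injective.ne h2) (e.injective.ne h3)
  | .query i => .query (i.trans e)
  | .meanField len enc i => .meanField len enc (i.trans e)

/-- Rename the wires. -/
def Op.map (e : α ↪ β) : Op nv nh N α → Op nv nh N β
  | .one U a => .one U (e a)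
  | .cls c => .cls (c.map e)

/-- The inverse operation. -/
def Op.inv : Op nv nh N α → Op nv nh N α
  | .one U a => .one U⁻¹ a
  | .cls c => .cls c

variable [DecidableEq α] [DecidableEq β]

/-- The wires that a classical operation flips. -/
def COp.mask (I : Instance nv nh N) : COp nv nh N α → (α → Bool) → α → Bool
  | .load k f a, _ => fun t => decide (t = a) && f (I.value k)
  | .cnot a b _, s => fun t => decide (t = b) && s a
  | .toffoli a b c _ _ _, s => fun t => decide (t = c) && (s a && s b)
  | .query e, s => fun t => @decide (∃ i, e (.inr i) = t ∧
      trainingVector I.x (binValue fun k => s (e (.inl k))) i = true) (Classical.propDecidable _)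
  | .meanField _ enc e, s => fun t => @decide (∃ k, e (.inr k) = t ∧
      enc k.1 (I.clampedValue (fun i => s (e (.inl i))) k.1) k.2 = true) (Classical.propDecidable _)

/-- Action of a classical operation on basis states. -/
def COp.act (I : Instance nv nh N) (c : COp nv nh N α) (s : α → Bool) : α → Bool :=
  fun t => xor (s t) (c.mask I s t)

/-- Action of an operation on state vectors. -/
def Op.apply (I : Instance nv nh N) : Op nv nh N α → ((α → Bool) → ℂ) → (α → Bool) → ℂ
  | .one U a, ψ => fun s =>
      ∑ t : Bool, (U : Matrix Bool Bool ℂ) (s a) t * ψ (Function.update s a t)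
  | .cls c, ψ => fun s => ψ (c.act I s)

/-- Action of a list of operations, the first one acting first. -/
def run (I : Instance nv nh N) (l : List (Op nv nh N α)) (ψ : (α → Bool) → ℂ) :
    (α → Bool) → ℂ :=
  l.foldl (fun ψ g => g.apply I ψ) ψ

/-- The inverse of a list of operations. -/
def invOps (l : List (Op nv nh N α)) : List (Op nv nh N α) := (l.map Op.inv).reverse

/-- The all-zero basis state. -/
def zeroState [Fintype α] : (α → Bool) → ℂ := fun s => if s = fun _ => false then 1 else 0

/-- The gate of a circuit on `q` qubits that implements an operation. -/
def Op.toGate {q : ℕ} : Op nv nh N (Fin q) → Gate nv nh N q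
  | .one U a => .one U a
  | .cls (.load k f a) => .param k (fun x => if f x then xGate else 1) a
  | .cls (.cnot a b h) => .cnot a b h
  | .cls (.toffoli a b c h1 h2 h3) => .toffoli a b c h1 h2 h3
  | .cls (.query e) => .query e
  | .cls (.meanField len enc e) => .meanField len enc e

theorem Op.toGate_apply {q : ℕ} (I : Instance nv nh N) (g : Op nv nh N (Fin q)) (ψ : State q) :
    g.toGate.apply I ψ = g.apply I ψ := by
  have hx : ∀ (s : Config q) (a : Fin q) (v : Bool),
      Function.update s a (xor (s a) v) = fun t => xor (s t) (decide (t = a) && v) := by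
    intro s a v
    funext t
    by_cases h : t = a
    · subst h; simp
    · simp [h]
  match g with
  | .one U a => rfl
  | .cls (.load k f a) =>
    funext s
    change applyOne (if f (I.value k) then xGate else 1) a ψ s = _
    change _ = ψ (fun t => xor (s t) (decide (t = a) && f (I.value k)))
    unfold applyOne
    have hx := hx s a (f (I.value k))
    cases hf : f (I.value k)
    · rw [hf] at hx
      rw [← hx]
      cases s a <;> simp
    · rw [hf] at hx
      rw [← hx]
      cases s a <;> simp [xGate]
  | .cls (.cnot a b h) =>
    funext s
    exact congrArg ψ (hx s b (s a))
  | .cls (.toffoli a b c h1 h2 h3) =>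
    funext s
    exact congrArg ψ (hx s c (s a && s b))
  | .cls (.query e) => rfl
  | .cls (.meanField len enc e) => rfl

theorem run_nil (I : Instance nv nh N) (ψ : (α → Bool) → ℂ) : run I [] ψ = ψ := rfl

theorem run_cons (I : Instance nv nh N) (g : Op nv nh N α) (l : List (Op nv nh N α))
    (ψ : (α → Bool) → ℂ) : run I (g :: l) ψ = run I l (g.apply I ψ) := rfl

theorem run_append (I : Instance nv nh N) (l l' : List (Op nv nh N α)) (ψ : (α → Bool) → ℂ) :
    run I (l ++ l') ψ = run I l' (run I l ψ) := List.foldl_append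

theorem run_toGate {q : ℕ} (I : Instance nv nh N) (l : List (Op nv nh N (Fin q))) (ψ : State q) :
    (l.map Op.toGate).foldl (fun ψ g => g.apply I ψ) ψ = run I l ψ := by
  induction l generalizing ψ with
  | nil => rfl
  | cons g l ih => rw [List.map_cons, List.foldl_cons, Op.toGate_apply, ih]; rfl

/-! #### Locality -/

theorem COp.mask_map (I : Instance nv nh N) (e : α ↪ β) (c : COp nv nh N α) (s : β → Bool) (a : α) :
    (c.map e).mask I s (e a) = c.mask I (fun a => s (e a)) a := by
  cases c <;> simp [COp.map, COp.mask]

theorem COp.mask_map_of_notMem (I : Instance nv nh N) (e : α ↪ β) (c : COp nv nh N α)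
    (s : β → Bool) {t : β} (ht : ¬ ∃ a, e a = t) : (c.map e).mask I s t = false := by
  have h : ∀ a, t ≠ e a := fun a ha => ht ⟨a, ha.symm⟩
  have h' : ∀ a, ¬ e a = t := fun a ha => ht ⟨a, ha⟩
  cases c <;> simp [COp.map, COp.mask, h, h']

theorem COp.act_map (I : Instance nv nh N) (e : α ↪ β) (c : COp nv nh N α) (s : β → Bool) :
    (c.map e).act I s = Function.extend e (c.act I fun a => s (e a)) s := by
  funext t
  by_cases ht : ∃ a, e a = t
  · obtain ⟨a, rfl⟩ := ht
    rw [e.injective.extend_apply, COp.act, COp.act, COp.mask_map]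
  · rw [Function.extend_apply' _ _ _ ht, COp.act, COp.mask_map_of_notMem I e c s ht, Bool.xor_false]

theorem extend_update (e : α ↪ β) (s : β → Bool) (a : α) (v : Bool) :
    Function.update s (e a) v =
      Function.extend e (Function.update (fun a => s (e a)) a v) s := by
  funext t
  by_cases ht : ∃ a, e a = t
  · obtain ⟨b, rfl⟩ := ht
    rw [e.injective.extend_apply]
    by_cases h : b = a
    · subst h; simp
    · simp [h]
  · rw [Function.extend_apply' _ _ _ ht, Function.update_of_ne]
    rintro rfl
    exact ht ⟨a, rfl⟩

theorem extend_extend (e : α ↪ β) (t t' : α → Bool) (s : β → Bool) :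
    Function.extend e t (Function.extend e t' s) = Function.extend e t s := by
  funext x
  by_cases hx : ∃ a, e a = x
  · obtain ⟨b, rfl⟩ := hx
    rw [e.injective.extend_apply, e.injective.extend_apply]
  · rw [Function.extend_apply' _ _ _ hx, Function.extend_apply' _ _ _ hx,
      Function.extend_apply' _ _ _ hx]

theorem extend_self (e : α ↪ β) (s : β → Bool) :
    Function.extend e (fun a => s (e a)) s = s := by
  funext x
  by_cases hx : ∃ a, e a = x
  · obtain ⟨b, rfl⟩ := hx
    rw [e.injective.extend_apply]
  · rw [Function.extend_apply' _ _ _ hx]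

/-- An operation on a subset of the wires acts fibrewise, leaving the other wires fixed. -/
theorem Op.apply_map (I : Instance nv nh N) (e : α ↪ β) (g : Op nv nh N α) (ψ : (β → Bool) → ℂ)
    (s : β → Bool) :
    (g.map e).apply I ψ s =
      g.apply I (fun t => ψ (Function.extend e t s)) (fun a => s (e a)) := by
  cases g with
  | one U a =>
    simp only [Op.map, Op.apply]
    exact Finset.sum_congr rfl fun t _ => by rw [extend_update]
  | cls c => simp only [Op.map, Op.apply, COp.act_map]

theorem run_map (I : Instance nv nh N) (e : α ↪ β) (l : List (Op nv nh N α)) (ψ : (β → Bool) → ℂ)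
    (s : β → Bool) :
    run I (l.map (Op.map e)) ψ s =
      run I l (fun t => ψ (Function.extend e t s)) (fun a => s (e a)) := by
  induction l generalizing ψ with
  | nil => simp [run_nil, extend_self]
  | cons g l ih =>
    rw [List.map_cons, run_cons, ih, run_cons]
    congr 1
    funext t
    rw [Op.apply_map]
    simp only [extend_extend, e.injective.extend_apply]

/-! #### Linearity and unitarity -/

theorem Op.apply_linear (I : Instance nv nh N) (g : Op nv nh N α) (a b : ℂ)
    (φ ψ : (α → Bool) → ℂ) :
    g.apply I (fun s => a * φ s + b * ψ s) = fun s => a * g.apply I φ s + b * g.apply I ψ s := by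
  funext s
  cases g with
  | one U c => simp only [Op.apply, Fintype.sum_bool]; ring
  | cls c => rfl

theorem run_linear (I : Instance nv nh N) (l : List (Op nv nh N α)) (a b : ℂ)
    (φ ψ : (α → Bool) → ℂ) :
    run I l (fun s => a * φ s + b * ψ s) = fun s => a * run I l φ s + b * run I l ψ s := by
  induction l generalizing φ ψ with
  | nil => rfl
  | cons g l ih => simp only [run_cons, Op.apply_linear, ih]

theorem COp.mask_act (I : Instance nv nh N) (c : COp nv nh N α) (s : α → Bool) :
    c.mask I (c.act I s) = c.mask I s := by
  cases c with
  | load k f a => rfl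
  | cnot a b h => simp [COp.act, COp.mask, h]
  | toffoli a b c h1 h2 h3 => simp [COp.act, COp.mask, h2, h3]
  | query e =>
    have h : ∀ k, (COp.query e : COp nv nh N α).act I s (e (.inl k)) = s (e (.inl k)) := by
      simp [COp.act, COp.mask]
    funext t
    simp only [COp.mask, decide_eq_decide, h]
  | meanField len enc e => simp [COp.act, COp.mask]

theorem COp.act_act (I : Instance nv nh N) (c : COp nv nh N α) (s : α → Bool) :
    c.act I (c.act I s) = s := by
  funext t
  rw [COp.act, COp.mask_act, COp.act]
  simp

theorem unitary_sum (U : U2) (i j : Bool) :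
    ∑ t, (U : Matrix Bool Bool ℂ) i t * ((U⁻¹ : U2) : Matrix Bool Bool ℂ) t j =
      if i = j then 1 else 0 := by
  have h : ((U * U⁻¹ : U2) : Matrix Bool Bool ℂ) = 1 := by simp
  have := congrFun (congrFun h i) j
  rw [Matrix.one_apply] at this
  rw [← this]
  rfl

theorem Op.apply_inv (I : Instance nv nh N) (g : Op nv nh N α) (ψ : (α → Bool) → ℂ) :
    g.apply I (g.inv.apply I ψ) = ψ := by
  funext s
  cases g with
  | one U a =>
    have h1 := unitary_sum U (s a) true
    have h2 := unitary_sum U (s a) false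
    simp only [Fintype.sum_bool] at h1 h2
    simp only [Op.inv, Op.apply, Fintype.sum_bool, Function.update_self, Function.update_idem]
    have hs : ψ s = (if s a = true then 1 else 0) * ψ (Function.update s a true) +
        (if s a = false then 1 else 0) * ψ (Function.update s a false) := by
      cases hsa : s a <;> simp [← hsa]
    rw [hs, ← h1, ← h2]
    ring
  | cls c => simp only [Op.inv, Op.apply, COp.act_act]

theorem run_invOps (I : Instance nv nh N) (l : List (Op nv nh N α)) (ψ : (α → Bool) → ℂ) :
    run I l (run I (invOps l) ψ) = ψ := by
  induction l generalizing ψ with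
  | nil => rfl
  | cons g l ih =>
    have : invOps (g :: l) = invOps l ++ [g.inv] := by simp [invOps]
    rw [this, run_append, run_cons, run_cons, run_nil, Op.apply_inv, ih]

variable [Fintype α]

/-- The inner product of state vectors. -/
def sInner (φ ψ : (α → Bool) → ℂ) : ℂ := ∑ s, starRingEnd ℂ (φ s) * ψ s

theorem Op.sInner_apply (I : Instance nv nh N) (g : Op nv nh N α) (φ ψ : (α → Bool) → ℂ) :
    sInner (g.apply I φ) ψ = sInner φ (g.inv.apply I ψ) := by
  unfold sInner
  cases g with
  | one U a =>
    simp only [Op.inv, Op.apply, map_sum, map_mul, Finset.sum_mul, Finset.mul_sum]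
    rw [← Fintype.sum_prod_type', ← Fintype.sum_prod_type']
    refine Finset.sum_nbij' (fun p => (Function.update p.1 a p.2, p.1 a))
      (fun p => (Function.update p.1 a p.2, p.1 a)) (by simp) (by simp) ?_ ?_ ?_
    · rintro ⟨s, t⟩ -; simp
    · rintro ⟨s, t⟩ -; simp
    · rintro ⟨s, t⟩ -
      have : ((U⁻¹ : U2) : Matrix Bool Bool ℂ) t (s a) =
          starRingEnd ℂ ((U : Matrix Bool Bool ℂ) (s a) t) := rfl
      simp only [Function.update_self, Function.update_idem, Function.update_eq_self, this]
      ring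
  | cls c =>
    simp only [Op.inv, Op.apply]
    refine Finset.sum_nbij' (c.act I) (c.act I) (by simp) (by simp) ?_ ?_ ?_
    · intro s _; exact c.act_act I s
    · intro s _; exact c.act_act I s
    · intro s _; rw [c.act_act]

theorem sInner_run (I : Instance nv nh N) (l : List (Op nv nh N α)) (φ ψ : (α → Bool) → ℂ) :
    sInner (run I l φ) ψ = sInner φ (run I (invOps l) ψ) := by
  induction l generalizing φ with
  | nil => rfl
  | cons g l ih =>
    have : invOps (g :: l) = invOps l ++ [g.inv] := by simp [invOps]
    rw [this, run_append, run_cons, run_cons, run_nil, ih, Op.sInner_apply]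

end

/-! ### Classical reversible circuits -/

section

variable {nv nh N : ℕ} {α : Type} [DecidableEq α]

/-- Action of a list of classical operations on basis states, the first one acting first. -/
def crun (I : Instance nv nh N) (l : List (COp nv nh N α)) (s : α → Bool) : α → Bool :=
  l.foldl (fun s c => c.act I s) s

theorem crun_append (I : Instance nv nh N) (l l' : List (COp nv nh N α)) (s : α → Bool) :
    crun I (l ++ l') s = crun I l' (crun I l s) := List.foldl_append

theorem crun_cons (I : Instance nv nh N) (c : COp nv nh N α) (l : List (COp nv nh N α))
    (s : α → Bool) : crun I (c :: l) s = crun I l (c.act I s) := rfl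

/-- A classical circuit permutes the basis states. -/
theorem sum_run_cls [Fintype α] (I : Instance nv nh N) (l : List (COp nv nh N α))
    (ψ : (α → Bool) → ℂ) (F : (α → Bool) → ℝ) :
    ∑ s, ‖run I (l.map Op.cls) ψ s‖ ^ 2 * F s = ∑ s, ‖ψ s‖ ^ 2 * F (crun I l s) := by
  induction l generalizing ψ with
  | nil => rfl
  | cons c l ih =>
    rw [List.map_cons, run_cons, ih]
    simp only [crun_cons, Op.apply]
    refine Finset.sum_nbij' (c.act I) (c.act I) (by simp) (by simp) ?_ ?_ ?_
    · intro s _; exact c.act_act I s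
    · intro s _; exact c.act_act I s
    · intro s _; rw [c.act_act]

/-- Computing a bit, changing the sign and uncomputing multiplies the basis states by signs. -/
theorem run_phase (I : Instance nv nh N) (l : List (COp nv nh N α)) (a : α)
    (ψ : (α → Bool) → ℂ) (s : α → Bool) :
    run I (l.map Op.cls ++ Op.one zGate a :: (l.map Op.cls).reverse) ψ s =
      (if crun I l s a then -1 else 1) * ψ s := by
  induction l generalizing ψ s with
  | nil =>
    simp only [List.map_nil, List.nil_append, List.reverse_nil, run_cons, run_nil, Op.apply, crun,
      List.foldl_nil, Fintype.sum_bool]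
    have h : ∀ b, s a = b → Function.update s a b = s := by rintro b rfl; simp
    obtain hb | hb := Bool.eq_false_or_eq_true (s a)
    · simp [zGate, hb, h _ hb]
    · simp [zGate, hb, h _ hb]
  | cons c l ih =>
    have : (c :: l).map Op.cls ++ Op.one zGate a :: ((c :: l).map Op.cls).reverse =
        Op.cls c :: ((l.map Op.cls ++ Op.one zGate a :: (l.map Op.cls).reverse) ++ [Op.cls c]) := by
      simp
    rw [this, run_cons, run_append, run_cons, run_nil]
    change run I _ (fun s => ψ (c.act I s)) (c.act I s) = _
    rw [ih]
    rw [c.act_act, crun_cons]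

/-- A source of a wire in a netlist: a constant one, another wire, the conjunction of two wires, or
a bit of a classical datum. -/
inductive Src (nv nh : ℕ) (α : Type) : Type
  | const
  | lin (a : α)
  | quad (a b : α)
  | load (k : Datum nv nh) (f : ℝ → Bool)

/-- The value of a source. -/
def Src.eval (I : Instance nv nh N) (s : α → Bool) : Src nv nh α → Bool
  | .const => true
  | .lin a => s a
  | .quad a b => s a && s b
  | .load k f => f (I.value k)

/-- The sum modulo two of a list of sources. -/
def evalSrcs (I : Instance nv nh N) (s : α → Bool) (l : List (Src nv nh α)) : Bool :=
  l.foldr (fun x b => xor (x.eval I s) b) false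

/-- The operation that adds a source to the wire `w`; none in the degenerate cases where wires
coincide. -/
def Src.op? (w : α) : Src nv nh α → Option (COp nv nh N α)
  | .const => some (.load .zQ (fun _ => true) w)
  | .lin a => if h : a ≠ w then some (.cnot a w h) else none
  | .quad a b =>
      if h : a ≠ b ∧ a ≠ w ∧ b ≠ w then some (.toffoli a b w h.1 h.2.1 h.2.2) else none
  | .load k f => some (.load k f w)

/-- The wires that a source reads have lower rank than `w`. -/
def Src.Below (rank : α → ℕ) (w : α) : Src nv nh α → Prop
  | .const => True
  | .lin a => rank a < rank w
  | .quad a b => a ≠ b ∧ rank a < rank w ∧ rank b < rank w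
  | .load _ _ => True

/-- The operations that compute the wire `w`. -/
def wireOps (D : α → List (Src nv nh α)) (w : α) : List (COp nv nh N α) :=
  (D w).filterMap (Src.op? w)

/-- The operations that compute the wires `ws` one after the other. A wire is computed as the sum
modulo two of its sources `D w`. -/
def netlist (D : α → List (Src nv nh α)) (ws : List α) : List (COp nv nh N α) :=
  ws.flatMap (wireOps D)

theorem Src.eval_congr (I : Instance nv nh N) {rank : α → ℕ} {w : α} {s s' : α → Bool}
    {x : Src nv nh α} (hx : x.Below rank w) (h : ∀ a, rank a < rank w → s a = s' a) :
    x.eval I s = x.eval I s' := by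
  cases x with
  | const => rfl
  | lin a => exact h a hx
  | quad a b => simp only [Src.eval]; rw [h a hx.2.1, h b hx.2.2]
  | load k f => rfl

theorem evalSrcs_congr (I : Instance nv nh N) {rank : α → ℕ} {w : α} {s s' : α → Bool}
    {l : List (Src nv nh α)} (hl : ∀ x ∈ l, x.Below rank w)
    (h : ∀ a, rank a < rank w → s a = s' a) : evalSrcs I s l = evalSrcs I s' l := by
  induction l with
  | nil => rfl
  | cons x l ih =>
    simp only [evalSrcs, List.foldr_cons] at *
    rw [Src.eval_congr I (hl x (by simp)) h, ih fun y hy => hl y (by simp [hy])]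

theorem update_xor_eq (s : α → Bool) (a : α) (v : Bool) :
    (fun t => xor (s t) (decide (t = a) && v)) = Function.update s a (xor (s a) v) := by
  funext t
  by_cases h : t = a
  · subst h; simp
  · simp [h]

theorem crun_filterMap_op (I : Instance nv nh N) {rank : α → ℕ} {w : α}
    (l : List (Src nv nh α)) (hl : ∀ x ∈ l, x.Below rank w) (s : α → Bool) :
    crun I (l.filterMap (Src.op? w)) s = Function.update s w (xor (s w) (evalSrcs I s l)) := by
  induction l generalizing s with
  | nil => simp [crun, evalSrcs]
  | cons x l ih =>
    have hx := hl x (by simp)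
    have hl' : ∀ y ∈ l, y.Below rank w := fun y hy => hl y (by simp [hy])
    obtain ⟨c, hc, hact⟩ : ∃ c : COp nv nh N α, x.op? w = some c ∧
        c.act I s = Function.update s w (xor (s w) (x.eval I s)) := by
      cases x with
      | const => exact ⟨_, rfl, update_xor_eq _ _ _⟩
      | load k f => exact ⟨_, rfl, update_xor_eq _ _ _⟩
      | lin a =>
        have h : a ≠ w := by rintro rfl; exact lt_irrefl _ hx
        exact ⟨_, dif_pos h, update_xor_eq _ _ _⟩
      | quad a b =>
        have h : a ≠ b ∧ a ≠ w ∧ b ≠ w := by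
          refine ⟨hx.1, ?_, ?_⟩ <;> rintro rfl
          · exact lt_irrefl _ hx.2.1
          · exact lt_irrefl _ hx.2.2
        exact ⟨_, dif_pos h, update_xor_eq _ _ _⟩
    rw [List.filterMap_cons_some hc, crun_cons, hact, ih hl']
    have : evalSrcs I (Function.update s w (xor (s w) (x.eval I s))) l = evalSrcs I s l :=
      evalSrcs_congr I hl' fun a ha => Function.update_of_ne (by rintro rfl; exact lt_irrefl _ ha) _ _
    rw [this, Function.update_idem, Function.update_self]
    simp [evalSrcs]

/-- If the wires are computed in an order compatible with the rank, then in the end every wire is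
the sum of its sources (and its initial value). -/
theorem crun_netlist (I : Instance nv nh N) (D : α → List (Src nv nh α)) (rank : α → ℕ)
    (hD : ∀ w, ∀ x ∈ D w, x.Below rank w) (ws : List α) (hnd : ws.Nodup)
    (hs : ws.Pairwise fun a b => rank a ≤ rank b) (s : α → Bool) (w : α) :
    crun I (netlist D ws) s w =
      if w ∈ ws then xor (s w) (evalSrcs I (crun I (netlist D ws) s) (D w)) else s w := by
  induction ws generalizing s w with
  | nil => simp [netlist, crun]
  | cons v ws ih =>
    rw [List.nodup_cons] at hnd
    rw [List.pairwise_cons] at hs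
    have e : netlist (N := N) D (v :: ws) = wireOps D v ++ netlist D ws := rfl
    rw [e, crun_append]
    have h1 : crun I (wireOps D v) s = Function.update s v (xor (s v) (evalSrcs I s (D v))) :=
      crun_filterMap_op I (D v) (hD v) s
    rw [h1]
    set s1 := Function.update s v (xor (s v) (evalSrcs I s (D v))) with hs1
    have ih' := ih hnd.2 hs.2 s1
    by_cases hwv : w = v
    · subst hwv
      rw [ih' w, if_neg hnd.1, if_pos List.mem_cons_self, hs1, Function.update_self, ← hs1]
      congr 1
      refine evalSrcs_congr I (hD w) fun a ha => ?_
      rw [ih' a, if_neg, hs1, Function.update_of_ne]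
      · rintro rfl; exact lt_irrefl _ ha
      · intro hmem
        exact absurd (hs.1 a hmem) (by omega)
    · rw [ih' w]
      have : s1 w = s w := Function.update_of_ne hwv _ _
      rw [this]
      simp [hwv]

/-- All wires, in the order of their rank. -/
def rankedWires [Fintype α] (rank : α → ℕ) : List α :=
  Finset.univ.toList.mergeSort fun a b => decide (rank a ≤ rank b)

theorem rankedWires_perm [Fintype α] (rank : α → ℕ) :
    (rankedWires rank).Perm Finset.univ.toList := List.mergeSort_perm _ _

theorem crun_netlist_ranked [Fintype α] (I : Instance nv nh N) (D : α → List (Src nv nh α))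
    (rank : α → ℕ) (hD : ∀ w, ∀ x ∈ D w, x.Below rank w) (s : α → Bool) (w : α) :
    crun I (netlist D (rankedWires rank)) s w =
      xor (s w) (evalSrcs I (crun I (netlist D (rankedWires rank)) s) (D w)) := by
  rw [crun_netlist I D rank hD, if_pos]
  · rw [(rankedWires_perm rank).mem_iff]; simp
  · rw [(rankedWires_perm rank).nodup_iff]; exact Finset.nodup_toList _
  · have := List.pairwise_mergeSort (le := fun a b : α => decide (rank a ≤ rank b))
      (fun a b c => by simpa using le_trans) (fun a b => by simpa using le_total _ _)
      Finset.univ.toList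
    exact this.imp fun h => by simpa using h

theorem length_wireOps_le (D : α → List (Src nv nh α)) (w : α) :
    (wireOps (N := N) D w).length ≤ (D w).length := List.length_filterMap_le _ _

theorem length_netlist_ranked_le [Fintype α] (D : α → List (Src nv nh α)) (rank : α → ℕ) {b : ℕ}
    (hb : ∀ w, (D w).length ≤ b) :
    (netlist (N := N) D (rankedWires rank)).length ≤ b * Fintype.card α := by
  unfold netlist
  rw [List.length_flatMap]
  have hc : (rankedWires rank).length = Fintype.card α := by
    rw [(rankedWires_perm rank).length_eq, Finset.length_toList, Finset.card_univ]
  rw [← hc]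
  have := List.sum_le_card_nsmul ((rankedWires rank).map fun w => (wireOps (N := N) D w).length) b
    (by
      intro x hx
      obtain ⟨w, -, rfl⟩ := List.mem_map.1 hx
      exact (length_wireOps_le D w).trans (hb w))
  rw [List.length_map, smul_eq_mul] at this
  linarith

/-! ### Independent coins -/

/-- Tossing coins: the wire `w` becomes `1` with probability `p w`. -/
def coinOps (p : α → ℝ) (ws : List α) : List (Op nv nh N α) :=
  ws.map fun w => .one (coinGate (p w)) w

theorem run_coinOps [Fintype α] (I : Instance nv nh N) (p : α → ℝ) (hp0 : ∀ a, 0 ≤ p a)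
    (hp1 : ∀ a, p a ≤ 1) (ws : List α) (hnd : ws.Nodup) (f : α → Bool → ℂ)
    (hf : ∀ a ∈ ws, f a = fun b => if b then 0 else 1) :
    run I (coinOps p ws) (fun s => ∏ a, f a (s a)) =
      fun s => ∏ a, if a ∈ ws then ((√(bern (p a) (s a)) : ℝ) : ℂ) else f a (s a) := by
  induction ws generalizing f with
  | nil => simp [coinOps, run_nil]
  | cons w ws ih =>
    rw [List.nodup_cons] at hnd
    have step : (Op.one (coinGate (p w)) w : Op nv nh N α).apply I (fun s => ∏ a, f a (s a)) =
        fun s => ∏ a, (if a = w then fun b => ((√(bern (p w) b) : ℝ) : ℂ) else f a) (s a) := by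
      funext s
      have e : ∀ t, ∏ a, f a (Function.update s w t a) =
          f w t * ∏ a ∈ Finset.univ.erase w, f a (s a) := by
        intro t
        rw [← Finset.mul_prod_erase _ _ (Finset.mem_univ w), Function.update_self]
        congr 1
        refine Finset.prod_congr rfl fun a ha => ?_
        rw [Function.update_of_ne (Finset.ne_of_mem_erase ha)]
      simp only [Op.apply, e, Fintype.sum_bool]
      rw [← Finset.mul_prod_erase _ _ (Finset.mem_univ w)]
      have e2 : ∏ a ∈ Finset.univ.erase w,
          (if a = w then fun b => ((√(bern (p w) b) : ℝ) : ℂ) else f a) (s a) =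
          ∏ a ∈ Finset.univ.erase w, f a (s a) := by
        refine Finset.prod_congr rfl fun a ha => ?_
        rw [if_neg (Finset.ne_of_mem_erase ha)]
      rw [e2, hf w (by simp)]
      have hc : 0 ≤ p w ∧ p w ≤ 1 := ⟨hp0 w, hp1 w⟩
      cases h : s w <;> simp [coinGate, hc, bern]
    have : coinOps p (w :: ws) = (Op.one (coinGate (p w)) w : Op nv nh N α) :: coinOps p ws := rfl
    rw [this, run_cons, step, ih hnd.2]
    · funext s
      refine Finset.prod_congr rfl fun a _ => ?_
      by_cases haw : a = w
      · subst haw; simp [hnd.1]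
      · simp [haw]
    · intro a ha
      rw [if_neg (by rintro rfl; exact hnd.1 ha)]
      exact hf a (by simp [ha])

theorem zeroState_eq_prod [Fintype α] :
    (zeroState : (α → Bool) → ℂ) = fun s => ∏ a, if s a then 0 else 1 := by
  funext s
  unfold zeroState
  by_cases h : s = fun _ => false
  · subst h; simp
  · rw [if_neg h]
    obtain ⟨a, ha⟩ := Function.ne_iff.mp h
    rw [Finset.prod_eq_zero (Finset.mem_univ a)]
    simpa using ha

/-- Measuring after tossing coins and running a classical circuit: the outcome statistics are
those of the corresponding classical random experiment. -/
theorem sum_run_coins_cls [Fintype α] (I : Instance nv nh N) (p : α → ℝ) (hp0 : ∀ a, 0 ≤ p a)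
    (hp1 : ∀ a, p a ≤ 1) (l : List (COp nv nh N α)) (F : (α → Bool) → ℝ) :
    ∑ s, ‖run I (coinOps p Finset.univ.toList ++ l.map Op.cls) zeroState s‖ ^ 2 * F s =
      bexp p fun s => F (crun I l s) := by
  rw [run_append, sum_run_cls, zeroState_eq_prod,
    run_coinOps I p hp0 hp1 _ (Finset.nodup_toList _) (fun _ b => if b then 0 else 1)
      (fun _ _ => rfl)]
  unfold bexp
  refine Finset.sum_congr rfl fun s _ => ?_
  congr 1
  rw [norm_prod, ← Finset.prod_pow]
  refine Finset.prod_congr rfl fun a _ => ?_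
  rw [if_pos (by simp), Complex.norm_real, Real.norm_eq_abs, sq_abs,
    Real.sq_sqrt (bern_nonneg (hp0 a) (hp1 a) _)]

end

/-! ### Grover iteration -/

section

variable {nv nh N : ℕ} {W : Type} [Fintype W] [DecidableEq W]

/-- Sources of the wires of the circuit that checks whether all wires in `W` are zero: the ancilla
`i` is one if the first `i` wires are zero. -/
def zeroTestSrcs : W ⊕ Fin (Fintype.card W + 1) → List (Src nv nh (W ⊕ Fin (Fintype.card W + 1)))
  | .inl _ => []
  | .inr i => Fin.cases [.const] (fun j => [.lin (.inr j.castSucc),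
      .quad (.inr j.castSucc) (.inl ((Fintype.equivFin W).symm j))]) i

/-- The order of computation of the zero test. -/
def zeroTestRank : W ⊕ Fin (Fintype.card W + 1) → ℕ
  | .inl _ => 0
  | .inr i => i + 1

/-- The circuit that checks whether all wires in `W` are zero. -/
def zeroTest : List (COp nv nh N (W ⊕ Fin (Fintype.card W + 1))) :=
  netlist zeroTestSrcs (rankedWires zeroTestRank)

theorem zeroTest_below (w : W ⊕ Fin (Fintype.card W + 1)) (x)
    (hx : x ∈ zeroTestSrcs (nv := nv) (nh := nh) w) : x.Below zeroTestRank w := by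
  rcases w with w | i
  · simp [zeroTestSrcs] at hx
  · induction i using Fin.cases with
    | zero =>
      simp only [zeroTestSrcs, Fin.cases_zero, List.mem_singleton] at hx
      subst hx; trivial
    | succ j =>
      simp only [zeroTestSrcs, Fin.cases_succ, List.mem_cons, List.not_mem_nil, or_false] at hx
      rcases hx with rfl | rfl <;> simp [Src.Below, zeroTestRank]

theorem crun_zeroTest (I : Instance nv nh N) (s : W ⊕ Fin (Fintype.card W + 1) → Bool)
    (hs : ∀ i, s (.inr i) = false) :
    crun I zeroTest s (.inr (Fin.last _)) = true ↔ ∀ w, s (.inl w) = false := by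
  have eqn := crun_netlist_ranked I zeroTestSrcs zeroTestRank zeroTest_below s
  have hl : ∀ w, crun I zeroTest s (.inl w) = s (.inl w) := by
    intro w
    rw [zeroTest, eqn]
    simp [zeroTestSrcs, evalSrcs]
  have h : ∀ i : Fin (Fintype.card W + 1), crun I zeroTest s (.inr i) = true ↔
      ∀ j : Fin (Fintype.card W), (j : ℕ) < i → s (.inl ((Fintype.equivFin W).symm j)) = false := by
    intro i
    induction i using Fin.induction with
    | zero =>
      rw [zeroTest, eqn]
      simp [zeroTestSrcs, evalSrcs, Src.eval, hs]
    | succ i ih =>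
      have e : crun I zeroTest s (.inr i.succ) = (crun I zeroTest s (.inr i.castSucc) &&
          !(s (.inl ((Fintype.equivFin W).symm i)))) := by
        rw [← hl]
        conv_lhs => rw [zeroTest, eqn]
        simp only [zeroTestSrcs, Fin.cases_succ, evalSrcs, List.foldr_cons, List.foldr_nil,
          Src.eval, hs, Bool.xor_false, Bool.false_xor]
        rw [← zeroTest]
        cases crun I zeroTest s (.inr i.castSucc) <;>
          cases crun I zeroTest s (.inl ((Fintype.equivFin W).symm i)) <;> rfl
      rw [e, Bool.and_eq_true, ih]
      constructor
      · rintro ⟨h1, h2⟩ j hj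
        rcases Nat.lt_succ_iff_lt_or_eq.1 (by rwa [Fin.val_succ] at hj) with h | h
        · exact h1 j h
        · have : j = i := Fin.ext h
          subst this
          simpa using h2
      · intro h1
        exact ⟨fun j hj => h1 j (by simp at hj ⊢; omega), by simpa using h1 i (by simp)⟩
  rw [h]
  constructor
  · intro h1 w
    have := h1 (Fintype.equivFin W w) (by simp)
    simpa using this
  · intro h1 j _
    exact h1 _

/-- The state of the wires `W` together with ancillas that are zero. -/
def liftState {A : Type} [Fintype A] (φ : (W → Bool) → ℂ) : (W ⊕ A → Bool) → ℂ :=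
  fun s => if ∀ i, s (.inr i) = false then φ (fun w => s (.inl w)) else 0

theorem run_liftState {A : Type} [Fintype A] [DecidableEq A] (I : Instance nv nh N)
    (l : List (Op nv nh N W)) (φ : (W → Bool) → ℂ) :
    run I (l.map (Op.map .inl)) (liftState φ : (W ⊕ A → Bool) → ℂ) = liftState (run I l φ) := by
  funext s
  rw [run_map]
  have h1 : ∀ t (w : W), Function.extend (Function.Embedding.inl : W ↪ W ⊕ A) t s (.inl w) = t w :=
    fun t w => Function.Embedding.inl.injective.extend_apply t s w
  have h2 : ∀ t (i : A), Function.extend (Function.Embedding.inl : W ↪ W ⊕ A) t s (.inr i) =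
      s (.inr i) := fun t i => Function.extend_apply' _ _ _ (by simp)
  unfold liftState
  simp only [h1, h2]
  by_cases h : ∀ i, s (.inr i) = false
  · simp [h]
  · simp only [h, if_false]
    have := congrFun (run_linear I l 0 0 (fun _ => 0) fun _ => 0) fun a => s (.inl a)
    simpa using this

theorem sum_liftState {A : Type} [Fintype A] [DecidableEq A] (φ : (W → Bool) → ℂ)
    (F : (W → Bool) → ℝ) :
    ∑ s : W ⊕ A → Bool, ‖liftState φ s‖ ^ 2 * F (fun w => s (.inl w)) =
      ∑ t, ‖φ t‖ ^ 2 * F t := by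
  rw [← (Equiv.sumArrowEquivProdArrow W A Bool).symm.sum_comp, Fintype.sum_prod_type]
  refine Finset.sum_congr rfl fun t _ => ?_
  rw [Finset.sum_eq_single fun _ => false]
  · simp [liftState]
  · intro b _ hb
    have : ¬ ∀ i, b i = false := fun h => hb (funext h)
    simp [liftState, this]
  · simp

theorem zeroState_apply (s : W → Bool) :
    zeroState s = if s = fun _ => false then 1 else 0 := rfl

/-- The reflection about the all-zero state of the wires `W`. -/
def reflectOps : List (Op nv nh N (W ⊕ Fin (Fintype.card W + 1))) :=
  zeroTest.map .cls ++ Op.one zGate (.inr (Fin.last _)) :: (zeroTest.map .cls).reverse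

theorem run_reflectOps (I : Instance nv nh N) (φ : (W → Bool) → ℂ) :
    run I reflectOps (liftState φ) =
      liftState fun s => 1 * φ s + (-2 * φ (fun _ => false)) * zeroState s := by
  funext s
  rw [reflectOps, run_phase]
  unfold liftState
  by_cases h : ∀ i, s (.inr i) = false
  · rw [if_pos h, if_pos h]
    have := crun_zeroTest I s h
    by_cases h0 : (fun w => s (.inl w)) = fun _ => false
    · rw [if_pos (this.2 fun w => congrFun h0 w)]
      beta_reduce
      rw [zeroState_apply, if_pos h0, h0]; ring
    · rw [if_neg (fun hc => h0 (funext (this.1 hc)))]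
      beta_reduce
      rw [zeroState_apply, if_neg h0]; ring
  · rw [if_neg h, if_neg h, mul_zero]

/-- One Grover iteration for the preparation `A` and the flag `f`. -/
def groverStep (A : List (Op nv nh N W)) (f : W) :
    List (Op nv nh N (W ⊕ Fin (Fintype.card W + 1))) :=
  Op.one zGate (.inl f) ::
    ((invOps A).map (Op.map .inl) ++ (reflectOps ++ A.map (Op.map .inl)))

/-- The preparation `A` followed by `k` Grover iterations. -/
def groverOps (A : List (Op nv nh N W)) (f : W) (k : ℕ) :
    List (Op nv nh N (W ⊕ Fin (Fintype.card W + 1))) :=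
  A.map (Op.map .inl) ++ (List.replicate k (groverStep A f)).flatten

/-- The Grover iteration is the product of the sign flip of the flagged basis states and the
reflection about the prepared state. -/
theorem run_groverStep (I : Instance nv nh N) (A : List (Op nv nh N W)) (f : W)
    (φ : (W → Bool) → ℂ) :
    run I (groverStep A f) (liftState φ) =
      liftState fun s => 1 * ((if s f then -1 else 1) * φ s) +
        (-2 * sInner (run I A zeroState) (fun s => (if s f then -1 else 1) * φ s)) *
          run I A zeroState s := by
  have hz : (Op.one zGate (.inl f) : Op nv nh N (W ⊕ Fin (Fintype.card W + 1))).apply I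
      (liftState φ) = liftState fun s => (if s f then -1 else 1) * φ s := by
    funext s
    have := run_phase I ([] : List (COp nv nh N (W ⊕ Fin (Fintype.card W + 1)))) (.inl f)
      (liftState φ) s
    simp only [List.map_nil, List.nil_append, List.reverse_nil, run_cons, run_nil] at this
    rw [this]
    unfold liftState
    by_cases h : ∀ i, s (.inr i) = false
    · rw [if_pos h, if_pos h]; rfl
    · rw [if_neg h, if_neg h, mul_zero]
  rw [groverStep, run_cons, hz, run_append, run_append, run_liftState, run_reflectOps,
    run_liftState, run_linear, run_invOps, sInner_run]
  have : ∀ χ : (W → Bool) → ℂ, sInner zeroState χ = χ fun _ => false := by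
    intro χ
    unfold sInner zeroState
    rw [Finset.sum_eq_single fun _ => false] <;> simp +contextual
  rw [this]

theorem liftState_zeroState {A : Type} [Fintype A] [DecidableEq A] :
    liftState (zeroState : (W → Bool) → ℂ) = (zeroState : (W ⊕ A → Bool) → ℂ) := by
  funext s
  unfold liftState zeroState
  by_cases h : s = fun _ => false
  · subst h; simp
  · rw [if_neg h]
    split_ifs with h1 h2
    · exact absurd (funext fun x => by
        rcases x with x | x
        · exact congrFun h2 x
        · exact h1 x) h
    · rfl
    · rfl

/-- After `k` iterations the flag is set with probability `sin² ((2 k + 1) θ)`, where `sin² θ` is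
the probability that the preparation sets it. -/
theorem sum_groverOps (I : Instance nv nh N) (A : List (Op nv nh N W)) (f : W) (θ : ℝ)
    (h1 : ∑ s, ‖run I A zeroState s‖ ^ 2 * (if s f then (1 : ℝ) else 0) = Real.sin θ ^ 2)
    (h0 : ∑ s, ‖run I A zeroState s‖ ^ 2 * (if s f then (0 : ℝ) else 1) = Real.cos θ ^ 2)
    (k : ℕ) (b : Bool) :
    ∑ s, ‖run I (groverOps A f k) zeroState s‖ ^ 2 * (if s (.inl f) = b then (1 : ℝ) else 0) =
      bern (Real.sin ((2 * (k : ℝ) + 1) * θ) ^ 2) b := by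
  set ψ := run I A zeroState with hψ
  -- The iterations stay in the plane spanned by the two components of `ψ`, on which they act as
  -- `(-1) ^ k` times the rotation by `2 k θ`. The factors `x` and `y` are not divided out, because
  -- `sin θ` or `cos θ` may vanish.
  have hst : ∃ x y : ℝ, x * Real.sin θ = (-1) ^ k * Real.sin ((2 * (k : ℝ) + 1) * θ) ∧
      y * Real.cos θ = (-1) ^ k * Real.cos ((2 * (k : ℝ) + 1) * θ) ∧
      run I (groverOps A f k) zeroState =
        liftState fun s => (if s f then (x : ℂ) else y) * ψ s := by
    induction k with
    | zero =>
      refine ⟨1, 1, by simp, by simp, ?_⟩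
      rw [groverOps, List.replicate_zero, List.flatten_nil, List.append_nil, ← liftState_zeroState,
        run_liftState]
      simp [hψ]
    | succ k ih =>
      obtain ⟨x, y, hx, hy, hr⟩ := ih
      have e : groverOps A f (k + 1) = groverOps A f k ++ groverStep A f := by
        rw [groverOps, groverOps, List.replicate_succ', List.flatten_append, List.append_assoc]
        simp
      have hin : sInner ψ (fun s => (if s f then -1 else 1) * ((if s f then (x : ℂ) else y) * ψ s)) =
          ((-x * Real.sin θ ^ 2 + y * Real.cos θ ^ 2 : ℝ) : ℂ) := by
        rw [← h1, ← h0, Finset.mul_sum, Finset.mul_sum, ← Finset.sum_add_distrib]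
        unfold sInner
        push_cast
        refine Finset.sum_congr rfl fun s _ => ?_
        have := Complex.conj_mul' (ψ s)
        by_cases hs : s f = true
        · simp only [hs, if_true]; push_cast; linear_combination (-x : ℂ) * this
        · simp only [hs]; push_cast; simp; linear_combination (y : ℂ) * this
      have hc := Real.sin_sq_add_cos_sq θ
      refine ⟨-x - 2 * (-x * Real.sin θ ^ 2 + y * Real.cos θ ^ 2),
        y - 2 * (-x * Real.sin θ ^ 2 + y * Real.cos θ ^ 2), ?_, ?_, ?_⟩
      · have : (2 * ((k + 1 : ℕ) : ℝ) + 1) * θ = (2 * k + 1) * θ + 2 * θ := by push_cast; ring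
        rw [this, Real.sin_add, Real.cos_two_mul, Real.sin_two_mul]
        linear_combination (2 * Real.sin θ ^ 2 - 1) * hx - 2 * Real.sin θ * Real.cos θ * hy
          + (-2) * (-1) ^ k * Real.sin ((2 * k + 1) * θ) * hc * (-1)
      · have : (2 * ((k + 1 : ℕ) : ℝ) + 1) * θ = (2 * k + 1) * θ + 2 * θ := by push_cast; ring
        rw [this, Real.cos_add, Real.cos_two_mul, Real.sin_two_mul]
        linear_combination (2 * Real.sin θ * Real.cos θ) * hx + (1 - 2 * Real.cos θ ^ 2) * hy
      · rw [e, run_append, hr, run_groverStep, ← hψ, hin]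
        congr 1
        funext s
        by_cases hs : s f = true
        · simp only [hs, if_true]; push_cast; ring
        · simp only [hs]; push_cast; simp; ring
  obtain ⟨x, y, hx, hy, hr⟩ := hst
  rw [hr, sum_liftState _ fun s => if s f = b then (1 : ℝ) else 0]
  have hk : ((-1 : ℝ) ^ k) ^ 2 = 1 := by rw [← pow_mul, mul_comm, pow_mul]; simp
  cases b
  · have : ∀ s, ‖(if s f then (x : ℂ) else y) * ψ s‖ ^ 2 * (if s f = false then (1 : ℝ) else 0) =
        y ^ 2 * (‖ψ s‖ ^ 2 * (if s f then (0 : ℝ) else 1)) := by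
      intro s
      by_cases hs : s f = true
      · simp [hs]
      · simp [hs, mul_pow]
    simp_rw [this]
    rw [← Finset.mul_sum, h0, ← mul_pow, hy, mul_pow, hk, one_mul, Real.cos_sq']
    simp [bern]
  · have : ∀ s, ‖(if s f then (x : ℂ) else y) * ψ s‖ ^ 2 * (if s f = true then (1 : ℝ) else 0) =
        x ^ 2 * (‖ψ s‖ ^ 2 * (if s f then (1 : ℝ) else 0)) := by
      intro s
      by_cases hs : s f = true
      · simp [hs, mul_pow]
      · simp [hs]
    simp_rw [this]
    rw [← Finset.mul_sum, h1, ← mul_pow, hx, mul_pow, hk, one_mul]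
    simp [bern]

end

/-! ### Costs -/

section

variable {nv nh N : ℕ} {α β : Type}

/-- Number of oracle queries of an operation. -/
def Op.queries : Op nv nh N α → ℕ
  | .cls (.query _) => 1
  | _ => 0

/-- Cost of an operation for a machine with `E` edges. -/
def Op.cost (E : ℕ) : Op nv nh N α → ℕ
  | .cls (.meanField len _ _) => E * len
  | _ => 1

/-- Number of oracle queries of a list of operations. -/
def opQueries (l : List (Op nv nh N α)) : ℕ := (l.map Op.queries).sum

/-- Cost of a list of operations. -/
def opCost (E : ℕ) (l : List (Op nv nh N α)) : ℕ := (l.map (Op.cost E)).sum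

theorem Op.toGate_queries {q : ℕ} (g : Op nv nh N (Fin q)) : g.toGate.queries = g.queries := by
  match g with
  | .one U a => rfl
  | .cls (.load k f a) => rfl
  | .cls (.cnot a b h) => rfl
  | .cls (.toffoli a b c h1 h2 h3) => rfl
  | .cls (.query e) => rfl
  | .cls (.meanField len enc e) => rfl

theorem Op.toGate_cost {q : ℕ} (E : ℕ) (g : Op nv nh N (Fin q)) :
    g.toGate.cost E = g.cost E := by
  match g with
  | .one U a => rfl
  | .cls (.load k f a) => rfl
  | .cls (.cnot a b h) => rfl
  | .cls (.toffoli a b c h1 h2 h3) => rfl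
  | .cls (.query e) => rfl
  | .cls (.meanField len enc e) => rfl

theorem Op.map_queries (e : α ↪ β) (g : Op nv nh N α) : (g.map e).queries = g.queries := by
  match g with
  | .one U a => rfl
  | .cls (.load k f a) => rfl
  | .cls (.cnot a b h) => rfl
  | .cls (.toffoli a b c h1 h2 h3) => rfl
  | .cls (.query e) => rfl
  | .cls (.meanField len enc e) => rfl

theorem Op.map_cost (E : ℕ) (e : α ↪ β) (g : Op nv nh N α) : (g.map e).cost E = g.cost E := by
  match g with
  | .one U a => rfl
  | .cls (.load k f a) => rfl
  | .cls (.cnot a b h) => rfl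
  | .cls (.toffoli a b c h1 h2 h3) => rfl
  | .cls (.query e) => rfl
  | .cls (.meanField len enc e) => rfl

theorem opQueries_append (l l' : List (Op nv nh N α)) :
    opQueries (l ++ l') = opQueries l + opQueries l' := by simp [opQueries]

theorem opCost_append (E : ℕ) (l l' : List (Op nv nh N α)) :
    opCost E (l ++ l') = opCost E l + opCost E l' := by simp [opCost]

theorem opQueries_map (e : α ↪ β) (l : List (Op nv nh N α)) :
    opQueries (l.map (Op.map e)) = opQueries l := by
  simp [opQueries, Function.comp_def, Op.map_queries]

theorem opCost_map (E : ℕ) (e : α ↪ β) (l : List (Op nv nh N α)) :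
    opCost E (l.map (Op.map e)) = opCost E l := by
  simp [opCost, Function.comp_def, Op.map_cost]

theorem opQueries_invOps (l : List (Op nv nh N α)) : opQueries (invOps l) = opQueries l := by
  have : ∀ g : Op nv nh N α, g.inv.queries = g.queries := by rintro (_ | _) <;> rfl
  simp [opQueries, invOps, Function.comp_def, this]

theorem opCost_invOps (E : ℕ) (l : List (Op nv nh N α)) : opCost E (invOps l) = opCost E l := by
  have : ∀ g : Op nv nh N α, g.inv.cost E = g.cost E := by rintro (_ | _) <;> rfl
  simp [opCost, invOps, Function.comp_def, this]

theorem netlist_costs [DecidableEq α] (E : ℕ) (D : α → List (Src nv nh α)) (ws : List α) :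
    opQueries ((netlist (N := N) D ws).map .cls) = 0 ∧
      opCost E ((netlist (N := N) D ws).map .cls) = (netlist (N := N) D ws).length := by
  have h : ∀ c ∈ netlist (N := N) D ws, (Op.cls c).queries = 0 ∧ (Op.cls c).cost E = 1 := by
    intro c hc
    obtain ⟨w, -, hw⟩ := List.mem_flatMap.1 hc
    obtain ⟨x, -, hx⟩ := List.mem_filterMap.1 hw
    cases x with
    | const => cases hx; exact ⟨rfl, rfl⟩
    | load k f => cases hx; exact ⟨rfl, rfl⟩
    | lin a =>
      simp only [Src.op?] at hx
      split_ifs at hx; cases hx; exact ⟨rfl, rfl⟩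
    | quad a b =>
      simp only [Src.op?] at hx
      split_ifs at hx; cases hx; exact ⟨rfl, rfl⟩
  generalize netlist (N := N) D ws = l at h
  induction l with
  | nil => exact ⟨rfl, rfl⟩
  | cons c l ih =>
    have h1 := h c (by simp)
    have h2 := ih fun c hc => h c (by simp [hc])
    simp only [opQueries, opCost, List.map_cons, List.sum_cons, List.length_cons] at *
    omega

variable [Fintype α] [DecidableEq α]

theorem length_zeroTest_le :
    (zeroTest (nv := nv) (nh := nh) (N := N) (W := α)).length ≤ 2 * (2 * Fintype.card α + 1) := by
  refine (length_netlist_ranked_le _ _ (b := 2) ?_).trans (le_of_eq ?_)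
  · rintro (w | i)
    · simp [zeroTestSrcs]
    · induction i using Fin.cases <;> simp [zeroTestSrcs]
  · rw [Fintype.card_sum, Fintype.card_fin]; ring

theorem opQueries_groverOps (A : List (Op nv nh N α)) (f : α) (k : ℕ) :
    opQueries (groverOps A f k) = (2 * k + 1) * opQueries A := by
  have hr : opQueries (reflectOps : List (Op nv nh N (α ⊕ Fin (Fintype.card α + 1)))) = 0 := by
    have h := (netlist_costs (nv := nv) (nh := nh) (N := N) 0 (zeroTestSrcs (W := α))
      (rankedWires zeroTestRank)).1
    rw [← zeroTest] at h
    rw [reflectOps, opQueries_append, h]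
    simpa [opQueries, Op.queries] using h
  have hs : opQueries (groverStep A f) = 2 * opQueries A := by
    have : groverStep A f = [Op.one zGate (.inl f)] ++
      ((invOps A).map (Op.map .inl) ++ (reflectOps ++ A.map (Op.map .inl))) := rfl
    rw [this, opQueries_append, opQueries_append, opQueries_append, opQueries_map, opQueries_map,
      opQueries_invOps, hr]
    simp [opQueries, Op.queries]; ring
  induction k with
  | zero => simp [groverOps, opQueries_map]
  | succ k ih =>
    have e : groverOps A f (k + 1) = groverOps A f k ++ groverStep A f := by
      rw [groverOps, groverOps, List.replicate_succ', List.flatten_append, List.append_assoc]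
      simp
    rw [e, opQueries_append, ih, hs]; ring

theorem opCost_groverOps_le (E : ℕ) (A : List (Op nv nh N α)) (f : α) (k : ℕ) :
    opCost E (groverOps A f k) ≤ (2 * k + 1) * (opCost E A + 4 * Fintype.card α + 3) := by
  have hr : opCost E (reflectOps : List (Op nv nh N (α ⊕ Fin (Fintype.card α + 1)))) ≤
      8 * Fintype.card α + 5 := by
    have h := (netlist_costs (nv := nv) (nh := nh) (N := N) E (zeroTestSrcs (W := α))
      (rankedWires zeroTestRank)).2
    have hl := length_zeroTest_le (nv := nv) (nh := nh) (N := N) (α := α)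
    rw [← zeroTest] at h
    have h2 : opCost E (Op.one zGate (.inr (Fin.last _)) :: (zeroTest.map .cls).reverse :
        List (Op nv nh N (α ⊕ Fin (Fintype.card α + 1)))) =
        1 + opCost E ((zeroTest (nv := nv) (nh := nh) (N := N) (W := α)).map .cls) := by
      simp [opCost, Op.cost]
    rw [reflectOps, opCost_append, h2, h]
    omega
  have hs : opCost E (groverStep A f) ≤ 2 * (opCost E A + 4 * Fintype.card α + 3) := by
    have : groverStep A f = [Op.one zGate (.inl f)] ++
      ((invOps A).map (Op.map .inl) ++ (reflectOps ++ A.map (Op.map .inl))) := rfl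
    rw [this, opCost_append, opCost_append, opCost_append, opCost_map, opCost_map,
      opCost_invOps]
    have : opCost E [(Op.one zGate (.inl f) : Op nv nh N (α ⊕ Fin (Fintype.card α + 1)))] = 1 := rfl
    omega
  induction k with
  | zero => simp [groverOps, opCost_map]; omega
  | succ k ih =>
    have e : groverOps A f (k + 1) = groverOps A f k ++ groverStep A f := by
      rw [groverOps, groverOps, List.replicate_succ', List.flatten_append, List.append_assoc]
      simp
    rw [e, opCost_append]
    nlinarith

/-! ### Independent copies -/

/-- The circuits `L s` on disjoint copies of the wires `α`. -/
def copies {S : ℕ} (emb : Fin S × α ≃ β) (L : Fin S → List (Op nv nh N α))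
    (ss : List (Fin S)) : List (Op nv nh N β) :=
  ss.flatMap fun s => (L s).map (Op.map ⟨fun a => emb (s, a), fun _ _ h =>
    (Prod.ext_iff.1 (emb.injective h)).2⟩)

theorem copies_costs {S : ℕ} (emb : Fin S × α ≃ β) (L : Fin S → List (Op nv nh N α)) (E : ℕ)
    (ss : List (Fin S)) :
    opQueries (copies emb L ss) = (ss.map fun s => opQueries (L s)).sum ∧
      opCost E (copies emb L ss) = (ss.map fun s => opCost E (L s)).sum := by
  induction ss with
  | nil => exact ⟨rfl, rfl⟩
  | cons s ss ih =>
    have : copies emb L (s :: ss) = (L s).map (Op.map ⟨fun a => emb (s, a), fun _ _ h =>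
      (Prod.ext_iff.1 (emb.injective h)).2⟩) ++ copies emb L ss := rfl
    rw [this, opQueries_append, opCost_append, opQueries_map, opCost_map, ih.1, ih.2]
    simp

variable [Fintype β] [DecidableEq β]

/-- Circuits on disjoint sets of wires preserve product states. -/
theorem run_copies {S : ℕ} (I : Instance nv nh N) (emb : Fin S × α ≃ β)
    (L : Fin S → List (Op nv nh N α)) (ss : List (Fin S)) (hss : ss.Nodup)
    (φ : Fin S → (α → Bool) → ℂ) :
    run I (copies emb L ss) (fun c => ∏ s, φ s fun a => c (emb (s, a))) =
      fun c => ∏ s, (if s ∈ ss then run I (L s) (φ s) else φ s) fun a => c (emb (s, a)) := by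
  induction ss generalizing φ with
  | nil => simp [copies, run_nil]
  | cons s ss ih =>
    rw [List.nodup_cons] at hss
    have e : copies emb L (s :: ss) = (L s).map (Op.map ⟨fun a => emb (s, a), fun _ _ h =>
      (Prod.ext_iff.1 (emb.injective h)).2⟩) ++ copies emb L ss := rfl
    rw [e, run_append]
    set i : α ↪ β := ⟨fun a => emb (s, a), fun _ _ h => (Prod.ext_iff.1 (emb.injective h)).2⟩ with hi
    have step : run I ((L s).map (Op.map i)) (fun c => ∏ s', φ s' fun a => c (emb (s', a))) =
        fun c => ∏ s', (if s' = s then run I (L s) (φ s) else φ s') fun a => c (emb (s', a)) := by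
      funext c
      rw [run_map]
      have h1 : ∀ t : α → Bool, ∏ s', (φ s' fun a => Function.extend i t c (emb (s', a))) =
          (∏ s' ∈ Finset.univ.erase s, φ s' fun a => c (emb (s', a))) * φ s t + 0 * φ s t := by
        intro t
        rw [← Finset.mul_prod_erase _ _ (Finset.mem_univ s), mul_comm, zero_mul, add_zero]
        congr 1
        · refine Finset.prod_congr rfl fun s' hs' => ?_
          congr 1
          funext a
          refine Function.extend_apply' _ _ _ ?_
          rintro ⟨b, hb⟩
          exact Finset.ne_of_mem_erase hs' (Prod.ext_iff.1 (emb.injective hb)).1.symm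
        · congr 1
          funext a
          exact i.injective.extend_apply t c a
      simp_rw [h1]
      rw [run_linear, ← Finset.mul_prod_erase _ _ (Finset.mem_univ s), if_pos rfl]
      beta_reduce
      rw [zero_mul, add_zero, mul_comm]
      congr 1
      refine Finset.prod_congr rfl fun s' hs' => ?_
      rw [if_neg (Finset.ne_of_mem_erase hs')]
    rw [step, ih hss.2]
    funext c
    refine Finset.prod_congr rfl fun s' _ => ?_
    by_cases h : s' = s
    · subst h; simp [hss.1]
    · simp [h]

/-- The quantum algorithm that runs the circuit `L s` on the `s`-th copy of the wires `α`, for all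
`s`, and measures the wire `f` of every copy. -/
def copiesAlgorithm {S : ℕ} (L : Fin S → List (Op nv nh N α)) (f : α)
    (post : ℝ → Config S → ℝ) : QAlgorithm nv nh N where
  q := Fintype.card (Fin S × α)
  circuit := (copies (Fintype.equivFin (Fin S × α)) L (List.finRange S)).map Op.toGate
  m := S
  measured := ⟨fun s => Fintype.equivFin (Fin S × α) (s, f), fun _ _ h =>
    (Prod.ext_iff.1 ((Fintype.equivFin (Fin S × α)).injective h)).1⟩
  post := post

theorem copiesAlgorithm_costs {S : ℕ} (L : Fin S → List (Op nv nh N α)) (f : α)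
    (post : ℝ → Config S → ℝ) (E : ℕ) :
    (copiesAlgorithm L f post).queries = ∑ s, opQueries (L s) ∧
      (copiesAlgorithm L f post).cost E = ∑ s, opCost E (L s) := by
  have h := copies_costs (Fintype.equivFin (Fin S × α)) L E (List.finRange S)
  constructor
  · have : (copiesAlgorithm L f post).queries =
        opQueries (copies (Fintype.equivFin (Fin S × α)) L (List.finRange S)) := by
      simp only [QAlgorithm.queries, copiesAlgorithm, opQueries, List.map_map]
      congr 1
      exact List.map_congr_left fun g _ => g.toGate_queries
    rw [this, h.1, ← List.ofFn_eq_map, List.sum_ofFn]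
  · have : (copiesAlgorithm L f post).cost E =
        opCost E (copies (Fintype.equivFin (Fin S × α)) L (List.finRange S)) := by
      simp only [QAlgorithm.cost, copiesAlgorithm, opCost, List.map_map]
      congr 1
      exact List.map_congr_left fun g _ => g.toGate_cost E
    rw [this, h.2, ← List.ofFn_eq_map, List.sum_ofFn]

open Classical in
/-- The measured bits are independent. -/
theorem outputProb_copiesAlgorithm {S : ℕ} (I : Instance nv nh N) (L : Fin S → List (Op nv nh N α))
    (f : α) (post : ℝ → Config S → ℝ) (w : ℝ) (T : Set ℝ) (p : Fin S → ℝ)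
    (hp : ∀ s b, ∑ t, ‖run I (L s) zeroState t‖ ^ 2 * (if t f = b then (1 : ℝ) else 0) =
      bern (p s) b) :
    (copiesAlgorithm L f post).outputProb I w T =
      bexp p fun x => if post w x ∈ T then 1 else 0 := by
  set emb := Fintype.equivFin (Fin S × α) with hemb
  have hz : (zeroState : (Fin (Fintype.card (Fin S × α)) → Bool) → ℂ) =
      fun c => ∏ s, (zeroState : (α → Bool) → ℂ) fun a => c (emb (s, a)) := by
    funext c
    by_cases h : c = fun _ => false
    · subst h; simp [zeroState]
    · obtain ⟨x, hx⟩ := Function.ne_iff.mp h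
      have e : zeroState c = 0 := if_neg h
      rw [e, Finset.prod_eq_zero (Finset.mem_univ (emb.symm x).1)]
      refine if_neg fun h' => hx ?_
      have := congrFun h' (emb.symm x).2
      simpa using this
  have hfin : (copiesAlgorithm L f post).finalState I =
      fun c => ∏ s, run I (L s) zeroState fun a => c (emb (s, a)) := by
    have h : run I (copies emb L (List.finRange S)) zeroState =
        fun c => ∏ s, run I (L s) zeroState fun a => c (emb (s, a)) := by
      rw [hz, run_copies I emb L _ (List.nodup_finRange S)]
      simp
    exact (run_toGate I (copies emb L (List.finRange S)) zeroState).trans h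
  have e1 : (copiesAlgorithm L f post).outputProb I w T =
      ∑ c : Fin (Fintype.card (Fin S × α)) → Bool,
        (∏ s, ‖run I (L s) zeroState fun a => c (emb (s, a))‖ ^ 2) *
          (if post w (fun s => c (emb (s, f))) ∈ T then 1 else 0) := by
    unfold QAlgorithm.outputProb
    rw [hfin]
    refine Finset.sum_congr rfl fun c _ => ?_
    rw [norm_prod, ← Finset.prod_pow, mul_ite, mul_one, mul_zero]
    rfl
  rw [e1]
  have e2 := sum_prod_pushforward (fun s (t : α → Bool) => ‖run I (L s) zeroState t‖ ^ 2)
    (fun _ t => t f) (fun x : Fin S → Bool => if post w x ∈ T then (1 : ℝ) else 0)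
  unfold bexp
  have e3 : ∀ (s : Fin S) b, bern (p s) b =
      ∑ y : α → Bool, if y f = b then ‖run I (L s) zeroState y‖ ^ 2 else 0 := by
    intro s b
    rw [← hp]
    exact Finset.sum_congr rfl fun t _ => by rw [mul_ite, mul_one, mul_zero]
  simp_rw [e3]
  rw [← e2]
  refine Fintype.sum_equiv ((emb.symm.arrowCongr (Equiv.refl Bool)).trans
    (Equiv.curry (Fin S) α Bool)) _ _ fun c => ?_
  rfl

end

/-! ### Binary arithmetic -/

theorem binValue_succ {l : ℕ} (s : Fin (l + 1) → Bool) :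
    binValue s = binValue (fun k => s k.castSucc) + if s (Fin.last l) then 2 ^ l else 0 := by
  unfold binValue
  rw [Fin.sum_univ_castSucc]
  rfl

theorem binValue_lt {l : ℕ} (s : Fin l → Bool) : binValue s < 2 ^ l := by
  induction l with
  | zero => simp [binValue]
  | succ l ih =>
    rw [binValue_succ, pow_succ]
    have := ih fun k => s k.castSucc
    split_ifs <;> omega

theorem binValue_testBit (l n : ℕ) : binValue (fun b : Fin l => n.testBit b) = n % 2 ^ l := by
  induction l with
  | zero => simp [binValue, Nat.mod_one]
  | succ l ih =>
    rw [binValue_succ, Nat.mod_pow_succ]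
    simp only [Fin.val_castSucc, Fin.val_last]
    rw [ih, ← Nat.toNat_testBit]
    obtain h | h := Bool.eq_false_or_eq_true (n.testBit l) <;> simp [h]

theorem binValue_injective (l : ℕ) : Function.Injective (binValue (l := l)) := by
  induction l with
  | zero => intro s s' _; exact Subsingleton.elim _ _
  | succ l ih =>
    intro s s' h
    rw [binValue_succ, binValue_succ] at h
    have h1 := binValue_lt fun k => s k.castSucc
    have h2 := binValue_lt fun k => s' k.castSucc
    have h3 : s (Fin.last l) = s' (Fin.last l) := by
      cases ha : s (Fin.last l) <;> cases hb : s' (Fin.last l) <;> simp [ha, hb] at h ⊢ <;> omega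
    have h4 : (fun k : Fin l => s k.castSucc) = fun k => s' k.castSucc := by
      apply ih
      rw [h3] at h
      omega
    funext k
    induction k using Fin.lastCases with
    | last => exact h3
    | cast k => exact congrFun h4 k

theorem eq_testBit_of_binValue {l n : ℕ} (s : Fin l → Bool) (h : binValue s = n % 2 ^ l) :
    s = fun b : Fin l => n.testBit b :=
  binValue_injective l (by rw [h, binValue_testBit])

/-- Ripple-carry addition. -/
theorem binValue_add {l : ℕ} (a b s : Fin l → Bool) (c : Fin (l + 1) → Bool) (h0 : c 0 = false)
    (hs : ∀ k, s k = xor (a k) (xor (b k) (c k.castSucc)))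
    (hc : ∀ k : Fin l, c k.succ =
      xor (a k && b k) (xor (a k && c k.castSucc) (b k && c k.castSucc))) :
    binValue s + (if c (Fin.last l) then 2 ^ l else 0) = binValue a + binValue b := by
  induction l with
  | zero => simp [binValue, h0]
  | succ l ih =>
    have h := ih (fun k => a k.castSucc) (fun k => b k.castSucc) (fun k => s k.castSucc)
      (fun k => c k.castSucc) h0 (fun k => hs _) (fun k => hc k.castSucc)
    rw [binValue_succ s, binValue_succ a, binValue_succ b, hs, ← Fin.succ_last, hc, pow_succ]
    cases a (Fin.last l) <;> cases b (Fin.last l) <;> cases hcl : c (Fin.last l).castSucc <;>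
      simp [hcl] at h ⊢ <;> omega

theorem binValue_add_mod {l : ℕ} (a b s : Fin l → Bool) (c : Fin (l + 1) → Bool) (h0 : c 0 = false)
    (hs : ∀ k, s k = xor (a k) (xor (b k) (c k.castSucc)))
    (hc : ∀ k : Fin l, c k.succ =
      xor (a k && b k) (xor (a k && c k.castSucc) (b k && c k.castSucc))) :
    binValue s = (binValue a + binValue b) % 2 ^ l := by
  rw [← binValue_add a b s c h0 hs hc]
  split_ifs
  · rw [Nat.add_mod_right, Nat.mod_eq_of_lt (binValue_lt s)]
  · rw [add_zero, Nat.mod_eq_of_lt (binValue_lt s)]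

/-- Comparison of two binary numbers, from the least significant digit on. -/
theorem binValue_le_iff {l : ℕ} (p q : Fin l → Bool) (c : Fin (l + 1) → Bool) (h0 : c 0 = true)
    (hc : ∀ k : Fin l, c k.succ = if q k then !p k || c k.castSucc else !p k && c k.castSucc) :
    c (Fin.last l) = true ↔ binValue p ≤ binValue q := by
  induction l with
  | zero => simp [binValue, h0]
  | succ l ih =>
    have h := ih (fun k => p k.castSucc) (fun k => q k.castSucc) (fun k => c k.castSucc) h0
      (fun k => hc k.castSucc)
    have h1 := binValue_lt fun k => p k.castSucc
    have h2 := binValue_lt fun k => q k.castSucc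
    rw [binValue_succ p, binValue_succ q, ← Fin.succ_last, hc]
    cases p (Fin.last l) <;> cases q (Fin.last l) <;> simp [h] <;> omega

/-- A conjunction computed by a chain of conjunctions. -/
theorem chain_last_iff {l : ℕ} (x : Fin l → Bool) (c : Fin (l + 1) → Bool)
    (hc : ∀ k : Fin l, c k.succ = xor (c k.castSucc) (c k.castSucc && x k)) :
    c (Fin.last l) = (c 0 && decide (∀ k, x k = false)) := by
  induction l with
  | zero => simp
  | succ l ih =>
    have h := ih (fun k => x k.castSucc) (fun k => c k.castSucc) (fun k => hc k.castSucc)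
    rw [← Fin.succ_last, hc]
    have h' : c (Fin.last l).castSucc = (c 0 && decide (∀ k : Fin l, x k.castSucc = false)) := h
    rw [h']
    have : (∀ k, x k = false) ↔ (∀ k : Fin l, x k.castSucc = false) ∧ x (Fin.last l) = false := by
      constructor
      · exact fun h => ⟨fun k => h _, h _⟩
      · rintro ⟨h1, h2⟩ k
        induction k using Fin.lastCases with
        | last => exact h2
        | cast k => exact h1 k
    simp only [this, Bool.decide_and]
    cases c 0 <;> cases decide (∀ k : Fin l, x k.castSucc = false) <;>
      cases x (Fin.last l) <;> simp

/-- The second bit of the first trial whose first bit is set; `false` if there is none. -/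
def firstAccepted {K : ℕ} (y : Fin K → Bool × Bool) : Bool :=
  decide (∃ k, (y k).1 = true ∧ (y k).2 = true ∧ ∀ k' < k, (y k').1 = false)

theorem firstAccepted_cons {K : ℕ} (a : Bool × Bool) (y : Fin K → Bool × Bool) :
    firstAccepted (Fin.cons a y : Fin (K + 1) → Bool × Bool) =
      if a.1 then a.2 else firstAccepted y := by
  unfold firstAccepted
  rcases a with ⟨a1, a2⟩
  cases a1
  · simp [Fin.exists_fin_succ, Fin.forall_fin_succ, Fin.succ_lt_succ_iff]
  · simp [Fin.exists_fin_succ, Fin.forall_fin_succ]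

/-- Sequential search for the first accepted trial. -/
theorem firstAccepted_eq {K : ℕ} (y : Fin K → Bool × Bool) (found res : Fin (K + 1) → Bool)
    (hf0 : found 0 = false) (hr0 : res 0 = false)
    (hf : ∀ k : Fin K, found k.succ =
      xor (found k.castSucc) (xor (y k).1 (found k.castSucc && (y k).1)))
    (hr : ∀ k : Fin K, res k.succ = xor (res k.castSucc)
      (xor ((y k).1 && (y k).2) (found k.castSucc && ((y k).1 && (y k).2)))) :
    res (Fin.last K) = firstAccepted y := by
  have key : ∀ i : Fin (K + 1),
      (found i = true ↔ ∃ k : Fin K, k.castSucc < i ∧ (y k).1 = true) ∧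
      (res i = true ↔ ∃ k : Fin K, k.castSucc < i ∧ (y k).1 = true ∧ (y k).2 = true ∧
        ∀ k' < k, (y k').1 = false) := by
    intro i
    induction i using Fin.induction with
    | zero => simp [hf0, hr0]
    | succ i ih =>
      obtain ⟨ih1, ih2⟩ := ih
      have hlt : ∀ k : Fin K, k.castSucc < i.succ ↔ k.castSucc < i.castSucc ∨ k = i := by
        intro k
        rw [Fin.castSucc_lt_succ_iff, le_iff_lt_or_eq, Fin.castSucc_lt_castSucc_iff]
      constructor
      · rw [hf]
        have : (∃ k : Fin K, k.castSucc < i.succ ∧ (y k).1 = true) ↔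
            found i.castSucc = true ∨ (y i).1 = true := by
          rw [ih1]
          constructor
          · rintro ⟨k, hk, h⟩
            rcases (hlt k).1 hk with h' | rfl
            · exact Or.inl ⟨k, h', h⟩
            · exact Or.inr h
          · rintro (⟨k, hk, h⟩ | h)
            · exact ⟨k, (hlt k).2 (Or.inl hk), h⟩
            · exact ⟨i, (hlt i).2 (Or.inr rfl), h⟩
        rw [this]
        cases found i.castSucc <;> cases (y i).1 <;> simp
      · rw [hr]
        have hfi : found i.castSucc = false ↔ ∀ k' < i, (y k').1 = false := by
          rw [← Bool.not_eq_true, ih1]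
          push Not
          simp
        have hrf : res i.castSucc = true → found i.castSucc = true := by
          rw [ih1, ih2]
          rintro ⟨k, h1, h2, -⟩
          exact ⟨k, h1, h2⟩
        have : (∃ k : Fin K, k.castSucc < i.succ ∧ (y k).1 = true ∧ (y k).2 = true ∧
            ∀ k' < k, (y k').1 = false) ↔ res i.castSucc = true ∨
              ((y i).1 = true ∧ (y i).2 = true ∧ found i.castSucc = false) := by
          rw [ih2, hfi]
          constructor
          · rintro ⟨k, hk, h⟩
            rcases (hlt k).1 hk with h' | rfl
            · exact Or.inl ⟨k, h', h⟩
            · exact Or.inr h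
          · rintro (⟨k, hk, h⟩ | h)
            · exact ⟨k, (hlt k).2 (Or.inl hk), h⟩
            · exact ⟨i, (hlt i).2 (Or.inr rfl), h⟩
        rw [this]
        revert hrf
        cases res i.castSucc <;> cases found i.castSucc <;> cases (y i).1 <;>
          cases (y i).2 <;> simp
  have h := (key (Fin.last K)).2
  unfold firstAccepted
  rw [Bool.eq_iff_iff, h, decide_eq_true_eq]
  simp [Fin.castSucc_lt_last]

/-- Rejection sampling with `K` independent trials. -/
theorem sum_firstAccepted (w : Bool × Bool → ℝ) (hw : ∑ a, w a = 1) (K : ℕ) :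
    (w (true, true) + w (true, false)) *
      ∑ y : Fin K → Bool × Bool, (∏ k, w (y k)) * (if firstAccepted y then 1 else 0) =
      w (true, true) * (1 - (1 - (w (true, true) + w (true, false))) ^ K) := by
  induction K with
  | zero => simp [firstAccepted]
  | succ K ih =>
    have hw' : w (false, true) + w (false, false) =
        1 - (w (true, true) + w (true, false)) := by
      rw [Fintype.sum_prod_type] at hw
      simp only [Fintype.sum_bool] at hw
      linarith
    have hone : ∑ y : Fin K → Bool × Bool, ∏ k, w (y k) = 1 := by
      rw [sum_prod_eq_prod_sum (fun (_ : Fin K) a => w a)]; simp only [hw, Finset.prod_const_one]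
    have step : ∑ y : Fin (K + 1) → Bool × Bool, (∏ k, w (y k)) *
        (if firstAccepted y then (1 : ℝ) else 0) = w (true, true) +
          (1 - (w (true, true) + w (true, false))) *
          ∑ y : Fin K → Bool × Bool, (∏ k, w (y k)) * (if firstAccepted y then (1 : ℝ) else 0) := by
      rw [← (Fin.consEquiv fun _ => Bool × Bool).sum_comp, Fintype.sum_prod_type]
      have e : ∀ (a : Bool × Bool) (y : Fin K → Bool × Bool),
          (Fin.consEquiv fun _ => Bool × Bool) (a, y) =
            (Fin.cons a y : Fin (K + 1) → Bool × Bool) := fun _ _ => rfl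
      simp only [e, firstAccepted_cons, Fin.prod_univ_succ, Fin.cons_zero, Fin.cons_succ, mul_assoc,
        ← Finset.mul_sum]
      rw [Fintype.sum_prod_type]
      simp only [Fintype.sum_bool, if_true, Bool.false_eq_true, if_false, mul_one, mul_zero, hone,
        Finset.sum_const_zero]
      rw [← hw']
      ring
    rw [step, mul_add]
    have : (w (true, true) + w (true, false)) * ((1 - (w (true, true) + w (true, false))) *
          ∑ y : Fin K → Bool × Bool, (∏ k, w (y k)) * (if firstAccepted y then (1 : ℝ) else 0)) =
        (1 - (w (true, true) + w (true, false))) * ((w (true, true) + w (true, false)) *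
          ∑ y : Fin K → Bool × Bool, (∏ k, w (y k)) * (if firstAccepted y then (1 : ℝ) else 0)) := by
      ring
    rw [this, ih, pow_succ]
    ring

/-! ### The sampling circuit -/

/-- The units of a Boltzmann machine. -/
abbrev Unt (nv nh : ℕ) : Type := Fin nv ⊕ Fin nh

/-- The bias of a unit. -/
def biasCoord {nv nh : ℕ} : Unt nv nh → Coord nv nh
  | .inl i => .b i
  | .inr j => .d j

/-- The weight of an ordered pair of units; none for a hidden unit followed by a visible one, since
such pairs are counted in the other order. -/
def pairCoord {nv nh : ℕ} : Unt nv nh → Unt nv nh → Option (Coord nv nh)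
  | .inl i, .inr j => some (.wvh i j)
  | .inl i, .inl i' => some (.wv i i')
  | .inr j, .inr j' => some (.wh j j')
  | .inr _, .inl _ => none

/-- The monomial in the units that a parameter multiplies in the energy (up to the sign). -/
def coordVal {nv nh : ℕ} : Coord nv nh → (Unt nv nh → Bool) → Bool
  | .b i, s => s (.inl i)
  | .d j, s => s (.inr j)
  | .wvh i j, s => s (.inl i) && s (.inr j)
  | .wv i i', s => s (.inl i) && s (.inl i')
  | .wh j j', s => s (.inr j) && s (.inr j')

/-- The terms of the negative logarithm of the acceptance probability: the (shifted) logarithm of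
the variational partition function, the logarithm of the mean-field probability of a unit, split
into the value for an inactive unit and the increment for an active one, the biases, and the
weights of ordered pairs of adjacent units. -/
inductive ExpTerm (nv nh : ℕ) : Type
  | logZ
  | base (u : Unt nv nh)
  | slope (u : Unt nv nh)
  | bias (u : Unt nv nh)
  | pair (a b : Unt nv nh)

/-- The configurations in which a term is present. -/
def ExpTerm.sel {nv nh : ℕ} : ExpTerm nv nh → (Unt nv nh → Bool) → Bool
  | .logZ, _ => true
  | .base _, _ => true
  | .slope u, s => s u
  | .bias u, s => s u
  | .pair a b, s => s a && s b

/-- The wires of the sampling circuit. There are `K` trials of rejection sampling; numbers have `l`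
binary digits, and the exponent is a sum of `T` terms.
* `side`, `nside` tell whether the machine is clamped; `quart` dilutes the success probability;
* `idx`, `vis`, `reg` are the index, data and mean-field registers, `le` compares the index;
* `pre`, `mf`, `par` are numbers loaded from the classical data or selected from the registers: for
  every unit `mf` holds the number and the bits described at `SamplerSpec`;
* `coinA`, `hitA`, `chainA`, `unit` sample the units from the mean-field distribution;
* `sel`, `term`, `acc`, `carry` add up the exponent, and `coinB`, `hitB`, `chainB` accept or reject;
* `val`, `good`, `found`, `res` find the value of the first accepted trial. -/
inductive Wire (nv nh m l K T : ℕ) : Type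
  | one
  | side
  | nside
  | quart (i : Bool)
  | idx (k : Fin m)
  | le (k : Fin (m + 1))
  | vis (i : Fin nv)
  | reg (o : Option (Fin nh)) (a : Fin 4) (b : Fin l)
  | pre (x : Option (Unt nv nh × Fin 4)) (b : Fin l)
  | mf (x : Option (Unt nv nh × Fin 4)) (b : Fin l)
  | par (t : Fin T) (b : Fin l)
  | coinA (k : Fin K) (u : Unt nv nh) (b : Fin l)
  | hitA (k : Fin K) (u : Unt nv nh) (b : Fin l)
  | chainA (k : Fin K) (u : Unt nv nh) (b : Fin (l + 1))
  | unit (k : Fin K) (u : Unt nv nh)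
  | sel (k : Fin K) (t : Fin T)
  | term (k : Fin K) (t : Fin T) (b : Fin l)
  | acc (k : Fin K) (t : Fin (T + 1)) (b : Fin l)
  | carry (k : Fin K) (t : Fin T) (b : Fin (l + 1))
  | coinB (k : Fin K) (b : Fin l)
  | hitB (k : Fin K) (b : Fin l)
  | chainB (k : Fin K) (b : Fin (l + 1))
  | val (k : Fin K)
  | good (k : Fin K)
  | found (k : Fin (K + 1))
  | res (k : Fin (K + 1))
  | out
  | quarts
  | inRange
  | flag
  deriving DecidableEq

set_option synthInstance.maxSize 2000 in
set_option synthInstance.maxHeartbeats 200000 in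
instance (nv nh m l K T : ℕ) : Fintype (Wire nv nh m l K T) :=
  Fintype.ofEquiv _ (proxy_equiv% (Wire nv nh m l K T))

set_option synthInstance.maxSize 2000 in
set_option synthInstance.maxHeartbeats 200000 in
theorem card_wire_le {nv nh m l K T E : ℕ} (hl : 1 ≤ l) (hK : 1 ≤ K) (hE : 1 ≤ E)
    (hn : nv + nh ≤ 2 * E) (hT : T ≤ 11 * E) :
    Fintype.card (Wire nv nh m l K T) ≤ 150 * (K * E * (l + m)) := by
  rw [← Fintype.card_congr (proxy_equiv% (Wire nv nh m l K T))]
  simp only [Fintype.card_sum, Fintype.card_sigma, Fintype.card_fin, Fintype.card_option,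
    Fintype.card_prod, Fintype.card_bool, Finset.sum_const, Finset.card_univ, smul_eq_mul,
    Fintype.card_unique]
  have hK1 : 1 ≤ K * E := Nat.mul_pos hK hE
  have e1 : K * 1 ≤ K * E := Nat.mul_le_mul_left K hE
  have e2 : 1 * E ≤ K * E := Nat.mul_le_mul_right E hK
  obtain ⟨X, hX⟩ : ∃ X, X = K * E := ⟨_, rfl⟩
  have a1 : X * 1 ≤ X * l := Nat.mul_le_mul_left X hl
  have a2 : 1 * m ≤ X * m := Nat.mul_le_mul_right m (hX ▸ hK1)
  have a3 : 1 * l ≤ X * l := Nat.mul_le_mul_right l (hX ▸ hK1)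
  have b1 : nv ≤ 2 * X := by omega
  have b2 : nh ≤ 2 * X := by omega
  have b3 : nh * l ≤ 2 * X * l := Nat.mul_le_mul_right l b2
  have b4 : (nv + nh) * l ≤ 2 * X * l := Nat.mul_le_mul_right l (by omega)
  have b5 : T * l ≤ 11 * X * l := Nat.mul_le_mul_right l (by omega)
  have c1 : K * (nv + nh) ≤ 2 * X := by
    calc K * (nv + nh) ≤ K * (2 * E) := Nat.mul_le_mul_left K hn
      _ = 2 * X := by rw [hX]; ring
  have c2 : K * T ≤ 11 * X := by
    calc K * T ≤ K * (11 * E) := Nat.mul_le_mul_left K hT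
      _ = 11 * X := by rw [hX]; ring
  have c3 : K * (nv + nh) * l ≤ 2 * X * l := Nat.mul_le_mul_right l c1
  have c4 : K * T * l ≤ 11 * X * l := Nat.mul_le_mul_right l c2
  have c5 : K * l ≤ X * l := Nat.mul_le_mul_right l (by omega)
  rw [← hX]
  have goal : 150 * (X * (l + m)) = 150 * (X * l) + 150 * (X * m) := by ring
  rw [goal]
  nlinarith

/-- What the sampling circuit computes: the terms of the exponent, the monomial whose expectation is
sought, and the encodings of mean-field parameters, variational partition functions and weights.
The encoding of a mean-field parameter consists of four numbers: `-log` of the probability of the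
less likely value (number `0`), whether this value is `0` (in the last bit of number `1`), and
the logarithm of the probability of `0` and its increment for `1` (numbers `2` and `3`). -/
structure SamplerSpec (nv nh T : ℕ) where
  tm : Fin T → ExpTerm nv nh
  c : Coord nv nh
  encU : ℝ → Fin 4 → ℕ
  encZ : ℝ → ℕ
  encP : ℝ → ℕ

section

variable {nv nh N m l K T : ℕ} [NeZero l]

/-- The conjunction of two wires. -/
def andSrc {α : Type} [DecidableEq α] (a b : α) : List (Src nv nh α) :=
  if a = b then [.lin a] else [.quad a b]

/-- The term `t` of the exponent, as a wire holding its `b`-th bit. -/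
def SamplerSpec.dataWire (Sp : SamplerSpec nv nh T) (t : Fin T) (b : Fin l) :
    Wire nv nh m l K T :=
  match Sp.tm t with
  | .logZ => .mf none b
  | .base u => .mf (some (u, 2)) b
  | .slope u => .mf (some (u, 3)) b
  | .bias _ => .par t b
  | .pair _ _ => .par t b

/-- The definitions of the wires. The conjunction `a ∧ ¬ b` is written as the sum `a + a b`, and
the comparison of the index is with the digits of `N - 1`. -/
def SamplerSpec.srcs (Sp : SamplerSpec nv nh T) (N : ℕ) :
    Wire nv nh m l K T → List (Src nv nh (Wire nv nh m l K T))
  | .one => [.const]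
  | .side => []
  | .nside => [.const, .lin .side]
  | .quart _ => []
  | .idx _ => []
  | .le k => Fin.cases [.const] (fun k =>
      if (N - 1).testBit k then [.const, .lin (.idx k), .quad (.idx k) (.le k.castSucc)]
      else [.lin (.le k.castSucc), .quad (.idx k) (.le k.castSucc)]) k
  | .vis _ => []
  | .reg _ _ _ => []
  | .pre none b => [.load .zQ fun z => (Sp.encZ z).testBit b]
  | .pre (some (.inl i, a)) b => [.load (.mfV i) fun z => (Sp.encU z a).testBit b]
  | .pre (some (.inr j, a)) b => [.load (.mfH j) fun z => (Sp.encU z a).testBit b]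
  | .mf none b => [.quad .nside (.pre none b), .quad .side (.reg none 0 b)]
  | .mf (some (.inl i, a)) b => .quad .nside (.pre (some (.inl i, a)) b) ::
      if a = 1 then [.quad .side (.vis i)] else []
  | .mf (some (.inr j, a)) b =>
      [.quad .nside (.pre (some (.inr j, a)) b), .quad .side (.reg (some j) a b)]
  | .par t b =>
      match Sp.tm t with
      | .bias u => [.load (.coord (biasCoord u)) fun z => (Sp.encP z).testBit b]
      | .pair a b' =>
          match pairCoord a b' with
          | some c => [.load (.coord c) fun z => (Sp.encP z).testBit b]
          | none => []
      | _ => []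
  | .coinA _ _ _ => []
  | .hitA k u b => [.quad (.mf (some (u, 0)) b) (.coinA k u b)]
  | .chainA k u b => Fin.cases
      (match u with
        | .inl _ => [.lin .nside]
        | .inr _ => [.const])
      (fun b => [.lin (.chainA k u b.castSucc), .quad (.chainA k u b.castSucc) (.hitA k u b)]) b
  | .unit k u => [.lin (.mf (some (u, 1)) 0), .lin (.chainA k u (Fin.last l))]
  | .sel k t =>
      match Sp.tm t with
      | .logZ => [.const]
      | .base _ => [.const]
      | .slope u => [.lin (.unit k u)]
      | .bias u => [.lin (.unit k u)]
      | .pair a b => andSrc (.unit k a) (.unit k b)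
  | .term k t b => [.quad (.sel k t) (Sp.dataWire t b)]
  | .acc k t b => Fin.cases [] (fun t =>
      [.lin (.acc k t.castSucc b), .lin (.term k t b), .lin (.carry k t b.castSucc)]) t
  | .carry k t b => Fin.cases [] (fun b =>
      [.quad (.acc k t.castSucc b) (.term k t b),
        .quad (.acc k t.castSucc b) (.carry k t b.castSucc),
        .quad (.term k t b) (.carry k t b.castSucc)]) b
  | .coinB _ _ => []
  | .hitB k b => [.quad (.acc k (Fin.last T) b) (.coinB k b)]
  | .chainB k b => Fin.cases [.const] (fun b =>
      [.lin (.chainB k b.castSucc), .quad (.chainB k b.castSucc) (.hitB k b)]) b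
  | .val k =>
      match Sp.c with
      | .b i => [.lin (.unit k (.inl i))]
      | .d j => [.lin (.unit k (.inr j))]
      | .wvh i j => andSrc (.unit k (.inl i)) (.unit k (.inr j))
      | .wv i i' => andSrc (.unit k (.inl i)) (.unit k (.inl i'))
      | .wh j j' => andSrc (.unit k (.inr j)) (.unit k (.inr j'))
  | .good k => [.quad (.chainB k (Fin.last l)) (.val k)]
  | .found k => Fin.cases [] (fun k =>
      [.lin (.found k.castSucc), .lin (.chainB k (Fin.last l)),
        .quad (.found k.castSucc) (.chainB k (Fin.last l))]) k
  | .res k => Fin.cases [] (fun k =>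
      [.lin (.res k.castSucc), .lin (.good k), .quad (.found k.castSucc) (.good k)]) k
  | .out => [.lin (.res (Fin.last K)), .lin .nside]
  | .quarts => [.quad (.quart false) (.quart true)]
  | .inRange => [.quad (.le (Fin.last m)) .out]
  | .flag => [.quad .quarts .inRange]

/-- An order in which the wires can be computed. -/
def wireRank : Wire nv nh m l K T → ℕ
  | .one => 0
  | .side => 0
  | .nside => 1
  | .quart _ => 0
  | .idx _ => 0
  | .le k => k
  | .vis _ => 0
  | .reg _ _ _ => 0
  | .pre _ _ => 0
  | .mf _ _ => 2
  | .par _ _ => 0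
  | .coinA _ _ _ => 0
  | .hitA _ _ _ => 3
  | .chainA _ _ b => 3 + b
  | .unit _ _ => l + 4
  | .sel _ _ => l + 5
  | .term _ _ _ => l + 6
  | .acc _ t b => l + 7 + 2 * t + 2 * b
  | .carry _ t b => l + 8 + 2 * t + 2 * b
  | .coinB _ _ => 0
  | .hitB _ _ => 3 * l + 2 * T + 8
  | .chainB _ b => 3 * l + 2 * T + 8 + b
  | .val _ => l + 5
  | .good _ => 4 * l + 2 * T + 9
  | .found k => 4 * l + 2 * T + 9 + k
  | .res k => 4 * l + 2 * T + 10 + k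
  | .out => 4 * l + 2 * T + 11 + K
  | .quarts => 1
  | .inRange => 4 * l + 2 * T + 12 + K + m
  | .flag => 4 * l + 2 * T + 13 + K + m

theorem wireRank_dataWire (Sp : SamplerSpec nv nh T) (t : Fin T) (b : Fin l) :
    wireRank (Sp.dataWire t b : Wire nv nh m l K T) ≤ 2 := by
  unfold SamplerSpec.dataWire
  split <;> simp [wireRank]

theorem dataWire_ne_sel (Sp : SamplerSpec nv nh T) (t : Fin T) (b : Fin l) (k : Fin K) (t' : Fin T) :
    (.sel k t' : Wire nv nh m l K T) ≠ Sp.dataWire t b := by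
  unfold SamplerSpec.dataWire
  split <;> simp

theorem below_andSrc {α : Type} [DecidableEq α] {rank : α → ℕ} {a b w : α}
    (ha : rank a < rank w) (hb : rank b < rank w) (x : Src nv nh α) (hx : x ∈ andSrc a b) :
    x.Below rank w := by
  unfold andSrc at hx
  split_ifs at hx with h
  · rw [List.mem_singleton] at hx; subst hx; exact ha
  · rw [List.mem_singleton] at hx; subst hx; exact ⟨h, ha, hb⟩

theorem SamplerSpec.below (Sp : SamplerSpec nv nh T) (N : ℕ) (w : Wire nv nh m l K T)
    (x : Src nv nh (Wire nv nh m l K T)) (hx : x ∈ Sp.srcs N w) : x.Below wireRank w := by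
  have hl : 0 < l := Nat.pos_of_ne_zero (NeZero.ne l)
  cases w with
  | le k =>
    induction k using Fin.cases with
    | zero => simp [srcs] at hx; subst hx; trivial
    | succ k =>
      simp only [srcs, Fin.cases_succ] at hx
      split_ifs at hx <;> simp at hx <;> rcases hx with rfl | rfl | rfl <;>
        simp [Src.Below, wireRank]
  | pre y b =>
    rcases y with _ | ⟨_ | _, _⟩ <;> simp [srcs] at hx <;> subst hx <;> trivial
  | mf y b =>
    rcases y with _ | ⟨_ | _, a⟩
    · simp [srcs] at hx; rcases hx with rfl | rfl <;> simp [Src.Below, wireRank]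
    · simp only [srcs] at hx
      split_ifs at hx <;> simp at hx
      · rcases hx with rfl | rfl <;> simp [Src.Below, wireRank]
      · subst hx; simp [Src.Below, wireRank]
    · simp [srcs] at hx; rcases hx with rfl | rfl <;> simp [Src.Below, wireRank]
  | par t b =>
    simp only [srcs] at hx
    split at hx
    · simp at hx; subst hx; trivial
    · split at hx
      · simp at hx; subst hx; trivial
      · simp at hx
    · simp at hx
  | chainA k u b =>
    induction b using Fin.cases with
    | zero =>
      rcases u with u | u <;> simp [srcs] at hx <;> subst hx <;> simp [Src.Below, wireRank]
    | succ b =>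
      simp only [srcs, Fin.cases_succ, List.mem_cons, List.not_mem_nil, or_false] at hx
      rcases hx with rfl | rfl <;> simp [Src.Below, wireRank]
  | unit k u =>
    simp only [srcs, List.mem_cons, List.not_mem_nil, or_false] at hx
    rcases hx with rfl | rfl <;> simp [Src.Below, wireRank]
    omega
  | sel k t =>
    simp only [srcs] at hx
    split at hx
    · simp at hx; subst hx; trivial
    · simp at hx; subst hx; trivial
    · simp at hx; subst hx; simp [Src.Below, wireRank]
    · simp at hx; subst hx; simp [Src.Below, wireRank]
    · exact below_andSrc (by simp [wireRank]) (by simp [wireRank]) x hx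
  | term k t b =>
    simp only [srcs, List.mem_singleton] at hx
    subst hx
    refine ⟨dataWire_ne_sel _ _ _ _ _, by simp [wireRank], ?_⟩
    have := wireRank_dataWire (m := m) (K := K) Sp t b
    refine lt_of_le_of_lt this ?_
    simp [wireRank]
  | acc k t b =>
    induction t using Fin.cases with
    | zero => simp [srcs] at hx
    | succ t =>
      simp only [srcs, Fin.cases_succ, List.mem_cons, List.not_mem_nil, or_false] at hx
      rcases hx with rfl | rfl | rfl <;> simp [Src.Below, wireRank] <;> omega
  | carry k t b =>
    induction b using Fin.cases with
    | zero => simp [srcs] at hx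
    | succ b =>
      simp only [srcs, Fin.cases_succ, List.mem_cons, List.not_mem_nil, or_false] at hx
      rcases hx with rfl | rfl | rfl <;> simp [Src.Below, wireRank] <;> omega
  | hitB k b =>
    simp only [srcs, List.mem_singleton] at hx
    subst hx
    simp [Src.Below, wireRank]
    omega
  | chainB k b =>
    induction b using Fin.cases with
    | zero => simp [srcs] at hx; subst hx; trivial
    | succ b =>
      simp only [srcs, Fin.cases_succ, List.mem_cons, List.not_mem_nil, or_false] at hx
      rcases hx with rfl | rfl <;> simp [Src.Below, wireRank]
  | val k =>
    simp only [srcs] at hx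
    split at hx
    · simp at hx; subst hx; simp [Src.Below, wireRank]
    · simp at hx; subst hx; simp [Src.Below, wireRank]
    all_goals exact below_andSrc (by simp [wireRank]) (by simp [wireRank]) x hx
  | found k =>
    induction k using Fin.cases with
    | zero => simp [srcs] at hx
    | succ k =>
      simp only [srcs, Fin.cases_succ, List.mem_cons, List.not_mem_nil, or_false] at hx
      rcases hx with rfl | rfl | rfl <;> simp [Src.Below, wireRank] <;> omega
  | res k =>
    induction k using Fin.cases with
    | zero => simp [srcs] at hx
    | succ k =>
      simp only [srcs, Fin.cases_succ, List.mem_cons, List.not_mem_nil, or_false] at hx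
      rcases hx with rfl | rfl | rfl <;> simp [Src.Below, wireRank] <;> omega
  | one => simp [srcs] at hx; subst hx; trivial
  | nside => simp [srcs] at hx; rcases hx with rfl | rfl <;> simp [Src.Below, wireRank]
  | hitA k u b => simp [srcs] at hx; subst hx; simp [Src.Below, wireRank]
  | good k => simp [srcs] at hx; subst hx; simp [Src.Below, wireRank]; omega
  | out => simp [srcs] at hx; rcases hx with rfl | rfl <;> simp [Src.Below, wireRank]; omega
  | quarts => simp [srcs] at hx; subst hx; simp [Src.Below, wireRank]
  | inRange => simp [srcs] at hx; subst hx; simp [Src.Below, wireRank]; omega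
  | flag => simp [srcs] at hx; subst hx; simp [Src.Below, wireRank]; omega
  | side => simp [srcs] at hx
  | quart _ => simp [srcs] at hx
  | idx _ => simp [srcs] at hx
  | vis _ => simp [srcs] at hx
  | reg _ _ _ => simp [srcs] at hx
  | coinA _ _ _ => simp [srcs] at hx
  | coinB _ _ => simp [srcs] at hx

theorem SamplerSpec.length_srcs_le (Sp : SamplerSpec nv nh T) (N : ℕ) (w : Wire nv nh m l K T) :
    (Sp.srcs N w).length ≤ 3 := by
  have ha : ∀ a b : Wire nv nh m l K T, (andSrc (nv := nv) (nh := nh) a b).length ≤ 3 := by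
    intro a b; unfold andSrc; split_ifs <;> simp
  cases w with
  | le k =>
    induction k using Fin.cases <;> simp only [srcs, Fin.cases_zero, Fin.cases_succ] <;>
      try split_ifs
    all_goals simp
  | pre y b => rcases y with _ | ⟨_ | _, _⟩ <;> simp [srcs]
  | mf y b => rcases y with _ | ⟨_ | _, a⟩ <;> simp only [srcs] <;> try split_ifs
              all_goals simp
  | par t b =>
    simp only [srcs]
    split
    · simp
    · split <;> simp
    · simp
  | chainA k u b => induction b using Fin.cases <;> rcases u with u | u <;> simp [srcs]
  | sel k t => simp only [srcs]; split <;> first | exact ha _ _ | simp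
  | acc k t b => induction t using Fin.cases <;> simp [srcs]
  | carry k t b => induction b using Fin.cases <;> simp [srcs]
  | chainB k b => induction b using Fin.cases <;> simp [srcs]
  | val k => simp only [srcs]; split <;> first | exact ha _ _ | simp
  | found k => induction k using Fin.cases <;> simp [srcs]
  | res k => induction k using Fin.cases <;> simp [srcs]
  | _ => simp [srcs]

end

section

variable {nv nh N l K T : ℕ} [NeZero l]

/-- The oracle query of the sampling circuit. -/
def samplerQuery : COp nv nh N (Wire nv nh (Nat.clog 2 N) l K T) :=
  .query ⟨Sum.elim .idx .vis, by rintro (a | a) (b | b) h <;> simp_all⟩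

/-- The mean-field evaluation of the sampling circuit. -/
def SamplerSpec.samplerMeanField (Sp : SamplerSpec nv nh T) :
    COp nv nh N (Wire nv nh (Nat.clog 2 N) l K T) :=
  .meanField (4 * l)
    (fun o z x => match o with
      | some _ => (Sp.encU z (finProdFinEquiv.symm x).1).testBit (finProdFinEquiv.symm x).2
      | none => (Sp.encZ z).testBit (finProdFinEquiv.symm x).2)
    ⟨Sum.elim .vis fun p => .reg p.1 (finProdFinEquiv.symm p.2).1 (finProdFinEquiv.symm p.2).2, by
      rintro (a | ⟨a, a'⟩) (b | ⟨b, b'⟩) h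
      · simp_all
      · simp at h
      · simp at h
      · simp only [Sum.elim_inr, Wire.reg.injEq] at h
        obtain ⟨h1, h2, h3⟩ := h
        have : finProdFinEquiv.symm a' = finProdFinEquiv.symm b' := Prod.ext h2 h3
        rw [h1, finProdFinEquiv.symm.injective this]⟩

/-- The classical part of the sampling circuit. -/
def SamplerSpec.classicalOps (Sp : SamplerSpec nv nh T) :
    List (COp nv nh N (Wire nv nh (Nat.clog 2 N) l K T)) :=
  samplerQuery :: Sp.samplerMeanField :: netlist (Sp.srcs N) (rankedWires wireRank)

/-! #### The computed function -/

/-- The bits of the mean-field data, of the machine clamped to `x` if `σ` holds and of the machine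
itself otherwise. For clamped units only the bit with the value of the unit is used. -/
def SamplerSpec.slotBit (Sp : SamplerSpec nv nh T) (I : Instance nv nh N) (σ : Bool)
    (x : Config nv) (y : Option (Unt nv nh × Fin 4)) (b : ℕ) : Bool :=
  match σ, y with
  | true, none => (Sp.encZ (clampedZQ I.θ x (I.νx x))).testBit b
  | true, some (.inr j, a) => (Sp.encU (I.νx x j) a).testBit b
  | true, some (.inl i, a) => decide (a = 1) && x i
  | false, none => (Sp.encZ (zQ I.θ I.μ I.ν)).testBit b
  | false, some (.inl i, a) => (Sp.encU (I.μ i) a).testBit b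
  | false, some (.inr j, a) => (Sp.encU (I.ν j) a).testBit b

/-- The bits of a term of the exponent. -/
def SamplerSpec.termBit (Sp : SamplerSpec nv nh T) (I : Instance nv nh N) (σ : Bool)
    (x : Config nv) (t : ExpTerm nv nh) (b : ℕ) : Bool :=
  match t with
  | .logZ => Sp.slotBit I σ x none b
  | .base u => Sp.slotBit I σ x (some (u, 2)) b
  | .slope u => Sp.slotBit I σ x (some (u, 3)) b
  | .bias u => (Sp.encP (I.θ (biasCoord u))).testBit b
  | .pair a b' =>
      match pairCoord a b' with
      | some c => (Sp.encP (I.θ c)).testBit b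
      | none => false

/-- The value of a unit sampled with the coins `A`. -/
def SamplerSpec.unitVal (Sp : SamplerSpec nv nh T) (I : Instance nv nh N) (σ : Bool)
    (x : Config nv) (u : Unt nv nh) (A : Fin l → Bool) : Bool :=
  xor (Sp.slotBit I σ x (some (u, 1)) 0) ((u.isRight || !σ) &&
    decide (∀ b : Fin l, (Sp.slotBit I σ x (some (u, 0)) b && A b) = false))

/-- The exponent for a configuration of the units. -/
def SamplerSpec.total (Sp : SamplerSpec nv nh T) (l : ℕ) (I : Instance nv nh N) (σ : Bool)
    (x : Config nv) (s : Unt nv nh → Bool) : ℕ :=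
  ∑ t, if (Sp.tm t).sel s then binValue (fun b : Fin l => Sp.termBit I σ x (Sp.tm t) b) else 0

/-- A trial of rejection sampling with coins `A` and `B`: whether the trial is accepted, and the
value of the monomial. -/
def SamplerSpec.trial (Sp : SamplerSpec nv nh T) (I : Instance nv nh N) (σ : Bool)
    (x : Config nv) (A : Unt nv nh → Fin l → Bool) (B : Fin l → Bool) : Bool × Bool :=
  (decide (∀ b : Fin l,
      ((Sp.total l I σ x fun u => Sp.unitVal I σ x u (A u)).testBit b && B b) = false),
    coordVal Sp.c fun u => Sp.unitVal I σ x u (A u))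

theorem evalSrcs_andSrc {α : Type} [DecidableEq α] (I : Instance nv nh N) (s : α → Bool) (a b : α) :
    evalSrcs I s (andSrc a b) = (s a && s b) := by
  unfold andSrc
  split_ifs with h
  · subst h; simp [evalSrcs, Src.eval]
  · simp [evalSrcs, Src.eval]

/-- The wires that are not changed by the classical part of the circuit. -/
def Wire.isCoin {m : ℕ} : Wire nv nh m l K T → Bool
  | .side => true
  | .quart _ => true
  | .idx _ => true
  | .coinA _ _ _ => true
  | .coinB _ _ => true
  | _ => false

/-- The final value of the flag. -/
theorem SamplerSpec.crun_flag (Sp : SamplerSpec nv nh T) (I : Instance nv nh N)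
    (s₀ : Wire nv nh (Nat.clog 2 N) l K T → Bool) (hs₀ : ∀ w, w.isCoin = false → s₀ w = false) :
    crun I Sp.classicalOps s₀ .flag =
      ((s₀ (.quart false) && s₀ (.quart true)) &&
        (decide (binValue (fun k => s₀ (.idx k)) ≤ (N - 1) % 2 ^ Nat.clog 2 N) &&
          xor (firstAccepted fun k => Sp.trial I (s₀ .side)
            (trainingVector I.x (binValue fun k => s₀ (.idx k)))
            (fun u b => s₀ (.coinA k u b)) (fun b => s₀ (.coinB k b))) (!s₀ .side))) := by
  set x := trainingVector I.x (binValue fun k => s₀ (.idx k)) with hx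
  set σ := s₀ .side with hσ
  -- The query and the mean-field evaluation fill the wires `vis` and `reg`; all other wires are
  -- computed from them and from the coins by the netlist.
  set s₁ := (samplerQuery : COp nv nh N (Wire nv nh (Nat.clog 2 N) l K T)).act I s₀ with hs₁
  set s₂ := Sp.samplerMeanField.act I s₁ with hs₂
  have m1 : ∀ w, (samplerQuery : COp nv nh N (Wire nv nh (Nat.clog 2 N) l K T)).mask I s₀ w =
      true ↔ ∃ i, Wire.vis i = w ∧ x i = true := fun w =>
    @decide_eq_true_iff _ (Classical.propDecidable _)
  have h1v : ∀ i, s₁ (.vis i) = x i := by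
    intro i
    rw [hs₁, COp.act, hs₀ _ rfl, Bool.false_xor, Bool.eq_iff_iff, m1]
    constructor
    · rintro ⟨i', h, h'⟩
      rw [Wire.vis.injEq] at h
      exact h ▸ h'
    · exact fun h => ⟨i, rfl, h⟩
  have h1 : ∀ w, (∀ i, w ≠ .vis i) → s₁ w = s₀ w := by
    intro w hw
    have : (samplerQuery : COp nv nh N (Wire nv nh (Nat.clog 2 N) l K T)).mask I s₀ w = false := by
      rw [← Bool.not_eq_true, m1]
      rintro ⟨i, h, -⟩
      exact hw i h.symm
    rw [hs₁, COp.act, this, Bool.xor_false]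
  have hx1 : (fun i => s₁ (.vis i)) = x := funext h1v
  have m2 : ∀ w, Sp.samplerMeanField.mask I s₁ w = true ↔
      ∃ k : Option (Fin nh) × Fin (4 * l),
        Wire.reg k.1 (finProdFinEquiv.symm k.2).1 (finProdFinEquiv.symm k.2).2 = w ∧
        (match k.1 with
          | some j => (Sp.encU (I.νx x j) (finProdFinEquiv.symm k.2).1).testBit
              (finProdFinEquiv.symm k.2).2
          | none => (Sp.encZ (clampedZQ I.θ x (I.νx x))).testBit
              (finProdFinEquiv.symm k.2).2) = true := by
    intro w
    refine (@decide_eq_true_iff _ (Classical.propDecidable _)).trans ?_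
    refine exists_congr fun k => and_congr Iff.rfl ?_
    obtain ⟨o, k⟩ := k
    rw [← hx1]
    cases o <;> exact Iff.rfl
  have h2 : ∀ w, (∀ o a b, w ≠ .reg o a b) → s₂ w = s₁ w := by
    intro w hw
    have : Sp.samplerMeanField.mask I s₁ w = false := by
      rw [← Bool.not_eq_true, m2]
      rintro ⟨k, h, -⟩
      exact hw _ _ _ h.symm
    rw [hs₂, COp.act, this, Bool.xor_false]
  have h2r : ∀ o a b, s₂ (.reg o a b) =
      (match o with
        | some j => (Sp.encU (I.νx x j) a).testBit b
        | none => (Sp.encZ (clampedZQ I.θ x (I.νx x))).testBit b) := by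
    intro o a b
    rw [hs₂, COp.act, h1 _ (by simp), hs₀ _ rfl, Bool.false_xor, Bool.eq_iff_iff, m2]
    constructor
    · rintro ⟨⟨o', y⟩, hy, h⟩
      rw [Wire.reg.injEq] at hy
      obtain ⟨rfl, rfl, rfl⟩ := hy
      exact h
    · intro h
      refine ⟨⟨o, finProdFinEquiv (a, b)⟩, ?_, ?_⟩
      · rw [Equiv.symm_apply_apply]
      · rw [Equiv.symm_apply_apply]
        exact h
  set s := crun I Sp.classicalOps s₀ with hs
  have hs' : s = crun I (netlist (Sp.srcs N) (rankedWires wireRank)) s₂ := rfl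
  -- The final values satisfy the equations of the netlist, in which all wires have their final
  -- values.
  have E : ∀ w, s w = xor (s₂ w) (evalSrcs I s (Sp.srcs N w)) := by
    intro w
    rw [hs']
    exact crun_netlist_ranked I (Sp.srcs N) wireRank (Sp.below N) s₂ w
  have Z : ∀ w, w.isCoin = false → (∀ i, w ≠ .vis i) → (∀ o a b, w ≠ .reg o a b) →
      s w = evalSrcs I s (Sp.srcs N w) := by
    intro w hw1 hw2 hw3
    rw [E, h2 w hw3, h1 w hw2, hs₀ w hw1, Bool.false_xor]
  have Cn : ∀ w, w.isCoin = true → s w = s₀ w := by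
    intro w hw
    have hw2 : ∀ i, w ≠ .vis i := by rintro i rfl; simp [Wire.isCoin] at hw
    have hw3 : ∀ o a b, w ≠ .reg o a b := by rintro o a b rfl; simp [Wire.isCoin] at hw
    rw [E, h2 w hw3, h1 w hw2]
    have : Sp.srcs N w = [] := by cases w <;> simp [Wire.isCoin] at hw <;> rfl
    rw [this]; simp [evalSrcs]
  have Vis : ∀ i, s (.vis i) = x i := by
    intro i
    rw [E, h2 _ (by simp), h1v]; simp [srcs, evalSrcs]
  have Reg : ∀ o a b, s (.reg o a b) =
      (match o with
        | some j => (Sp.encU (I.νx x j) a).testBit b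
        | none => (Sp.encZ (clampedZQ I.θ x (I.νx x))).testBit b) := by
    intro o a b
    rw [E, h2r]; simp [srcs, evalSrcs]
  have Side : s .side = σ := Cn _ rfl
  -- The values of the wires, in the order in which they are computed.
  have Nside : s .nside = !σ := by
    rw [Z _ rfl (by simp) (by simp)]; simp [srcs, evalSrcs, Src.eval, Side]
  have Mf : ∀ y b, s (.mf y b) =
      (match y with
        | some (.inl _, a) => if σ = true ∧ a ≠ 1 then false else Sp.slotBit I σ x y b
        | _ => Sp.slotBit I σ x y b) := by
    intro y b
    rw [Z _ rfl (by simp) (by simp)]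
    rcases y with _ | ⟨i | j, a⟩
    · have hp := Z (.pre none b) rfl (by simp) (by simp)
      simp only [srcs, evalSrcs, List.foldr_cons, List.foldr_nil, Src.eval, Bool.xor_false] at hp ⊢
      rw [hp, Nside, Side, Reg]
      cases hc : σ <;> simp [slotBit, Instance.value]
    · have hp := Z (.pre (some (.inl i, a)) b) rfl (by simp) (by simp)
      simp only [srcs, evalSrcs, List.foldr_cons, List.foldr_nil, Src.eval, Bool.xor_false] at hp ⊢
      rw [hp, Nside]
      by_cases ha : a = 1
      · simp only [ha, if_true, List.foldr_cons, List.foldr_nil, Side, Vis]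
        cases hc : σ <;> simp [slotBit, Instance.value]
      · simp only [ha, if_false, List.foldr_nil]
        cases hc : σ <;> simp [slotBit, Instance.value, ha]
    · have hp := Z (.pre (some (.inr j, a)) b) rfl (by simp) (by simp)
      simp only [srcs, evalSrcs, List.foldr_cons, List.foldr_nil, Src.eval, Bool.xor_false] at hp ⊢
      rw [hp, Nside, Side, Reg]
      cases hc : σ <;> simp [slotBit, Instance.value]
  have Mf' : ∀ y b, s (.mf y b) = Sp.slotBit I σ x y b := by
    intro y b
    rw [Mf]
    rcases y with _ | ⟨i | j, a⟩
    · rfl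
    · simp only
      split_ifs with h
      · rw [h.1]; simp [slotBit, h.2]
      · rfl
    · rfl
  -- A chain of conjunctions records whether none of the coins of a unit hits a digit.
  have Unit : ∀ k u, s (.unit k u) = Sp.unitVal I σ x u fun b => s₀ (.coinA k u b) := by
    intro k u
    have hch := chain_last_iff (fun b => s (.hitA k u b)) (fun b => s (.chainA k u b)) (by
      intro b
      have := Z (.chainA k u b.succ) rfl (by simp) (by simp)
      simpa only [srcs, Fin.cases_succ, evalSrcs, List.foldr_cons, List.foldr_nil, Src.eval,
        Bool.xor_false] using this)
    have h0 : s (.chainA k u 0) = (u.isRight || !σ) := by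
      rw [Z _ rfl (by simp) (by simp)]
      rcases u with u | u <;> simp [srcs, evalSrcs, Src.eval, Nside]
    have hh : ∀ b, s (.hitA k u b) = (Sp.slotBit I σ x (some (u, 0)) b && s₀ (.coinA k u b)) := by
      intro b
      rw [Z _ rfl (by simp) (by simp)]
      simp only [srcs, evalSrcs, List.foldr_cons, List.foldr_nil, Src.eval, Bool.xor_false, Mf']
      rw [Cn _ rfl]
    rw [Z _ rfl (by simp) (by simp)]
    simp only [srcs, evalSrcs, List.foldr_cons, List.foldr_nil, Src.eval, Bool.xor_false, Mf', hch,
      h0, hh]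
    rfl
  have Sel : ∀ k t, s (.sel k t) =
      (Sp.tm t).sel fun u => Sp.unitVal I σ x u fun b => s₀ (.coinA k u b) := by
    intro k t
    rw [Z _ rfl (by simp) (by simp)]
    simp only [srcs]
    cases Sp.tm t <;> simp only [ExpTerm.sel, evalSrcs_andSrc, Unit] <;>
      simp [evalSrcs, Src.eval, Unit]
  have Data : ∀ t b, s (Sp.dataWire t b) = Sp.termBit I σ x (Sp.tm t) b := by
    intro t b
    have hp := Z (.par t b) rfl (by simp) (by simp)
    simp only [srcs] at hp
    unfold dataWire
    cases ht : Sp.tm t with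
    | logZ => simp only [termBit]; exact Mf' _ _
    | base u => simp only [termBit]; exact Mf' _ _
    | slope u => simp only [termBit]; exact Mf' _ _
    | bias u =>
      rw [ht] at hp
      simp only [termBit]
      rw [hp]; simp [evalSrcs, Src.eval, Instance.value]
    | pair a b' =>
      rw [ht] at hp
      simp only [termBit]
      rw [hp]
      cases hc : pairCoord a b' <;> simp only [hc] <;> simp [evalSrcs, Src.eval, Instance.value]
  have Term : ∀ k t b, s (.term k t b) = (((Sp.tm t).sel fun u => Sp.unitVal I σ x u fun b =>
      s₀ (.coinA k u b)) && Sp.termBit I σ x (Sp.tm t) b) := by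
    intro k t b
    rw [Z _ rfl (by simp) (by simp)]
    simp only [srcs, evalSrcs, List.foldr_cons, List.foldr_nil, Src.eval, Bool.xor_false, Sel, Data]
  -- The accumulator holds the sum of the selected terms modulo `2 ^ l`, by ripple-carry addition.
  have Acc : ∀ k, (fun b : Fin l => s (.acc k (Fin.last T) b)) =
      fun b : Fin l => (Sp.total l I σ x fun u => Sp.unitVal I σ x u fun b =>
        s₀ (.coinA k u b)).testBit b := by
    intro k
    apply eq_testBit_of_binValue
    have key : ∀ t : Fin (T + 1), binValue (fun b : Fin l => s (.acc k t b)) =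
        (∑ t' : Fin T, if t'.castSucc < t then
          (if (Sp.tm t').sel (fun u => Sp.unitVal I σ x u fun b => s₀ (.coinA k u b)) then
            binValue (fun b : Fin l => Sp.termBit I σ x (Sp.tm t') b) else 0) else 0) % 2 ^ l := by
      intro t
      induction t using Fin.induction with
      | zero =>
        have : ∀ b, s (.acc k 0 b) = false := by
          intro b
          rw [Z _ rfl (by simp) (by simp)]
          simp [srcs, evalSrcs]
        simp [this, binValue]
      | succ t ih =>
        have hadd := binValue_add_mod (fun b : Fin l => s (.acc k t.castSucc b))
          (fun b => s (.term k t b)) (fun b => s (.acc k t.succ b)) (fun b => s (.carry k t b))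
          (by
            rw [Z _ rfl (by simp) (by simp)]
            simp [srcs, evalSrcs])
          (by
            intro b
            have := Z (.acc k t.succ b) rfl (by simp) (by simp)
            simpa only [srcs, Fin.cases_succ, evalSrcs, List.foldr_cons, List.foldr_nil, Src.eval,
              Bool.xor_false] using this)
          (by
            intro b
            have := Z (.carry k t b.succ) rfl (by simp) (by simp)
            simpa only [srcs, Fin.cases_succ, evalSrcs, List.foldr_cons, List.foldr_nil, Src.eval,
              Bool.xor_false] using this)
        rw [hadd, ih, Nat.mod_add_mod]
        congr 1
        have hterm : binValue (fun b : Fin l => s (.term k t b)) =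
            if (Sp.tm t).sel (fun u => Sp.unitVal I σ x u fun b => s₀ (.coinA k u b)) then
              binValue (fun b : Fin l => Sp.termBit I σ x (Sp.tm t) b) else 0 := by
          simp only [Term]
          split_ifs with h
          · simp [h]
          · rw [Bool.not_eq_true] at h
            simp [h, binValue]
        rw [hterm]
        have hsplit : ∀ (f : Fin T → ℕ), (∑ t' : Fin T, if t'.castSucc < t.succ then f t' else 0) =
            (∑ t' : Fin T, if t'.castSucc < t.castSucc then f t' else 0) + f t := by
          intro f
          have : ∀ t' : Fin T, (if t'.castSucc < t.succ then f t' else 0) =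
              (if t'.castSucc < t.castSucc then f t' else 0) + if t' = t then f t' else 0 := by
            intro t'
            simp only [Fin.castSucc_lt_succ_iff, Fin.castSucc_lt_castSucc_iff]
            rcases lt_trichotomy t' t with h | h | h
            · simp [h, h.le, h.ne]
            · simp [h]
            · simp [not_lt_of_gt h, not_le_of_gt h, h.ne']
          simp only [this, Finset.sum_add_distrib]
          simp
        rw [hsplit]
    rw [key (Fin.last T)]
    simp only [Fin.castSucc_lt_last, if_true]
    rfl
  have Trial : ∀ k, (s (.chainB k (Fin.last l)), s (.val k)) =
      Sp.trial I σ x (fun u b => s₀ (.coinA k u b)) (fun b => s₀ (.coinB k b)) := by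
    intro k
    have hch := chain_last_iff (fun b => s (.hitB k b)) (fun b => s (.chainB k b)) (by
      intro b
      have := Z (.chainB k b.succ) rfl (by simp) (by simp)
      simpa only [srcs, Fin.cases_succ, evalSrcs, List.foldr_cons, List.foldr_nil, Src.eval,
        Bool.xor_false] using this)
    have h0 : s (.chainB k 0) = true := by
      rw [Z _ rfl (by simp) (by simp)]
      simp [srcs, evalSrcs, Src.eval]
    have hh : ∀ b, s (.hitB k b) = ((Sp.total l I σ x fun u => Sp.unitVal I σ x u fun b =>
        s₀ (.coinA k u b)).testBit b && s₀ (.coinB k b)) := by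
      intro b
      rw [Z _ rfl (by simp) (by simp)]
      simp only [srcs, evalSrcs, List.foldr_cons, List.foldr_nil, Src.eval, Bool.xor_false]
      rw [Cn (.coinB k b) rfl, congrFun (Acc k) b]
    refine Prod.ext ?_ ?_
    · simp only [hch, h0, hh, Bool.true_and]
      rfl
    · change s (.val k) = _
      rw [Z _ rfl (by simp) (by simp)]
      simp only [srcs, trial]
      cases Sp.c <;> simp only [coordVal, evalSrcs_andSrc, Unit] <;>
        simp [evalSrcs, Src.eval, Unit]
  have Res := firstAccepted_eq
    (fun k => Sp.trial I σ x (fun u b => s₀ (.coinA k u b)) (fun b => s₀ (.coinB k b)))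
    (fun k => s (.found k)) (fun k => s (.res k))
    (by rw [Z _ rfl (by simp) (by simp)]; simp [srcs, evalSrcs])
    (by rw [Z _ rfl (by simp) (by simp)]; simp [srcs, evalSrcs])
    (by
      intro k
      rw [← Trial]
      have := Z (.found k.succ) rfl (by simp) (by simp)
      simpa only [srcs, Fin.cases_succ, evalSrcs, List.foldr_cons, List.foldr_nil, Src.eval,
        Bool.xor_false] using this)
    (by
      intro k
      rw [← Trial]
      have hg := Z (.good k) rfl (by simp) (by simp)
      have := Z (.res k.succ) rfl (by simp) (by simp)
      simp only [srcs, Fin.cases_succ, evalSrcs, List.foldr_cons, List.foldr_nil, Src.eval,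
        Bool.xor_false] at hg this
      rw [this, hg])
  have Le : s (.le (Fin.last _)) =
      decide (binValue (fun k => s₀ (.idx k)) ≤ (N - 1) % 2 ^ Nat.clog 2 N) := by
    have hle := binValue_le_iff (fun k => s₀ (.idx k))
      (fun k : Fin (Nat.clog 2 N) => (N - 1).testBit k) (fun k => s (.le k))
      (by rw [Z _ rfl (by simp) (by simp)]; simp [srcs, evalSrcs, Src.eval])
      (by
        intro k
        rw [Z _ rfl (by simp) (by simp)]
        simp only [srcs, Fin.cases_succ]
        split_ifs with h
        · simp only [evalSrcs, List.foldr_cons, List.foldr_nil, Src.eval, Bool.xor_false]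
          rw [Cn (.idx k) rfl]
          cases s₀ (.idx k) <;> cases s (.le k.castSucc) <;> rfl
        · simp only [evalSrcs, List.foldr_cons, List.foldr_nil, Src.eval, Bool.xor_false]
          rw [Cn (.idx k) rfl]
          cases s₀ (.idx k) <;> cases s (.le k.castSucc) <;> rfl)
    rw [binValue_testBit] at hle
    rw [Bool.eq_iff_iff, hle, decide_eq_true_eq]
  have eF := Z .flag rfl (by simp) (by simp)
  have eI := Z .inRange rfl (by simp) (by simp)
  have eQ := Z .quarts rfl (by simp) (by simp)
  have eO := Z .out rfl (by simp) (by simp)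
  simp only [srcs, evalSrcs, List.foldr_cons, List.foldr_nil, Src.eval, Bool.xor_false]
    at eF eI eQ eO
  rw [eF, eI, eQ, eO, Cn (.quart _) rfl, Cn (.quart _) rfl, Le, Nside]
  rw [← Res]

end

/-! ### The statistics of the sampling circuit -/

/-- The number `y`, read with `f` binary places, is turned into an event of probability
`exp (-y / 2 ^ f)` by one coin for each of its digits. -/
theorem bexp_digit_coins (f : ℕ) {l : ℕ} (y : Fin l → Bool) :
    bexp (fun b : Fin l => 1 - Real.exp (-(2 ^ (b : ℕ) / 2 ^ f)))
      (fun A => if ∀ b : Fin l, (y b && A b) = false then 1 else 0) =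
      Real.exp (-(binValue y / 2 ^ f)) := by
  have h : ∀ A : Fin l → Bool, (if ∀ b : Fin l, (y b && A b) = false then (1 : ℝ) else 0) =
      ∏ b, if (y b && A b) then 0 else 1 := by
    intro A
    split_ifs with h
    · exact (Finset.prod_eq_one fun b _ => by simp [h b]).symm
    · push Not at h
      obtain ⟨b, hb⟩ := h
      refine (Finset.prod_eq_zero (Finset.mem_univ b) ?_).symm
      simp only [ne_eq, Bool.not_eq_false] at hb
      simp [hb]
  unfold bexp
  simp only [h, ← Finset.prod_mul_distrib]
  rw [sum_prod_eq_prod_sum fun (b : Fin l) (t : Bool) =>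
    bern (1 - Real.exp (-(2 ^ (b : ℕ) / 2 ^ f))) t * if (y b && t) then 0 else 1]
  unfold binValue
  rw [Nat.cast_sum, Finset.sum_div, ← Finset.sum_neg_distrib, Real.exp_sum]
  refine Finset.prod_congr rfl fun b _ => ?_
  cases y b <;> simp [bern]

section

variable {nv nh N l K T : ℕ} [NeZero l]

/-- The coins of the sampling circuit. -/
def coinProb (f : ℕ) {m : ℕ} : Wire nv nh m l K T → ℝ
  | .side => 1 / 2
  | .quart _ => 1 / 2
  | .idx _ => 1 / 2
  | .coinA _ _ b => 1 - Real.exp (-(2 ^ (b : ℕ) / 2 ^ f))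
  | .coinB _ b => 1 - Real.exp (-(2 ^ (b : ℕ) / 2 ^ f))
  | _ => 0

theorem coinProb_mem (f : ℕ) {m : ℕ} (w : Wire nv nh m l K T) :
    0 ≤ coinProb f w ∧ coinProb f w ≤ 1 := by
  have h : ∀ b : ℕ, 0 ≤ 1 - Real.exp (-(2 ^ b / 2 ^ f)) ∧ 1 - Real.exp (-(2 ^ b / 2 ^ f)) ≤ 1 := by
    intro b
    have h1 : Real.exp (-(2 ^ b / 2 ^ f)) ≤ 1 := by
      rw [Real.exp_le_one_iff]; simp; positivity
    have := Real.exp_pos (-(2 ^ b / 2 ^ f))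
    constructor <;> linarith
  cases w <;> simp only [coinProb] <;> first | exact h _ | norm_num

/-- The probability that a unit is active in a trial. -/
def SamplerSpec.unitProb (Sp : SamplerSpec nv nh T) (f l : ℕ) (I : Instance nv nh N) (σ : Bool)
    (x : Config nv) (u : Unt nv nh) : ℝ :=
  let e := if u.isRight || !σ then
    Real.exp (-(binValue (fun b : Fin l => Sp.slotBit I σ x (some (u, 0)) b) / 2 ^ f)) else 0
  if Sp.slotBit I σ x (some (u, 1)) 0 then 1 - e else e

theorem SamplerSpec.unitProb_mem (Sp : SamplerSpec nv nh T) (f l : ℕ) (I : Instance nv nh N)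
    (σ : Bool) (x : Config nv) (u : Unt nv nh) :
    0 ≤ Sp.unitProb f l I σ x u ∧ Sp.unitProb f l I σ x u ≤ 1 := by
  set y := binValue (fun b : Fin l => Sp.slotBit I σ x (some (u, 0)) b) with hy
  have h1 : Real.exp (-((y : ℝ) / 2 ^ f)) ≤ 1 := by
    rw [Real.exp_le_one_iff]; simp; positivity
  have h0 := Real.exp_pos (-((y : ℝ) / 2 ^ f))
  unfold unitProb
  simp only [← hy]
  split_ifs <;> constructor <;> linarith

/-- The probability of the event that a trial is accepted, weighted with `F`. -/
def SamplerSpec.accepted (Sp : SamplerSpec nv nh T) (f l : ℕ) (I : Instance nv nh N) (σ : Bool)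
    (x : Config nv) (F : (Unt nv nh → Bool) → ℝ) : ℝ :=
  bexp (Sp.unitProb f l I σ x) fun s =>
    Real.exp (-((Sp.total l I σ x s % 2 ^ l : ℕ) / 2 ^ f)) * F s

theorem sum_unitVal (Sp : SamplerSpec nv nh T) (f : ℕ) (I : Instance nv nh N) (σ : Bool)
    (x : Config nv) (u : Unt nv nh) (t : Bool) :
    (∑ A : Fin l → Bool, if Sp.unitVal I σ x u A = t then
      ∏ b : Fin l, bern (1 - Real.exp (-(2 ^ (b : ℕ) / 2 ^ f))) (A b) else 0) =
      bern (Sp.unitProb f l I σ x u) t := by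
  have hc := bexp_digit_coins f (fun b : Fin l => Sp.slotBit I σ x (some (u, 0)) b)
  set E := Real.exp (-(binValue (fun b : Fin l => Sp.slotBit I σ x (some (u, 0)) b) / 2 ^ f)) with hE
  set p := fun b : Fin l => 1 - Real.exp (-(2 ^ (b : ℕ) / 2 ^ f)) with hp
  have h1 : bexp p (fun A => if Sp.unitVal I σ x u A = true then 1 else 0) =
      Sp.unitProb f l I σ x u := by
    unfold SamplerSpec.unitVal SamplerSpec.unitProb
    simp only [← hE]
    cases hs : Sp.slotBit I σ x (some (u, 1)) 0 <;> cases hu : (u.isRight || !σ)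
    · simp only [Bool.false_and, Bool.xor_false]
      simpa using bexp_const p 0
    · simp only [Bool.true_and, Bool.false_xor, decide_eq_true_eq]
      simpa using hc
    · simp only [Bool.false_and, Bool.xor_false]
      simpa using bexp_const p 1
    · have : bexp p (fun A : Fin l → Bool => if (true ^^ (true && decide (∀ b : Fin l,
          (Sp.slotBit I σ x (some (u, 0)) b && A b) = false))) = true then 1 else 0) =
          bexp p (fun A : Fin l → Bool => 1 - if (∀ b : Fin l,
          (Sp.slotBit I σ x (some (u, 0)) b && A b) = false) then (1 : ℝ) else 0) := by
        refine bexp_congr fun A => ?_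
        by_cases h : ∀ b : Fin l, (Sp.slotBit I σ x (some (u, 0)) b && A b) = false
        · simp only [h]; simp
        · simp only [h]; simp
      rw [this, bexp_one_sub, hc]
      simp
  have e : ∀ t, (∑ A : Fin l → Bool, if Sp.unitVal I σ x u A = t then ∏ b : Fin l, bern (p b) (A b)
      else 0) = bexp p (fun A => if Sp.unitVal I σ x u A = t then 1 else 0) := by
    intro t
    unfold bexp
    exact Finset.sum_congr rfl fun A _ => by rw [mul_ite, mul_one, mul_zero]
  rw [e]
  cases t
  · have : bexp p (fun A => if Sp.unitVal I σ x u A = false then 1 else 0) =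
        bexp p (fun A => 1 - if Sp.unitVal I σ x u A = true then (1 : ℝ) else 0) := by
      refine bexp_congr fun A => ?_
      cases Sp.unitVal I σ x u A <;> simp
    rw [this, bexp_one_sub, h1]
    simp [bern]
  · rw [h1]; simp [bern]

/-- The coins of one trial. -/
abbrev TrialCoin (nv nh l : ℕ) : Type := Unt nv nh × Fin l ⊕ Fin l

/-- The biases of the coins of one trial. -/
def trialCoinProb (f : ℕ) : TrialCoin nv nh l → ℝ
  | .inl (_, b) => 1 - Real.exp (-(2 ^ (b : ℕ) / 2 ^ f))
  | .inr b => 1 - Real.exp (-(2 ^ (b : ℕ) / 2 ^ f))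

/-- The distribution of the result of a trial. -/
def SamplerSpec.trialDist (Sp : SamplerSpec nv nh T) (f l : ℕ) [NeZero l] (I : Instance nv nh N)
    (σ : Bool) (x : Config nv) (a : Bool × Bool) : ℝ :=
  ∑ c : TrialCoin nv nh l → Bool,
    if Sp.trial I σ x (fun u b => c (.inl (u, b))) (fun b => c (.inr b)) = a then
      ∏ j, bern (trialCoinProb f j) (c j) else 0

theorem sum_trialDist (Sp : SamplerSpec nv nh T) (f : ℕ) (I : Instance nv nh N) (σ : Bool)
    (x : Config nv) : ∑ a, Sp.trialDist f l I σ x a = 1 := by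
  unfold SamplerSpec.trialDist
  rw [Finset.sum_comm]
  simp only [Finset.sum_ite_eq, Finset.mem_univ, if_true]
  exact sum_prod_bern _

theorem trialDist_accepted (Sp : SamplerSpec nv nh T) (f : ℕ) (I : Instance nv nh N) (σ : Bool)
    (x : Config nv) (v : Bool) : Sp.trialDist f l I σ x (true, v) =
      Sp.accepted f l I σ x fun s => if coordVal Sp.c s = v then 1 else 0 := by
  have h1 : Sp.trialDist f l I σ x (true, v) = bexp (trialCoinProb f) fun c : TrialCoin nv nh l → Bool =>
      if Sp.trial I σ x (fun u b => c (.inl (u, b))) (fun b => c (.inr b)) = (true, v)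
        then 1 else 0 := by
    unfold SamplerSpec.trialDist bexp
    exact Finset.sum_congr rfl fun A _ => by rw [mul_ite, mul_one, mul_zero]
  rw [h1, bexp_sum]
  simp only [Sum.elim_inl, Sum.elim_inr]
  have h2 : ∀ A : Unt nv nh → Fin l → Bool,
      (bexp (fun b : Fin l => trialCoinProb (nv := nv) (nh := nh) f (.inr b)) fun B =>
        if Sp.trial I σ x A B = (true, v) then 1 else 0) =
      Real.exp (-((Sp.total l I σ x (fun u => Sp.unitVal I σ x u (A u)) % 2 ^ l : ℕ) / 2 ^ f)) *
        if coordVal Sp.c (fun u => Sp.unitVal I σ x u (A u)) = v then 1 else 0 := by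
    intro A
    have := bexp_digit_coins f (fun b : Fin l =>
      (Sp.total l I σ x fun u => Sp.unitVal I σ x u (A u)).testBit b)
    rw [binValue_testBit] at this
    rw [← this, mul_comm, ← bexp_mul_left]
    refine bexp_congr fun B => ?_
    simp only [SamplerSpec.trial, Prod.mk.injEq, decide_eq_true_eq, ite_and]
    split_ifs <;> simp
  have h3 := bexp_curry (fun i : Unt nv nh × Fin l => trialCoinProb f (.inl i)) (fun A =>
      bexp (fun b : Fin l => trialCoinProb (nv := nv) (nh := nh) f (.inr b)) fun B =>
        if Sp.trial I σ x A B = (true, v) then 1 else 0)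
  refine h3.trans ?_
  simp only [h2]
  rw [sum_prod_pushforward (fun (u : Unt nv nh) (y : Fin l → Bool) =>
    ∏ j, bern (trialCoinProb f (.inl (u, j))) (y j)) (fun u y => Sp.unitVal I σ x u y)
    (fun s => Real.exp (-((Sp.total l I σ x s % 2 ^ l : ℕ) / 2 ^ f)) *
        if coordVal Sp.c s = v then 1 else 0)]
  unfold SamplerSpec.accepted bexp
  refine Finset.sum_congr rfl fun s _ => ?_
  congr 1
  exact Finset.prod_congr rfl fun u _ => sum_unitVal Sp f I σ x u (s u)

/-- The probability that there is an accepted trial, with value `1` in the first such trial. -/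
def SamplerSpec.resultProb (Sp : SamplerSpec nv nh T) (f l K : ℕ) [NeZero l] (I : Instance nv nh N)
    (σ : Bool) (x : Config nv) : ℝ :=
  ∑ y : Fin K → Bool × Bool, (∏ k, Sp.trialDist f l I σ x (y k)) * if firstAccepted y then 1 else 0

theorem resultProb_eq (Sp : SamplerSpec nv nh T) (f K : ℕ) (I : Instance nv nh N) (σ : Bool)
    (x : Config nv) :
    Sp.accepted f l I σ x (fun _ => 1) * Sp.resultProb f l K I σ x =
      Sp.accepted f l I σ x (fun s => if coordVal Sp.c s = true then 1 else 0) *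
        (1 - (1 - Sp.accepted f l I σ x (fun _ => 1)) ^ K) := by
  have h : Sp.accepted f l I σ x (fun _ => 1) =
      Sp.trialDist f l I σ x (true, true) + Sp.trialDist f l I σ x (true, false) := by
    rw [trialDist_accepted, trialDist_accepted]
    unfold SamplerSpec.accepted bexp
    rw [← Finset.sum_add_distrib]
    refine Finset.sum_congr rfl fun s _ => ?_
    rcases Bool.eq_false_or_eq_true (coordVal Sp.c s) with hv | hv <;> simp [hv]
  rw [h, ← trialDist_accepted]
  exact sum_firstAccepted _ (sum_trialDist Sp f I σ x) K

/-- The coins of the sampling circuit. -/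
abbrev Coin (nv nh m l K : ℕ) : Type := (Unit ⊕ Bool ⊕ Fin m) ⊕ Fin K × TrialCoin nv nh l

instance (m : ℕ) : DecidableEq (Coin nv nh m l K) := instDecidableEqSum

/-- The wire of a coin. -/
def Coin.wire {m : ℕ} : Coin nv nh m l K → Wire nv nh m l K T
  | .inl (.inl _) => .side
  | .inl (.inr (.inl i)) => .quart i
  | .inl (.inr (.inr k)) => .idx k
  | .inr (k, .inl (u, b)) => .coinA k u b
  | .inr (k, .inr b) => .coinB k b

theorem Coin.wire_injective {m : ℕ} :
    Function.Injective (Coin.wire : Coin nv nh m l K → Wire nv nh m l K T) := by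
  rintro ((a | a | a) | ⟨k, (⟨u, b⟩ | b)⟩) ((a' | a' | a') | ⟨k', (⟨u', b'⟩ | b')⟩) h <;>
    simp_all [Coin.wire]

theorem Coin.mem_range_wire {m : ℕ} (w : Wire nv nh m l K T) (hw : w.isCoin = true) :
    w ∈ Set.range (Coin.wire : Coin nv nh m l K → Wire nv nh m l K T) := by
  cases w <;> simp [Wire.isCoin] at hw
  · exact ⟨.inl (.inl ()), rfl⟩
  · exact ⟨.inl (.inr (.inl _)), rfl⟩
  · exact ⟨.inl (.inr (.inr _)), rfl⟩
  · exact ⟨.inr (_, .inl (_, _)), rfl⟩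
  · exact ⟨.inr (_, .inr _), rfl⟩

/-- A uniformly random index is in range with probability `N / 2 ^ clog 2 N`, and then uniformly
distributed. -/
theorem bexp_index (hN : 0 < N) (x : Fin N → Config nv) (G : Config nv → ℝ) :
    bexp (fun _ : Fin (Nat.clog 2 N) => (1 / 2 : ℝ)) (fun s =>
      if binValue s ≤ (N - 1) % 2 ^ Nat.clog 2 N then G (trainingVector x (binValue s)) else 0) =
      1 / 2 ^ Nat.clog 2 N * ∑ p, G (x p) := by
  set m := Nat.clog 2 N with hm
  have hNm : N ≤ 2 ^ m := Nat.le_pow_clog (by norm_num) N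
  rw [Nat.mod_eq_of_lt (by omega)]
  unfold bexp
  have hb : ∀ s : Fin m → Bool, ∏ i, bern (1 / 2) (s i) = 1 / 2 ^ m := by
    intro s
    have : ∀ b, bern (1 / 2) b = 1 / 2 := by intro b; cases b <;> norm_num [bern]
    rw [Finset.prod_congr rfl fun i _ => this (s i)]
    simp
  simp only [hb]
  rw [← Finset.mul_sum]
  congr 1
  have hv : ∀ p : Fin N, binValue (fun b : Fin m => (p : ℕ).testBit b) = p := by
    intro p
    rw [binValue_testBit, Nat.mod_eq_of_lt (p.2.trans_le hNm)]
  symm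
  refine Fintype.sum_of_injective (fun p : Fin N => fun b : Fin m => (p : ℕ).testBit b) ?_ _ _ ?_ ?_
  · intro p q h
    have := congrArg binValue h
    simp only [hv] at this
    exact Fin.ext this
  · intro s hs
    refine if_neg fun h => hs ⟨⟨binValue s, by omega⟩, ?_⟩
    refine binValue_injective m ?_
    exact hv ⟨binValue s, by omega⟩
  · intro p
    rw [hv, if_pos (by omega), trainingVector, dif_pos p.2]

set_option maxHeartbeats 1000000 in
/-- The probability that the flag is set. -/
theorem bexp_flag (hN : 0 < N) (Sp : SamplerSpec nv nh T) (f : ℕ) (I : Instance nv nh N) :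
    bexp (coinProb f : Wire nv nh (Nat.clog 2 N) l K T → ℝ)
      (fun s => if crun I Sp.classicalOps s .flag then 1 else 0) =
      1 / 8 * (1 / 2 ^ Nat.clog 2 N * ∑ p,
        (Sp.resultProb f l K I true (I.x p) + (1 - Sp.resultProb f l K I false (I.x p)))) := by
  rw [bexp_extend Coin.wire Coin.wire_injective]
  swap
  · intro w hw
    have : w.isCoin ≠ true := fun h => hw (Coin.mem_range_wire w h)
    cases w <;> simp [Wire.isCoin] at this <;> rfl
  -- The flag as a function of the coins: the bit `side`, two coins that must both show heads, the
  -- index, and the coins of the trials.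
  have hflag : ∀ t : Coin nv nh (Nat.clog 2 N) l K → Bool,
      crun I Sp.classicalOps (Function.extend Coin.wire t fun _ => false :
        Wire nv nh (Nat.clog 2 N) l K T → Bool) .flag =
      ((t (.inl (.inr (.inl false))) && t (.inl (.inr (.inl true)))) &&
        (decide (binValue (fun k => t (.inl (.inr (.inr k)))) ≤ (N - 1) % 2 ^ Nat.clog 2 N) &&
          xor (firstAccepted fun k => Sp.trial I (t (.inl (.inl ())))
            (trainingVector I.x (binValue fun k => t (.inl (.inr (.inr k)))))
            (fun u b => t (.inr (k, .inl (u, b)))) (fun b => t (.inr (k, .inr b))))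
            (!t (.inl (.inl ()))))) := by
    intro t
    have hex : ∀ c, Function.extend (Coin.wire : Coin nv nh (Nat.clog 2 N) l K →
        Wire nv nh (Nat.clog 2 N) l K T) t (fun _ => false) c.wire = t c :=
      fun c => Coin.wire_injective.extend_apply _ _ _
    rw [Sp.crun_flag I]
    · rw [← hex (.inl (.inl ())), ← hex (.inl (.inr (.inl false))), ← hex (.inl (.inr (.inl true)))]
      have e1 : (fun k => t (.inl (.inr (.inr k)))) = fun k => _ :=
        funext fun k => (hex (.inl (.inr (.inr k)))).symm
      have e2 : ∀ k : Fin K, (fun (u : Unt nv nh) (b : Fin l) => t (.inr (k, .inl (u, b)))) =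
        fun u b => _ := fun k => funext fun u => funext fun b => (hex (.inr (k, .inl (u, b)))).symm
      have e3 : ∀ k : Fin K, (fun (b : Fin l) => t (.inr (k, .inr b))) =
        fun b => _ := fun k => funext fun b => (hex (.inr (k, .inr b))).symm
      simp only [e1, e2, e3]
      rfl
    · intro w hw
      refine Function.extend_apply' _ _ _ ?_
      rintro ⟨c, rfl⟩
      rcases c with (a | a | a) | ⟨k, (⟨u, b⟩ | b)⟩ <;> simp [Coin.wire, Wire.isCoin] at hw
  simp only [hflag]
  refine (bexp_sum _ _).trans ?_
  -- The trials are independent and identically distributed.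
  have hres : ∀ σ x, (bexp (fun j : Fin K × TrialCoin nv nh l =>
      coinProb (T := T) (m := Nat.clog 2 N) f (Coin.wire (.inr j))) fun c =>
      if (firstAccepted fun k => Sp.trial I σ x
            (fun u b => c (k, .inl (u, b))) (fun b => c (k, .inr b))) then 1 else 0) =
      Sp.resultProb f l K I σ x := by
    intro σ x
    have h3 := bexp_curry (fun j : Fin K × TrialCoin nv nh l =>
      coinProb (T := T) (m := Nat.clog 2 N) f (Coin.wire (.inr j))) (fun c =>
      if (firstAccepted fun k => Sp.trial I σ x
            (fun u b => c k (.inl (u, b))) (fun b => c k (.inr b))) then 1 else 0)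
    rw [h3, sum_prod_pushforward (fun (k : Fin K) (c : TrialCoin nv nh l → Bool) =>
      ∏ j, bern (coinProb (T := T) (m := Nat.clog 2 N) f (Coin.wire (.inr (k, j)))) (c j))
      (fun k c => Sp.trial I σ x (fun u b => c (.inl (u, b))) (fun b => c (.inr b)))
      (fun y => if firstAccepted y then 1 else 0)]
    unfold SamplerSpec.resultProb SamplerSpec.trialDist
    have hc : ∀ (k : Fin K) (j : TrialCoin nv nh l),
        coinProb (T := T) (m := Nat.clog 2 N) f (Coin.wire (.inr (k, j))) = trialCoinProb f j := by
      rintro k (⟨u, b⟩ | b) <;> rfl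
    simp only [hc]
  set R : Bool → Config nv → ℝ := fun σ x => Sp.resultProb f l K I σ x with hR
  -- The expectation over the coins of the trials, when the other coins are fixed.
  have hinner : ∀ a : Unit ⊕ Bool ⊕ Fin (Nat.clog 2 N) → Bool,
      (bexp (fun j : Fin K × TrialCoin nv nh l =>
        coinProb (T := T) (m := Nat.clog 2 N) f (Coin.wire (.inr j))) fun c =>
        if ((a (.inr (.inl false)) && a (.inr (.inl true))) &&
        (decide (binValue (fun k => a (.inr (.inr k))) ≤ (N - 1) % 2 ^ Nat.clog 2 N) &&
          xor (firstAccepted fun k => Sp.trial I (a (.inl ()))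
            (trainingVector I.x (binValue fun k => a (.inr (.inr k))))
            (fun u b => c (k, .inl (u, b))) (fun b => c (k, .inr b)))
            (!a (.inl ())))) = true then (1 : ℝ) else 0) =
      if (a (.inr (.inl false)) && a (.inr (.inl true))) then
        (if binValue (fun k => a (.inr (.inr k))) ≤ (N - 1) % 2 ^ Nat.clog 2 N then
          (if a (.inl ()) then R true (trainingVector I.x (binValue fun k => a (.inr (.inr k))))
            else 1 - R false (trainingVector I.x (binValue fun k => a (.inr (.inr k))))) else 0)
        else 0 := by
    intro a
    split_ifs with h1 h2 h3
    · simp only [h1, h2, h3, decide_true, Bool.true_and, Bool.not_true, Bool.xor_false]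
      exact hres _ _
    · rw [Bool.not_eq_true] at h3
      simp only [h1, h2, h3, decide_true, Bool.true_and, Bool.not_false, Bool.xor_true]
      rw [hR]
      simp only
      rw [← hres, ← bexp_one_sub]
      refine bexp_congr fun c => ?_
      cases (firstAccepted fun k => Sp.trial I false
            (trainingVector I.x (binValue fun k => a (.inr (.inr k))))
            (fun u b => c (k, .inl (u, b))) (fun b => c (k, .inr b))) <;> simp
    · simp only [h2, decide_false, Bool.false_and, Bool.and_false]
      exact bexp_const _ 0
    · rw [Bool.not_eq_true] at h1
      simp only [h1, Bool.false_and]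
      exact bexp_const _ 0
  refine (bexp_congr fun a => hinner a).trans ?_
  refine (bexp_sum _ _).trans ?_
  -- The index is uniformly distributed on the integers below `2 ^ Nat.clog 2 N`; only those
  -- below `N` contribute.
  have hidx : ∀ t : Bool, (bexp (fun i : Fin (Nat.clog 2 N) =>
      coinProb (l := l) (K := K) (T := T) (nv := nv) (nh := nh) f (Coin.wire (.inl (.inr (.inr i))))) fun b =>
        if binValue b ≤ (N - 1) % 2 ^ Nat.clog 2 N then
          (if t then R true (trainingVector I.x (binValue b))
            else 1 - R false (trainingVector I.x (binValue b))) else 0) =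
      1 / 2 ^ Nat.clog 2 N * ∑ p, if t then R true (I.x p) else 1 - R false (I.x p) := by
    intro t
    exact bexp_index hN I.x fun x => if t then R true x else 1 - R false x
  have hq : ∀ (F : ℝ), (bexp (fun i : Bool => coinProb (m := Nat.clog 2 N) (l := l) (K := K) (T := T)
      (nv := nv) (nh := nh) f (Coin.wire (.inl (.inr (.inl i))))) fun a =>
      if (a false && a true) then F else 0) = 1 / 4 * F := by
    intro F
    have : ∀ a : Bool → Bool, (if (a false && a true) then F else 0) =
        ∏ i, if a i then (if i then F else 1) else 0 := by
      intro a
      rw [Fintype.prod_bool]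
      cases a false <;> cases a true <;> simp
    unfold bexp
    simp only [this, ← Finset.prod_mul_distrib]
    rw [sum_prod_eq_prod_sum fun (i : Bool) (t : Bool) =>
      bern (coinProb (m := Nat.clog 2 N) (l := l) (K := K) (T := T)
      (nv := nv) (nh := nh) f (Coin.wire (.inl (.inr (.inl i))))) t *
        if t then (if i then F else 1) else 0]
    simp [Coin.wire, coinProb, bern]
    ring
  have hside : ∀ F : Bool → ℝ, (bexp (fun _ : Unit => (1 / 2 : ℝ)) fun a => F (a ())) =
      1 / 2 * (F true + F false) := by
    intro F
    unfold bexp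
    rw [← (Equiv.funUnique Unit Bool).symm.sum_comp]
    simp [bern]
    ring
  have hsplit : ∀ (a : Unit → Bool), (bexp (fun i : Bool => coinProb (m := Nat.clog 2 N) (l := l)
      (K := K) (T := T) (nv := nv) (nh := nh) f (Coin.wire (.inl (.inr (.inl i))))) fun a_1 =>
      bexp (fun i : Fin (Nat.clog 2 N) => coinProb (l := l) (K := K) (T := T) (nv := nv) (nh := nh) f
        (Coin.wire (.inl (.inr (.inr i))))) fun b =>
        if (a_1 false && a_1 true) then
        (if binValue b ≤ (N - 1) % 2 ^ Nat.clog 2 N then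
          (if a () then R true (trainingVector I.x (binValue b))
            else 1 - R false (trainingVector I.x (binValue b))) else 0) else 0) =
      1 / 4 * (1 / 2 ^ Nat.clog 2 N * ∑ p, if a () then R true (I.x p) else 1 - R false (I.x p)) := by
    intro a
    rw [← hidx, ← hq]
    refine bexp_congr fun a_1 => ?_
    by_cases h : (a_1 false && a_1 true) = true
    · simp only [h, if_true]
    · simp only [h]
      exact bexp_const _ 0
  refine (bexp_congr fun a => (bexp_sum _ _).trans (hsplit a)).trans ?_
  have := hside fun t => 1 / 4 * (1 / 2 ^ Nat.clog 2 N * ∑ p, if t then R true (I.x p)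
    else 1 - R false (I.x p))
  refine Eq.trans this ?_
  simp only [Finset.sum_add_distrib]
  simp
  ring

end

/-! ### The energy and the gradient of the objective -/

section

variable {nv nh N : ℕ}

/-- The parameters of a machine, block by block. -/
def coordEquiv : Coord nv nh ≃
    (Fin nv ⊕ Fin nh) ⊕ (Fin nv × Fin nh ⊕ Fin nv × Fin nv ⊕ Fin nh × Fin nh) where
  toFun
    | .b i => .inl (.inl i)
    | .d j => .inl (.inr j)
    | .wvh i j => .inr (.inl (i, j))
    | .wv i i' => .inr (.inr (.inl (i, i')))
    | .wh j j' => .inr (.inr (.inr (j, j')))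
  invFun
    | .inl (.inl i) => .b i
    | .inl (.inr j) => .d j
    | .inr (.inl (i, j)) => .wvh i j
    | .inr (.inr (.inl (i, i'))) => .wv i i'
    | .inr (.inr (.inr (j, j'))) => .wh j j'
  left_inv c := by cases c <;> rfl
  right_inv c := by rcases c with (_ | _) | _ | _ | _ <;> rfl

instance : Fintype (Coord nv nh) := Fintype.ofEquiv _ coordEquiv.symm

theorem sum_coord (F : Coord nv nh → ℝ) : ∑ c, F c =
    (∑ i, F (.b i)) + (∑ j, F (.d j)) + (∑ i, ∑ j, F (.wvh i j)) + (∑ i, ∑ i', F (.wv i i')) +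
      ∑ j, ∑ j', F (.wh j j') := by
  rw [← coordEquiv.symm.sum_comp]
  simp only [Fintype.sum_sum_type, Fintype.sum_prod_type]
  simp only [coordEquiv, Equiv.coe_fn_symm_mk]
  ring

/-- The energy as a function of all units. -/
def energyAt (θ : Params nv nh) (s : Unt nv nh → Bool) : ℝ :=
  energy θ (fun i => s (.inl i)) fun j => s (.inr j)

theorem bit_and (a b : Bool) : bit (a && b) = bit a * bit b := by
  cases a <;> cases b <;> simp [bit]

theorem energyAt_eq_sum (θ : Params nv nh) (s : Unt nv nh → Bool) :
    energyAt θ s = -∑ c, θ c * bit (coordVal c s) := by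
  rw [sum_coord]
  simp only [coordVal, bit_and, energyAt, energy]
  simp only [← mul_assoc, mul_comm (θ (.b _)), mul_comm (θ (.d _))]
  ring

theorem energyAt_update (θ : Params nv nh) (c : Coord nv nh) (t : ℝ) (s : Unt nv nh → Bool) :
    energyAt (Function.update θ c t) s = energyAt θ s - (t - θ c) * bit (coordVal c s) := by
  rw [energyAt_eq_sum, energyAt_eq_sum]
  have : ∀ c', Function.update θ c t c' * bit (coordVal c' s) =
      θ c' * bit (coordVal c' s) + if c' = c then (t - θ c) * bit (coordVal c s) else 0 := by
    intro c'
    by_cases h : c' = c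
    · subst h; simp; ring
    · simp [h]
  simp only [this, Finset.sum_add_distrib, Finset.sum_ite_eq', Finset.mem_univ, if_true]
  ring

/-- Whether a parameter is a weight. -/
def Coord.isWeight : Coord nv nh → Bool
  | .b _ => false
  | .d _ => false
  | _ => true

theorem weightNormSq_eq_sum (θ : Params nv nh) :
    weightNormSq θ = ∑ c, if c.isWeight then θ c ^ 2 else 0 := by
  rw [sum_coord]
  simp [Coord.isWeight, weightNormSq]

theorem hasDerivAt_weightNormSq (θ : Params nv nh) (c : Coord nv nh) :
    HasDerivAt (fun t => weightNormSq (Function.update θ c t))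
      (if c.isWeight then 2 * θ c else 0) (θ c) := by
  have h : ∀ t, weightNormSq (Function.update θ c t) =
      weightNormSq θ + if c.isWeight then t ^ 2 - θ c ^ 2 else 0 := by
    intro t
    rw [weightNormSq_eq_sum, weightNormSq_eq_sum]
    have : ∀ c' : Coord nv nh, (if c'.isWeight then Function.update θ c t c' ^ 2 else 0) =
        (if c'.isWeight then θ c' ^ 2 else 0) +
          if c' = c then (if c.isWeight then t ^ 2 - θ c ^ 2 else 0) else 0 := by
      intro c'
      by_cases h : c' = c
      · subst h; by_cases h' : c'.isWeight <;> simp [h']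
      · simp [h]
    simp only [this, Finset.sum_add_distrib, Finset.sum_ite_eq', Finset.mem_univ, if_true]
  simp only [h]
  by_cases hc : c.isWeight
  · simp only [hc, if_true]
    have := ((hasDerivAt_pow 2 (θ c)).sub_const (θ c ^ 2)).const_add (weightNormSq θ)
    simpa using this
  · simp only [hc]
    simpa using hasDerivAt_const (θ c) (weightNormSq θ)

/-- The logarithmic derivative of a partial partition function is the expectation of the monomial
that the parameter multiplies. -/
theorem hasDerivAt_log_sum_exp {α : Type} [Fintype α] [Nonempty α] (θ : Params nv nh)
    (c : Coord nv nh) (s : α → Unt nv nh → Bool) :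
    HasDerivAt (fun t => Real.log (∑ a, Real.exp (-energyAt (Function.update θ c t) (s a))))
      ((∑ a, Real.exp (-energyAt θ (s a)) * bit (coordVal c (s a))) /
        ∑ a, Real.exp (-energyAt θ (s a))) (θ c) := by
  have hpos : 0 < ∑ a, Real.exp (-energyAt θ (s a)) :=
    Finset.sum_pos (fun _ _ => Real.exp_pos _) Finset.univ_nonempty
  have h1 : ∀ a, HasDerivAt (fun t => Real.exp (-energyAt (Function.update θ c t) (s a)))
      (Real.exp (-energyAt θ (s a)) * bit (coordVal c (s a))) (θ c) := by
    intro a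
    have h2 : HasDerivAt (fun t => -energyAt (Function.update θ c t) (s a))
        (bit (coordVal c (s a))) (θ c) := by
      simp only [energyAt_update]
      have := ((((hasDerivAt_id (θ c)).sub_const (θ c)).mul_const
        (bit (coordVal c (s a)))).sub_const (energyAt θ (s a)))
      simpa [sub_eq_add_neg, add_comm] using this
    have := h2.exp
    simpa using this
  have h3 := HasDerivAt.fun_sum fun a (_ : a ∈ Finset.univ) => h1 a
  have := h3.log (by simpa using hpos.ne')
  simpa using this

/-- The expectation of a monomial in the clamped machine. -/
def dataMean (θ : Params nv nh) (c : Coord nv nh) (x : Config nv) : ℝ :=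
  (∑ h : Config nh, Real.exp (-energy θ x h) * bit (coordVal c (Sum.elim x h))) /
    clampedPartition θ x

/-- The expectation of a monomial. -/
def modelMean (θ : Params nv nh) (c : Coord nv nh) : ℝ :=
  (∑ s : Unt nv nh → Bool, Real.exp (-energyAt θ s) * bit (coordVal c s)) / partition θ

theorem partition_eq_sum (θ : Params nv nh) :
    partition θ = ∑ s : Unt nv nh → Bool, Real.exp (-energyAt θ s) := by
  rw [← (Equiv.sumArrowEquivProdArrow (Fin nv) (Fin nh) Bool).symm.sum_comp,
    Fintype.sum_prod_type]
  rfl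

theorem partition_pos (θ : Params nv nh) : 0 < partition θ := by
  rw [partition_eq_sum]
  exact Finset.sum_pos (fun _ _ => Real.exp_pos _) Finset.univ_nonempty

theorem clampedPartition_pos (θ : Params nv nh) (x : Config nv) : 0 < clampedPartition θ x :=
  Finset.sum_pos (fun _ _ => Real.exp_pos _) Finset.univ_nonempty

/-- The gradient of the objective: data expectation minus model expectation, minus the derivative of
the regularization. -/
theorem hasDerivAt_objective (lam : ℝ) (x : Fin N → Config nv) (θ : Params nv nh)
    (c : Coord nv nh) :
    HasDerivAt (fun t => objective lam x (Function.update θ c t))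
      (1 / N * ∑ p, (dataMean θ c (x p) - modelMean θ c) - if c.isWeight then lam * θ c else 0)
      (θ c) := by
  have h1 : ∀ p, HasDerivAt
      (fun t => Real.log (∑ h : Config nh, gibbs (Function.update θ c t) (x p) h))
      (dataMean θ c (x p) - modelMean θ c) (θ c) := by
    intro p
    have e : ∀ t, Real.log (∑ h : Config nh, gibbs (Function.update θ c t) (x p) h) =
        Real.log (∑ h : Config nh, Real.exp (-energyAt (Function.update θ c t)
          (Sum.elim (x p) h))) -
        Real.log (∑ s : Unt nv nh → Bool, Real.exp (-energyAt (Function.update θ c t) s)) := by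
      intro t
      rw [← partition_eq_sum, ← Real.log_div]
      · rw [Finset.sum_div]
        rfl
      · exact (clampedPartition_pos (Function.update θ c t) (x p)).ne'
      · exact (partition_pos _).ne'
    simp only [e]
    have h2 := hasDerivAt_log_sum_exp θ c fun h : Config nh => Sum.elim (x p) h
    have h3 := hasDerivAt_log_sum_exp θ c fun s : Unt nv nh → Bool => s
    rw [← partition_eq_sum] at h3
    exact h2.sub h3
  have h4 := (HasDerivAt.fun_sum fun p (_ : p ∈ Finset.univ) => h1 p).const_mul (1 / (N : ℝ))
  have h5 := (hasDerivAt_weightNormSq θ c).const_mul (lam / 2)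
  have e : (lam / 2 * if c.isWeight = true then 2 * θ c else 0) =
      if c.isWeight then lam * θ c else 0 := by split_ifs <;> ring
  rw [e] at h5
  exact h4.sub h5

/-- The ordered pairs of adjacent units. -/
abbrev AdjPair (G : SimpleGraph (Unt nv nh)) : Type := {p : Unt nv nh × Unt nv nh // G.Adj p.1 p.2}

instance (G : SimpleGraph (Unt nv nh)) : Fintype (AdjPair G) := Fintype.ofFinite _

/-- The contribution of an ordered pair of units to the energy. -/
def pairEnergy (θ : Params nv nh) (a b : Unt nv nh) : ℝ :=
  match pairCoord a b with
  | some c => -θ c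
  | none => 0

/-- The energy as a sum over units and ordered pairs of adjacent units. -/
theorem energyAt_eq_graph (G : SimpleGraph (Unt nv nh)) (θ : Params nv nh) (hθ : WeightsOn G θ)
    (s : Unt nv nh → Bool) :
    energyAt θ s = (∑ u, if s u then -θ (biasCoord u) else 0) +
      ∑ p : AdjPair G,
        if s p.1.1 && s p.1.2 then pairEnergy θ p.1.1 p.1.2 else 0 := by
  classical
  have hsub : (∑ p : AdjPair G,
        if s p.1.1 && s p.1.2 then pairEnergy θ p.1.1 p.1.2 else 0) =
      ∑ p : Unt nv nh × Unt nv nh, if s p.1 && s p.2 then pairEnergy θ p.1 p.2 else 0 := by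
    refine Fintype.sum_of_injective Subtype.val Subtype.val_injective _ _ ?_ fun p => rfl
    rintro ⟨a, b⟩ hp
    have hadj : ¬ G.Adj a b := fun h => hp ⟨⟨(a, b), h⟩, rfl⟩
    have : pairEnergy θ a b = 0 := by
      rcases a with a | a <;> rcases b with b | b <;> simp only [pairEnergy, pairCoord]
      · rw [hθ.2.1 _ _ hadj, neg_zero]
      · rw [hθ.1 _ _ hadj, neg_zero]
      · rw [hθ.2.2 _ _ hadj, neg_zero]
    simp [this]
  rw [hsub, energyAt_eq_sum, sum_coord]
  simp only [Fintype.sum_prod_type, Fintype.sum_sum_type, pairEnergy, pairCoord, biasCoord,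
    coordVal]
  have hb : ∀ (b : Bool) (z : ℝ), (if b then -z else 0) = -(z * bit b) := by
    intro b z; cases b <;> simp [bit]
  simp only [hb, ite_self, Finset.sum_neg_distrib, Finset.sum_const_zero, Finset.sum_add_distrib]
  ring

theorem abs_energyAt_le (G : SimpleGraph (Unt nv nh)) (θ : Params nv nh) (hθ : WeightsOn G θ)
    {W : ℝ} (hW0 : 0 ≤ W) (hW : ∀ c, |θ c| ≤ W) (s : Unt nv nh → Bool) :
    |energyAt θ s| ≤ (nv + nh + Fintype.card (AdjPair G) : ℝ) * W := by
  rw [energyAt_eq_graph G θ hθ]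
  refine (abs_add_le _ _).trans ?_
  rw [add_mul]
  refine add_le_add ?_ ?_
  · refine (Finset.abs_sum_le_sum_abs _ _).trans ?_
    refine (Finset.sum_le_sum (g := fun _ => W) fun u _ => ?_).trans (by simp)
    split_ifs
    · rw [abs_neg]; exact hW _
    · simpa using hW0
  · refine (Finset.abs_sum_le_sum_abs _ _).trans ?_
    refine (Finset.sum_le_sum (g := fun _ => W) fun u _ => ?_).trans (by simp)
    split_ifs
    · unfold pairEnergy
      split
      · rw [abs_neg]; exact hW _
      · simpa using hW0
    · simpa using hW0

end

/-! ### Elementary inequalities -/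

/-- The variational lower bound on a partition function (Gibbs' inequality). -/
theorem exp_sum_mul_log_div_le {α : Type} [Fintype α] (Q w : α → ℝ) (hQ0 : ∀ a, 0 ≤ Q a)
    (hQ1 : ∑ a, Q a = 1) (hw : ∀ a, 0 < w a) :
    Real.exp (∑ a, Q a * Real.log (w a / Q a)) ≤ ∑ a, w a := by
  have hne : Nonempty α := by
    by_contra h
    rw [not_nonempty_iff] at h
    simp at hQ1
  set S := ∑ a, w a with hS
  have hSpos : 0 < S := Finset.sum_pos (fun a _ => hw a) Finset.univ_nonempty
  rw [← Real.le_log_iff_exp_le hSpos]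
  have h : ∀ a, Q a * Real.log (w a / Q a) ≤ Q a * Real.log S + (w a / S - Q a) := by
    intro a
    rcases (hQ0 a).eq_or_lt with h0 | h0
    · rw [← h0]; simp; exact div_nonneg (hw a).le hSpos.le
    · have e : Real.log (w a / Q a) = Real.log S + Real.log (w a / Q a / S) := by
        rw [← Real.log_mul hSpos.ne' (by have := hw a; positivity)]
        congr 1
        field_simp
      have := Real.log_le_sub_one_of_pos (show 0 < w a / Q a / S by have := hw a; positivity)
      rw [e, mul_add]
      refine add_le_add le_rfl ?_
      calc Q a * Real.log (w a / Q a / S) ≤ Q a * (w a / Q a / S - 1) :=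
            mul_le_mul_of_nonneg_left this h0.le
        _ = w a / S - Q a := by field_simp
  refine (Finset.sum_le_sum fun a _ => h a).trans ?_
  rw [Finset.sum_add_distrib, Finset.sum_sub_distrib, ← Finset.sum_mul, ← Finset.sum_div, hQ1, ← hS]
  rw [div_self hSpos.ne']
  linarith

/-- Expectations with respect to distributions whose densities agree up to a factor between
`exp (-τ)` and `1` differ by at most `τ`. -/
theorem abs_sum_div_sub_sum_div_le {α : Type} [Fintype α] (g w F : α → ℝ) {c τ : ℝ} (hc : 0 < c)
    (hg : ∀ a, 0 ≤ g a) (hG : 0 < ∑ a, g a) (hF0 : ∀ a, 0 ≤ F a) (hF1 : ∀ a, F a ≤ 1)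
    (h1 : ∀ a, c * Real.exp (-τ) * g a ≤ w a) (h2 : ∀ a, w a ≤ c * g a) :
    |(∑ a, w a * F a) / ∑ a, w a - (∑ a, g a * F a) / ∑ a, g a| ≤ τ := by
  have hcτ : 0 < c * Real.exp (-τ) := mul_pos hc (Real.exp_pos _)
  have hw0 : ∀ a, 0 ≤ w a := fun a => (mul_nonneg hcτ.le (hg a)).trans (h1 a)
  have hW : 0 < ∑ a, w a := by
    refine lt_of_lt_of_le (mul_pos hcτ hG) ?_
    rw [Finset.mul_sum]
    exact Finset.sum_le_sum fun a _ => h1 a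
  have hWG : ∑ a, w a ≤ c * ∑ a, g a := by
    rw [Finset.mul_sum]
    exact Finset.sum_le_sum fun a _ => h2 a
  -- One-sided bound, applied below to `F` and to `1 - F`.
  have key : ∀ F : α → ℝ, (∀ a, 0 ≤ F a) → (∀ a, F a ≤ 1) →
      (∑ a, g a * F a) / ∑ a, g a - τ ≤ (∑ a, w a * F a) / ∑ a, w a := by
    intro F hF0 hF1
    have hH0 : 0 ≤ ∑ a, g a * F a := Finset.sum_nonneg fun a _ => mul_nonneg (hg a) (hF0 a)
    have hH1 : (∑ a, g a * F a) / ∑ a, g a ≤ 1 := by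
      rw [div_le_one hG]
      exact Finset.sum_le_sum fun a _ => mul_le_of_le_one_right (hg a) (hF1 a)
    have hH0' : 0 ≤ (∑ a, g a * F a) / ∑ a, g a := div_nonneg hH0 hG.le
    have h3 : Real.exp (-τ) * ((∑ a, g a * F a) / ∑ a, g a) ≤ (∑ a, w a * F a) / ∑ a, w a := by
      calc Real.exp (-τ) * ((∑ a, g a * F a) / ∑ a, g a)
          = (c * Real.exp (-τ) * ∑ a, g a * F a) / (c * ∑ a, g a) := by field_simp
        _ ≤ (∑ a, w a * F a) / (c * ∑ a, g a) := by
            refine div_le_div_of_nonneg_right ?_ (mul_pos hc hG).le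
            rw [Finset.mul_sum]
            refine Finset.sum_le_sum fun a _ => ?_
            rw [← mul_assoc]
            exact mul_le_mul_of_nonneg_right (h1 a) (hF0 a)
        _ ≤ (∑ a, w a * F a) / ∑ a, w a :=
            div_le_div_of_nonneg_left
              (Finset.sum_nonneg fun a _ => mul_nonneg (hw0 a) (hF0 a)) hW hWG
    have h4 : 1 - τ ≤ Real.exp (-τ) := by have := Real.add_one_le_exp (-τ); linarith
    have hτ : Real.exp (-τ) ≤ 1 := by
      have : c * Real.exp (-τ) * ∑ a, g a ≤ c * ∑ a, g a := by
        refine le_trans ?_ hWG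
        rw [Finset.mul_sum]
        exact Finset.sum_le_sum fun a _ => h1 a
      have h5 : c * Real.exp (-τ) ≤ c := le_of_mul_le_mul_right this hG
      nlinarith
    have hτ0 : 0 ≤ τ := by
      rw [Real.exp_le_one_iff] at hτ; linarith
    nlinarith
  have k1 := key F hF0 hF1
  have k2 := key (fun a => 1 - F a) (fun a => by linarith [hF1 a]) (fun a => by linarith [hF0 a])
  have e : ∀ v : α → ℝ, (∑ a, v a ≠ 0) →
      (∑ a, v a * (1 - F a)) / ∑ a, v a = 1 - (∑ a, v a * F a) / ∑ a, v a := by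
    intro v hv
    simp only [mul_sub, mul_one, Finset.sum_sub_distrib, sub_div, div_self hv]
  rw [e g hG.ne', e w hW.ne'] at k2
  rw [abs_le]
  constructor <;> linarith

/-! ### The encodings of the sampling circuit -/

/-- The least multiple of `2 ^ (-f)` that is at least `z`, in units of `2 ^ (-f)` and modulo
`2 ^ l`. -/
def residue (f l : ℕ) (z : ℝ) : ℕ := (⌈2 ^ f * z⌉ % 2 ^ l).toNat

theorem residue_cast (f l : ℕ) (z : ℝ) : ((residue f l z : ℕ) : ℤ) = ⌈2 ^ f * z⌉ % 2 ^ l :=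
  Int.toNat_of_nonneg (Int.emod_nonneg _ (by positivity))

/-- `-log` of the probability of the less likely value of a bit, rounded up to a multiple of
`2 ^ (-f)`. -/
def mfDigits (f : ℕ) (ν : ℝ) : ℕ := ⌈2 ^ f * -Real.log (min ν (1 - ν))⌉₊

/-- The probability obtained by this rounding. -/
def mfRound (f : ℕ) (ν : ℝ) : ℝ :=
  if 1 / 2 < ν then 1 - Real.exp (-(mfDigits f ν / 2 ^ f)) else Real.exp (-(mfDigits f ν / 2 ^ f))

/-- Rounding decreases no probability by more than a factor `exp (-2 ^ (-f))`. -/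
theorem exp_mul_bern_le_bern_mfRound (f : ℕ) {ν : ℝ} (h0 : 0 < ν) (h1 : ν < 1) (b : Bool) :
    Real.exp (-(1 / 2 ^ f)) * bern ν b ≤ bern (mfRound f ν) b := by
  have hm : 0 < min ν (1 - ν) := lt_min h0 (by linarith)
  have hm1 : min ν (1 - ν) ≤ 1 := (min_le_left _ _).trans h1.le
  have hlog : 0 ≤ -Real.log (min ν (1 - ν)) := by
    have := Real.log_nonpos hm.le hm1; linarith
  have hf : (0 : ℝ) < 2 ^ f := by positivity
  have hY1 : 2 ^ f * -Real.log (min ν (1 - ν)) ≤ mfDigits f ν := Nat.le_ceil _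
  have hY2 : (mfDigits f ν : ℝ) < 2 ^ f * -Real.log (min ν (1 - ν)) + 1 :=
    Nat.ceil_lt_add_one (by positivity)
  have hE1 : Real.exp (-(mfDigits f ν / 2 ^ f)) ≤ min ν (1 - ν) := by
    rw [← Real.le_log_iff_exp_le hm, neg_le, le_div_iff₀ hf]
    linarith
  have hE2 : Real.exp (-(1 / 2 ^ f)) * min ν (1 - ν) ≤ Real.exp (-(mfDigits f ν / 2 ^ f)) := by
    nth_rewrite 1 [← Real.exp_log hm]
    rw [← Real.exp_add, Real.exp_le_exp]
    have : (mfDigits f ν : ℝ) / 2 ^ f ≤ -Real.log (min ν (1 - ν)) + 1 / 2 ^ f := by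
      rw [div_le_iff₀ hf, add_mul, div_mul_cancel₀ _ hf.ne']
      linarith
    linarith
  have hexp : Real.exp (-(1 / 2 ^ f)) ≤ 1 := by
    rw [Real.exp_le_one_iff]; simp
  have hle : ∀ z : ℝ, 0 ≤ z → Real.exp (-(1 / 2 ^ f)) * z ≤ z :=
    fun z hz => mul_le_of_le_one_left hz hexp
  unfold mfRound
  split_ifs with h
  · have hmin : min ν (1 - ν) = 1 - ν := min_eq_right (by linarith)
    rw [hmin] at hE1 hE2
    cases b
    · simp only [bern, Bool.false_eq_true, if_false, sub_sub_cancel]; exact hE2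
    · simp only [bern, if_true]; have := hle ν h0.le; linarith
  · have hmin : min ν (1 - ν) = ν := min_eq_left (by linarith)
    rw [hmin] at hE1 hE2
    cases b
    · simp only [bern, Bool.false_eq_true, if_false]
      have := hle (1 - ν) (by linarith); linarith
    · simp only [bern, if_true]; exact hE2

theorem mfDigits_lt (f : ℕ) {ν B : ℝ} (h : ∀ b, Real.exp (-B) ≤ bern ν b) (hB : 0 ≤ B) :
    (mfDigits f ν : ℝ) < 2 ^ f * B + 1 := by
  have ht := h true
  have hf := h false
  simp only [bern, if_true, Bool.false_eq_true, if_false] at ht hf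
  have hm : Real.exp (-B) ≤ min ν (1 - ν) := le_min ht hf
  have hlog : -Real.log (min ν (1 - ν)) ≤ B := by
    have := (Real.le_log_iff_exp_le ((Real.exp_pos _).trans_le hm)).2 hm
    linarith
  have : (mfDigits f ν : ℝ) ≤ ⌈2 ^ f * B⌉₊ :=
    Nat.cast_le.2 (Nat.ceil_mono (mul_le_mul_of_nonneg_left hlog (by positivity)))
  exact this.trans_lt (Nat.ceil_lt_add_one (by positivity))

section

variable {nv nh N : ℕ}

/-- The encodings with `f` binary places, for a bound `κ` on the density ratio. -/
def samplerSpec {T : ℕ} (tm : Fin T → ExpTerm nv nh) (c : Coord nv nh) (f l : ℕ) (κ : ℝ) :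
    SamplerSpec nv nh T where
  tm := tm
  c := c
  encU ν a :=
    if a = 0 then mfDigits f ν
    else if a = 1 then (if 1 / 2 < ν then 1 else 0)
    else if a = 2 then residue f l (Real.log (1 - mfRound f ν))
    else residue f l (Real.log (mfRound f ν) - Real.log (1 - mfRound f ν))
  encZ z := residue f l (Real.log z + Real.log κ + (nv + nh) / 2 ^ f)
  encP z := residue f l (-z)

/-- Whether a unit is not clamped. -/
def isFree (σ : Bool) (u : Unt nv nh) : Bool := u.isRight || !σ

/-- The mean-field parameters of the clamped or unclamped machine; `0` for clamped units. -/
def Instance.mfParam (I : Instance nv nh N) (σ : Bool) (x : Config nv) : Unt nv nh → ℝ :=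
  match σ with
  | false => Sum.elim I.μ I.ν
  | true => Sum.elim 0 (I.νx x)

/-- The variational partition function of the clamped or unclamped machine. -/
def Instance.mfZ (I : Instance nv nh N) (σ : Bool) (x : Config nv) : ℝ :=
  match σ with
  | false => zQ I.θ I.μ I.ν
  | true => clampedZQ I.θ x (I.νx x)

/-- The configurations of the clamped or unclamped machine. -/
def Compatible (σ : Bool) (x : Config nv) (s : Unt nv nh → Bool) : Prop :=
  σ = true → ∀ i, s (.inl i) = x i

/-- The real number that a term of the exponent stands for. -/
def ExpTerm.value (I : Instance nv nh N) (σ : Bool) (x : Config nv) (f : ℕ) (κ : ℝ) :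
    ExpTerm nv nh → ℝ
  | .logZ => Real.log (I.mfZ σ x) + Real.log κ + (nv + nh) / 2 ^ f
  | .base u => if isFree σ u then Real.log (1 - mfRound f (I.mfParam σ x u)) else 0
  | .slope u => if isFree σ u then Real.log (mfRound f (I.mfParam σ x u)) -
      Real.log (1 - mfRound f (I.mfParam σ x u)) else 0
  | .bias u => -I.θ (biasCoord u)
  | .pair a b => pairEnergy I.θ a b

theorem slotBit_of_isFree {T : ℕ} (Sp : SamplerSpec nv nh T) (I : Instance nv nh N) {σ : Bool}
    (x : Config nv) {u : Unt nv nh} (hu : isFree σ u = true) (a : Fin 4) (b : ℕ) :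
    Sp.slotBit I σ x (some (u, a)) b = (Sp.encU (I.mfParam σ x u) a).testBit b := by
  rcases u with u | u <;> cases σ <;> first | rfl | simp [isFree] at hu

theorem slotBit_of_not_isFree {T : ℕ} (Sp : SamplerSpec nv nh T) (I : Instance nv nh N) {σ : Bool}
    (x : Config nv) {u : Unt nv nh} (hu : isFree σ u = false) (a : Fin 4) (b : ℕ) :
    ∃ i, u = .inl i ∧ σ = true ∧ Sp.slotBit I σ x (some (u, a)) b = (decide (a = 1) && x i) := by
  rcases u with u | u <;> cases σ <;> simp [isFree] at hu
  exact ⟨u, rfl, rfl, rfl⟩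

variable {T : ℕ} (tm : Fin T → ExpTerm nv nh) (c : Coord nv nh) (f l : ℕ) (κ : ℝ)
  (I : Instance nv nh N) (σ : Bool) (x : Config nv)

theorem unitProb_of_isFree {u : Unt nv nh} (hu : isFree σ u = true)
    (hY : mfDigits f (I.mfParam σ x u) < 2 ^ l) :
    (samplerSpec tm c f l κ).unitProb f l I σ x u = mfRound f (I.mfParam σ x u) := by
  have hu' : (u.isRight || !σ) = true := hu
  unfold SamplerSpec.unitProb mfRound
  simp only [slotBit_of_isFree _ I x hu, binValue_testBit, hu', if_true]
  have e0 : (samplerSpec tm c f l κ).encU (I.mfParam σ x u) 0 = mfDigits f (I.mfParam σ x u) := rfl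
  have e1 : (samplerSpec tm c f l κ).encU (I.mfParam σ x u) 1 =
    if 1 / 2 < I.mfParam σ x u then 1 else 0 := rfl
  rw [e0, e1, Nat.mod_eq_of_lt hY]
  split_ifs <;> simp_all

theorem unitProb_of_not_isFree {i : Fin nv} (hσ : σ = true) :
    (samplerSpec tm c f l κ).unitProb f l I σ x (.inl i) = if x i then 1 else 0 := by
  subst hσ
  unfold SamplerSpec.unitProb
  simp [SamplerSpec.slotBit]

theorem termBit_value (t : ExpTerm nv nh) :
    ((binValue (fun b : Fin l => (samplerSpec tm c f l κ).termBit I σ x t b) : ℕ) : ℤ) % 2 ^ l =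
      ⌈2 ^ f * t.value I σ x f κ⌉ % 2 ^ l := by
  have key : ∀ z : ℝ, ((binValue (fun b : Fin l => (residue f l z).testBit b) : ℕ) : ℤ) % 2 ^ l =
      ⌈2 ^ f * z⌉ % 2 ^ l := by
    intro z
    rw [binValue_testBit]
    push_cast
    rw [residue_cast]
    simp
  have hzero : ((binValue (fun _ : Fin l => false) : ℕ) : ℤ) % 2 ^ l =
      ⌈(2 : ℝ) ^ f * 0⌉ % 2 ^ l := by
    simp [binValue]
  cases t with
  | logZ =>
    have : ∀ b, (samplerSpec tm c f l κ).termBit I σ x .logZ b =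
        (residue f l (Real.log (I.mfZ σ x) + Real.log κ + (nv + nh) / 2 ^ f)).testBit b := by
      intro b; cases σ <;> rfl
    simp only [this]
    exact key _
  | base u =>
    simp only [SamplerSpec.termBit, ExpTerm.value]
    rcases Bool.eq_false_or_eq_true (isFree σ u) with hu | hu
    · simp only [slotBit_of_isFree _ I x hu, hu, if_true]
      exact key _
    · have : ∀ b, (samplerSpec tm c f l κ).slotBit I σ x (some (u, 2)) b = false := by
        intro b
        obtain ⟨i, -, -, h⟩ := slotBit_of_not_isFree (samplerSpec tm c f l κ) I x hu 2 b
        rw [h]; simp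
      simp only [this, hu, Bool.false_eq_true, if_false]
      exact hzero
  | slope u =>
    simp only [SamplerSpec.termBit, ExpTerm.value]
    rcases Bool.eq_false_or_eq_true (isFree σ u) with hu | hu
    · simp only [slotBit_of_isFree _ I x hu, hu, if_true]
      exact key _
    · have : ∀ b, (samplerSpec tm c f l κ).slotBit I σ x (some (u, 3)) b = false := by
        intro b
        obtain ⟨i, -, -, h⟩ := slotBit_of_not_isFree (samplerSpec tm c f l κ) I x hu 3 b
        rw [h]; simp
      simp only [this, hu, Bool.false_eq_true, if_false]
      exact hzero
  | bias u => exact key _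
  | pair a b =>
    simp only [SamplerSpec.termBit, ExpTerm.value, pairEnergy]
    cases hp : pairCoord a b with
    | none => exact hzero
    | some c' => exact key _

/-- The exponent, before rounding. -/
def exponent (s : Unt nv nh → Bool) : ℝ :=
  ∑ t, if (tm t).sel s then (tm t).value I σ x f κ else 0

/-- If the exponent is in the range of the fixed-point arithmetic, the computed exponent exceeds it
by at most one unit in the last place for each term. -/
theorem total_bounds (s : Unt nv nh → Bool) (h0 : 0 ≤ exponent tm f κ I σ x s)
    (h1 : 2 ^ f * exponent tm f κ I σ x s + T < 2 ^ l) :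
    2 ^ f * exponent tm f κ I σ x s ≤
      ((samplerSpec tm c f l κ).total l I σ x s % 2 ^ l : ℕ) ∧
    (((samplerSpec tm c f l κ).total l I σ x s % 2 ^ l : ℕ) : ℝ) ≤
      2 ^ f * exponent tm f κ I σ x s + T := by
  set X : ℤ := ∑ t, if (tm t).sel s then ⌈2 ^ f * (tm t).value I σ x f κ⌉ else 0 with hX
  have hmod : (((samplerSpec tm c f l κ).total l I σ x s % 2 ^ l : ℕ) : ℤ) = X % 2 ^ l := by
    unfold SamplerSpec.total
    push_cast
    rw [hX]
    rw [Finset.sum_int_mod, Finset.sum_int_mod Finset.univ (2 ^ l) fun t =>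
      if (tm t).sel s then ⌈2 ^ f * (tm t).value I σ x f κ⌉ else 0]
    refine congrArg (· % (2 : ℤ) ^ l) (Finset.sum_congr rfl fun t _ => ?_)
    have e : (samplerSpec tm c f l κ).tm = tm := rfl
    rw [e]
    split_ifs with h
    · exact termBit_value tm c f l κ I σ x (tm t)
    · rfl
  have hlow : 2 ^ f * exponent tm f κ I σ x s ≤ X := by
    rw [hX, exponent, Finset.mul_sum]
    push_cast
    refine Finset.sum_le_sum fun t _ => ?_
    split_ifs
    · exact Int.le_ceil _
    · simp
  have hupp : (X : ℝ) ≤ 2 ^ f * exponent tm f κ I σ x s + T := by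
    have hT : (T : ℝ) = ∑ _t : Fin T, (1 : ℝ) := by simp
    rw [hX, exponent, Finset.mul_sum, hT, ← Finset.sum_add_distrib]
    push_cast
    refine Finset.sum_le_sum fun t _ => ?_
    split_ifs
    · exact (Int.ceil_lt_add_one _).le
    · simp
  have hX0 : 0 ≤ X := by
    have : (0 : ℝ) ≤ X := le_trans (by positivity) hlow
    exact_mod_cast this
  have hX1 : X < 2 ^ l := by
    have : (X : ℝ) < 2 ^ l := hupp.trans_lt h1
    exact_mod_cast this
  rw [Int.emod_eq_of_lt hX0 hX1] at hmod
  have hcast : (((samplerSpec tm c f l κ).total l I σ x s % 2 ^ l : ℕ) : ℝ) = X := by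
    rw [← hmod, Int.cast_natCast]
  rw [hcast]
  exact ⟨hlow, hupp⟩

end

/-! ### The accuracy of rejection sampling -/

section

variable {nv nh N : ℕ}

/-- An index set for the terms of the exponent. -/
abbrev TermIdx (G : SimpleGraph (Unt nv nh)) : Type :=
  Unit ⊕ Unt nv nh ⊕ Unt nv nh ⊕ Unt nv nh ⊕ AdjPair G

/-- The term with a given index. -/
def TermIdx.term {G : SimpleGraph (Unt nv nh)} : TermIdx G → ExpTerm nv nh
  | .inl _ => .logZ
  | .inr (.inl u) => .base u
  | .inr (.inr (.inl u)) => .slope u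
  | .inr (.inr (.inr (.inl u))) => .bias u
  | .inr (.inr (.inr (.inr p))) => .pair p.1.1 p.1.2

/-- The number of terms of the exponent. -/
abbrev numTerms (G : SimpleGraph (Unt nv nh)) : ℕ := Fintype.card (TermIdx G)

/-- An enumeration of the terms of the exponent. -/
def termEnum (G : SimpleGraph (Unt nv nh)) (t : Fin (numTerms G)) : ExpTerm nv nh :=
  TermIdx.term ((Fintype.equivFin (TermIdx G)).symm t)

theorem numTerms_eq (G : SimpleGraph (Unt nv nh)) :
    numTerms G = 1 + 3 * (nv + nh) + Fintype.card (AdjPair G) := by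
  simp only [numTerms, TermIdx, Fintype.card_sum, Fintype.card_unit, Fintype.card_fin]
  ring

variable (G : SimpleGraph (Unt nv nh)) (c : Coord nv nh) (f l K : ℕ) (κ : ℝ)
  (I : Instance nv nh N) (σ : Bool) (x : Config nv)

/-- The exponent is the logarithm of the ratio of the proposal distribution to the (rescaled)
Boltzmann factor. -/
theorem exponent_eq (hθ : WeightsOn G I.θ) (s : Unt nv nh → Bool) :
    exponent (termEnum G) f κ I σ x s =
      Real.log (I.mfZ σ x) + Real.log κ + (nv + nh) / 2 ^ f +
        (∑ u, if isFree σ u then Real.log (bern (mfRound f (I.mfParam σ x u)) (s u)) else 0) +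
        energyAt I.θ s := by
  unfold exponent termEnum
  rw [(Fintype.equivFin (TermIdx G)).symm.sum_comp fun t =>
    if t.term.sel s then t.term.value I σ x f κ else 0]
  rw [energyAt_eq_graph G I.θ hθ, Fintype.sum_sum_type, Fintype.sum_sum_type (α₁ := Unt nv nh),
    Fintype.sum_sum_type (α₁ := Unt nv nh), Fintype.sum_sum_type (α₁ := Unt nv nh)]
  simp only [TermIdx.term, ExpTerm.sel, ExpTerm.value, if_true, Finset.univ_unique,
    Finset.sum_singleton]
  have h : ∀ u, (if isFree σ u then Real.log (bern (mfRound f (I.mfParam σ x u)) (s u)) else 0) =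
      (if isFree σ u then Real.log (1 - mfRound f (I.mfParam σ x u)) else 0) +
        if s u then (if isFree σ u then Real.log (mfRound f (I.mfParam σ x u)) -
          Real.log (1 - mfRound f (I.mfParam σ x u)) else 0) else 0 := by
    intro u
    cases s u <;> cases isFree σ u <;> simp [bern]
  simp only [h, Finset.sum_add_distrib]
  ring_nf
  rfl

open Classical in
/-- The Boltzmann factors of the clamped or unclamped machine. -/
def boltzmann (s : Unt nv nh → Bool) : ℝ :=
  if Compatible σ x s then Real.exp (-energyAt I.θ s) else 0

/-- The mean-field distribution of the clamped or unclamped machine dominates its Boltzmann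
distribution up to the factor `κ`, and its variational partition function is at most the partition
function. -/
structure MeanFieldBound : Prop where
  param_mem : ∀ u, isFree σ u = true → 0 ≤ I.mfParam σ x u ∧ I.mfParam σ x u ≤ 1
  z_pos : 0 < I.mfZ σ x
  z_le : I.mfZ σ x ≤ ∑ s, boltzmann I σ x s
  le_mul : ∀ s, Compatible σ x s → Real.exp (-energyAt I.θ s) ≤ κ * I.mfZ σ x *
    ∏ u, if isFree σ u then bern (I.mfParam σ x u) (s u) else 1

variable {G f l κ I σ x}

/-- The probability that a trial proposes `s` and is accepted is proportional to the Boltzmann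
factor, up to rounding errors. -/
theorem accepted_weight_bounds (hθ : WeightsOn G I.θ) (hκ : 0 < κ)
    (H : MeanFieldBound κ I σ x) {e₀ B : ℝ} (he : ∀ s, |energyAt I.θ s| ≤ e₀)
    (hB : Real.log (I.mfZ σ x) + Real.log κ + e₀ ≤ B) (hB0 : 0 ≤ B)
    (hl : 2 ^ f * B + (nv + nh) + numTerms G + 1 ≤ (2 ^ l : ℝ)) (s : Unt nv nh → Bool) :
    Real.exp (-((nv + nh) / 2 ^ f)) / (κ * I.mfZ σ x) * Real.exp (-(numTerms G / 2 ^ f)) *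
        boltzmann I σ x s ≤
      (∏ u, bern ((samplerSpec (termEnum G) c f l κ).unitProb f l I σ x u) (s u)) *
        Real.exp (-(((samplerSpec (termEnum G) c f l κ).total l I σ x s % 2 ^ l : ℕ) / 2 ^ f)) ∧
    (∏ u, bern ((samplerSpec (termEnum G) c f l κ).unitProb f l I σ x u) (s u)) *
        Real.exp (-(((samplerSpec (termEnum G) c f l κ).total l I σ x s % 2 ^ l : ℕ) / 2 ^ f)) ≤
      Real.exp (-((nv + nh) / 2 ^ f)) / (κ * I.mfZ σ x) * boltzmann I σ x s := by
  have hf : (0 : ℝ) < 2 ^ f := by positivity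
  have hZ := H.z_pos
  have hκZ : 0 < κ * I.mfZ σ x := mul_pos hκ hZ
  -- The mean-field probabilities are bounded below, because the Boltzmann factors are.
  have hprod : ∀ s, Compatible σ x s → Real.exp (-B) ≤
      ∏ u, if isFree σ u then bern (I.mfParam σ x u) (s u) else 1 := by
    intro s hs
    have h1 := H.le_mul s hs
    have h2 : Real.exp (-e₀) ≤ Real.exp (-energyAt I.θ s) :=
      Real.exp_le_exp.2 (neg_le_neg ((le_abs_self _).trans (he s)))
    have h3 : Real.exp (-B) * (κ * I.mfZ σ x) ≤ Real.exp (-e₀) := by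
      nth_rewrite 1 [← Real.exp_log hκZ]
      rw [← Real.exp_add, Real.exp_le_exp, Real.log_mul hκ.ne' hZ.ne']
      linarith
    have h4 := (h3.trans h2).trans h1
    rw [mul_comm] at h4
    exact le_of_mul_le_mul_left h4 hκZ
  have hfac0 : ∀ (s : Unt nv nh → Bool) u,
      0 ≤ if isFree σ u then bern (I.mfParam σ x u) (s u) else 1 := by
    intro s u
    split_ifs with hu
    · exact bern_nonneg (H.param_mem u hu).1 (H.param_mem u hu).2 _
    · norm_num
  have hfac1 : ∀ (s : Unt nv nh → Bool) u,
      (if isFree σ u then bern (I.mfParam σ x u) (s u) else 1) ≤ 1 := by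
    intro s u
    split_ifs with hu
    · have := H.param_mem u hu
      cases s u <;> simp only [bern, Bool.false_eq_true, if_false, if_true] <;> linarith
    · exact le_rfl
  have hbern : ∀ u, isFree σ u = true → ∀ b, Real.exp (-B) ≤ bern (I.mfParam σ x u) b := by
    intro u hu b
    set s' : Unt nv nh → Bool := Function.update (Sum.elim x fun _ => false) u b with hs'
    have hcomp : Compatible σ x s' := by
      intro hσ i
      have hne : Sum.inl i ≠ u := by
        rintro rfl
        subst hσ
        simp [isFree] at hu
      rw [hs', Function.update_of_ne hne]
      rfl
    refine (hprod s' hcomp).trans ?_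
    rw [← Finset.mul_prod_erase _ _ (Finset.mem_univ u), if_pos hu]
    refine (mul_le_of_le_one_right ?_ (Finset.prod_le_one (fun u _ => hfac0 s' u)
      fun u _ => hfac1 s' u)).trans ?_
    · exact bern_nonneg (H.param_mem u hu).1 (H.param_mem u hu).2 _
    · simp [hs']
  have hpos : ∀ u, isFree σ u = true → 0 < I.mfParam σ x u ∧ I.mfParam σ x u < 1 := by
    intro u hu
    have h1 := (Real.exp_pos (-B)).trans_le (hbern u hu true)
    have h2 := (Real.exp_pos (-B)).trans_le (hbern u hu false)
    simp only [bern, if_true, Bool.false_eq_true, if_false] at h1 h2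
    exact ⟨h1, by linarith⟩
  have hround : ∀ u, isFree σ u = true → ∀ b, 0 < bern (mfRound f (I.mfParam σ x u)) b := by
    intro u hu b
    refine lt_of_lt_of_le ?_ (exp_mul_bern_le_bern_mfRound f (hpos u hu).1 (hpos u hu).2 b)
    exact mul_pos (Real.exp_pos _) ((Real.exp_pos (-B)).trans_le (hbern u hu b))
  -- Therefore the digits of their logarithms fit into the registers.
  have hdigits : ∀ u, isFree σ u = true → mfDigits f (I.mfParam σ x u) < 2 ^ l := by
    intro u hu
    have h1 := mfDigits_lt f (hbern u hu) hB0
    have h2 : (mfDigits f (I.mfParam σ x u) : ℝ) < 2 ^ l := by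
      have : (0 : ℝ) ≤ nv + nh + numTerms G := by positivity
      linarith
    exact_mod_cast h2
  have hunit : ∀ u, bern ((samplerSpec (termEnum G) c f l κ).unitProb f l I σ x u) (s u) =
      if isFree σ u then bern (mfRound f (I.mfParam σ x u)) (s u)
      else u.elim (fun i => if s (.inl i) = x i then 1 else 0) (fun _ => 1) := by
    intro u
    rcases Bool.eq_false_or_eq_true (isFree σ u) with hu | hu
    · rw [unitProb_of_isFree _ c f l κ I σ x hu (hdigits u hu), if_pos hu]
    · obtain ⟨i, rfl, hσ, -⟩ :=
        slotBit_of_not_isFree (samplerSpec (termEnum G) c f l κ) I x hu 0 0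
      rw [unitProb_of_not_isFree _ c f l κ I σ x hσ, hu]
      simp only [Bool.false_eq_true, if_false, Sum.elim_inl]
      cases s (.inl i) <;> cases x i <;> simp [bern]
  by_cases hs : Compatible σ x s
  swap
  · -- A configuration that differs from the clamped values is never proposed.
    have hs' := hs
    unfold Compatible at hs'
    push Not at hs'
    obtain ⟨hσ, i, hi⟩ := hs'
    have hz : ∏ u, bern ((samplerSpec (termEnum G) c f l κ).unitProb f l I σ x u) (s u) = 0 := by
      refine Finset.prod_eq_zero (Finset.mem_univ (.inl i)) ?_
      rw [hunit]
      subst hσ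
      simp [isFree, hi]
    simp [boltzmann, hs, hz]
  have hp : ∏ u, bern ((samplerSpec (termEnum G) c f l κ).unitProb f l I σ x u) (s u) =
      Real.exp (∑ u, if isFree σ u then
        Real.log (bern (mfRound f (I.mfParam σ x u)) (s u)) else 0) := by
    rw [Real.exp_sum]
    refine Finset.prod_congr rfl fun u _ => ?_
    rw [hunit]
    rcases Bool.eq_false_or_eq_true (isFree σ u) with hu | hu
    · simp only [hu, if_true]
      rw [Real.exp_log (hround u hu _)]
    · obtain ⟨i, rfl, hσ, -⟩ :=
        slotBit_of_not_isFree (samplerSpec (termEnum G) c f l κ) I x hu 0 0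
      simp [hu, hs hσ i]
  set L := ∑ u, if isFree σ u then Real.log (bern (mfRound f (I.mfParam σ x u)) (s u)) else 0
    with hL
  -- The product of the proposal probability `exp L` and the exact acceptance probability does not
  -- depend on the rounding of the mean-field probabilities.
  have hV := exponent_eq G f κ I σ x hθ s
  rw [← hL] at hV
  have hL0 : L ≤ 0 := by
    refine Finset.sum_nonpos fun u _ => ?_
    split_ifs with hu
    · refine Real.log_nonpos (hround u hu _).le ?_
      have h1 := hround u hu true
      have h2 := hround u hu false
      simp only [bern, if_true, Bool.false_eq_true, if_false] at h1 h2
      cases s u <;> simp only [bern, if_true, Bool.false_eq_true, if_false] <;> linarith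
    · exact le_rfl
  have hes := abs_le.1 (he s)
  -- The exponent is nonnegative by the promise on `κ`; the correction `(nv + nh) / 2 ^ f` in it
  -- compensates for the rounding of the mean-field probabilities.
  have hVnn : 0 ≤ exponent (termEnum G) f κ I σ x s := by
    have h1 : Real.exp (-((nv + nh) / 2 ^ f)) *
        ∏ u, (if isFree σ u then bern (I.mfParam σ x u) (s u) else 1) ≤ Real.exp L := by
      rw [hL, Real.exp_sum]
      have e : Real.exp (-((nv + nh) / 2 ^ f)) =
          ∏ _u : Unt nv nh, Real.exp (-(1 / 2 ^ f)) := by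
        rw [Finset.prod_const, ← Real.exp_nat_mul]
        simp
        ring
      rw [e, ← Finset.prod_mul_distrib]
      refine Finset.prod_le_prod (fun u _ => mul_nonneg (Real.exp_pos _).le (hfac0 s u))
        fun u _ => ?_
      split_ifs with hu
      · rw [Real.exp_log (hround u hu _)]
        exact exp_mul_bern_le_bern_mfRound f (hpos u hu).1 (hpos u hu).2 _
      · rw [Real.exp_zero, mul_one, Real.exp_le_one_iff]
        simp
    have h2 := mul_le_mul_of_nonneg_left (H.le_mul s hs)
      (Real.exp_pos (-((nv + nh : ℝ) / 2 ^ f))).le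
    have h3 : Real.exp (-((nv + nh) / 2 ^ f)) * Real.exp (-energyAt I.θ s) ≤
        κ * I.mfZ σ x * Real.exp L := by
      refine h2.trans ?_
      rw [mul_left_comm]
      exact mul_le_mul_of_nonneg_left h1 hκZ.le
    rw [← Real.exp_add, ← Real.exp_log hκZ, ← Real.exp_add, Real.exp_le_exp,
      Real.log_mul hκ.ne' hZ.ne'] at h3
    rw [hV]
    linarith
  -- There is no overflow in the addition modulo `2 ^ l`.
  have hVlt : 2 ^ f * exponent (termEnum G) f κ I σ x s + numTerms G < 2 ^ l := by
    have h1 : exponent (termEnum G) f κ I σ x s ≤ B + (nv + nh) / 2 ^ f := by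
      rw [hV]; linarith
    have h2 := mul_le_mul_of_nonneg_left h1 hf.le
    rw [mul_add, mul_div_cancel₀ _ hf.ne'] at h2
    linarith
  obtain ⟨hX1, hX2⟩ := total_bounds (termEnum G) c f l κ I σ x s hVnn hVlt
  set X := ((samplerSpec (termEnum G) c f l κ).total l I σ x s % 2 ^ l : ℕ) with hX
  have hX1' : exponent (termEnum G) f κ I σ x s ≤ X / 2 ^ f := by
    rw [le_div_iff₀ hf]; linarith
  have hX2' : (X : ℝ) / 2 ^ f ≤ exponent (termEnum G) f κ I σ x s + numTerms G / 2 ^ f := by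
    rw [div_le_iff₀ hf, add_mul, div_mul_cancel₀ _ hf.ne']; linarith
  have hc : Real.exp (-((nv + nh) / 2 ^ f)) / (κ * I.mfZ σ x) =
      Real.exp (-((nv + nh) / 2 ^ f) - (Real.log κ + Real.log (I.mfZ σ x))) := by
    rw [Real.exp_sub, ← Real.log_mul hκ.ne' hZ.ne', Real.exp_log hκZ]
  rw [hp, hc, boltzmann, if_pos hs, ← Real.exp_add, ← Real.exp_add, ← Real.exp_add,
    ← Real.exp_add, Real.exp_le_exp, Real.exp_le_exp]
  constructor <;> linarith

/-- The value of the first accepted trial has the right distribution up to rounding errors, unless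
no trial is accepted, which has exponentially small probability. -/
theorem abs_resultProb_sub_le [NeZero l] (hθ : WeightsOn G I.θ) (hκ : 0 < κ)
    (H : MeanFieldBound κ I σ x) {e₀ B : ℝ} (he : ∀ s, |energyAt I.θ s| ≤ e₀)
    (hB : Real.log (I.mfZ σ x) + Real.log κ + e₀ ≤ B) (hB0 : 0 ≤ B)
    (hl : 2 ^ f * B + (nv + nh) + numTerms G + 1 ≤ (2 ^ l : ℝ)) :
    |(samplerSpec (termEnum G) c f l κ).resultProb f l K I σ x -
        (∑ s, boltzmann I σ x s * bit (coordVal c s)) / ∑ s, boltzmann I σ x s| ≤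
      numTerms G / 2 ^ f +
        Real.exp (-(K * (Real.exp (-((nv + nh + numTerms G) / 2 ^ f)) / κ))) := by
  have hW := accepted_weight_bounds c hθ hκ H he hB hB0 hl
  set Sp := samplerSpec (termEnum G) c f l κ with hSp
  set w := fun s => (∏ u, bern (Sp.unitProb f l I σ x u) (s u)) *
        Real.exp (-((Sp.total l I σ x s % 2 ^ l : ℕ) / 2 ^ f)) with hw
  have hZ := H.z_pos
  have hg0 : ∀ s, 0 ≤ boltzmann I σ x s := by
    intro s; unfold boltzmann; split_ifs
    · exact (Real.exp_pos _).le
    · exact le_rfl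
  have hG : 0 < ∑ s, boltzmann I σ x s := hZ.trans_le H.z_le
  have hc0 : 0 < Real.exp (-((nv + nh) / 2 ^ f)) / (κ * I.mfZ σ x) := by positivity
  have hratio := abs_sum_div_sub_sum_div_le (boltzmann I σ x) w (fun s => bit (coordVal c s))
    hc0 hg0 hG (fun s => by unfold bit; split_ifs <;> norm_num)
    (fun s => by unfold bit; split_ifs <;> norm_num) (fun s => (hW s).1) (fun s => (hW s).2)
  set A := ∑ s, w s with hA
  have hA1 : Sp.accepted f l I σ x (fun _ => 1) = A := by
    simp only [SamplerSpec.accepted, bexp, mul_one]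
    rfl
  have ht : Sp.accepted f l I σ x (fun s => if coordVal Sp.c s = true then 1 else 0) =
      ∑ s, w s * bit (coordVal c s) := by
    simp only [SamplerSpec.accepted, bexp, hw, bit, mul_assoc]
    rfl
  -- `A` is the acceptance probability of a trial. It is about `Z / (κ Z_Q)`, hence at least about
  -- `1 / κ`.
  have hAlow : Real.exp (-((nv + nh + numTerms G) / 2 ^ f)) / κ ≤ A := by
    calc Real.exp (-((nv + nh + numTerms G) / 2 ^ f)) / κ
        = Real.exp (-((nv + nh) / 2 ^ f)) / (κ * I.mfZ σ x) * Real.exp (-(numTerms G / 2 ^ f)) *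
          I.mfZ σ x := by
          rw [add_div, neg_add, Real.exp_add]
          field_simp
      _ ≤ Real.exp (-((nv + nh) / 2 ^ f)) / (κ * I.mfZ σ x) * Real.exp (-(numTerms G / 2 ^ f)) *
          ∑ s, boltzmann I σ x s :=
          mul_le_mul_of_nonneg_left H.z_le (mul_pos hc0 (Real.exp_pos _)).le
      _ ≤ A := by
          rw [Finset.mul_sum]
          exact Finset.sum_le_sum fun s _ => (hW s).1
  have hApos : 0 < A := lt_of_lt_of_le (by positivity) hAlow
  have hAle : A ≤ 1 := by
    rw [← hA1]
    refine bexp_le_one (fun u => (Sp.unitProb_mem f l I σ x u).1)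
      (fun u => (Sp.unitProb_mem f l I σ x u).2) fun s => ?_
    rw [mul_one, Real.exp_le_one_iff]
    simp only [neg_nonpos]
    positivity
  have hR := resultProb_eq (l := l) Sp f K I σ x
  rw [hA1, ht] at hR
  -- The first accepted trial has the conditional distribution, unless all `K` trials fail.
  have hR' : Sp.resultProb f l K I σ x =
      (∑ s, w s * bit (coordVal c s)) / A * (1 - (1 - A) ^ K) := by
    rw [div_mul_eq_mul_div, eq_div_iff hApos.ne', mul_comm]
    exact hR
  have hw0 : ∀ s, 0 ≤ w s := fun s => (mul_nonneg (mul_pos hc0 (Real.exp_pos _)).le (hg0 s)).trans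
    (hW s).1
  set D := (∑ s, w s * bit (coordVal c s)) / A with hD
  have hD0 : 0 ≤ D := by
    refine div_nonneg (Finset.sum_nonneg fun s _ => mul_nonneg (hw0 s) ?_) hApos.le
    unfold bit; split_ifs <;> norm_num
  have hD1 : D ≤ 1 := by
    rw [hD, div_le_one hApos]
    refine Finset.sum_le_sum fun s _ => mul_le_of_le_one_right (hw0 s) ?_
    unfold bit; split_ifs <;> norm_num
  have hpow0 : 0 ≤ (1 - A) ^ K := pow_nonneg (by linarith) K
  have hpow : (1 - A) ^ K ≤
      Real.exp (-(K * (Real.exp (-((nv + nh + numTerms G) / 2 ^ f)) / κ))) := by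
    calc (1 - A) ^ K ≤ (Real.exp (-A)) ^ K :=
          pow_le_pow_left₀ (by linarith) (by have := Real.add_one_le_exp (-A); linarith) K
      _ = Real.exp (-(K * A)) := by rw [← Real.exp_nat_mul]; ring_nf
      _ ≤ _ := by
          rw [Real.exp_le_exp]
          exact neg_le_neg (mul_le_mul_of_nonneg_left hAlow (Nat.cast_nonneg K))
  have h5 : |Sp.resultProb f l K I σ x - D| ≤ (1 - A) ^ K := by
    rw [hR', abs_le]
    constructor <;> nlinarith
  calc _ ≤ |Sp.resultProb f l K I σ x - D| +
        |D - (∑ s, boltzmann I σ x s * bit (coordVal c s)) / ∑ s, boltzmann I σ x s| :=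
        abs_sub_le _ _ _
    _ ≤ _ := by linarith

end

/-! ### Consequences of the mean-field promises -/

section

variable {nv nh N : ℕ}

theorem card_adjPair (G : SimpleGraph (Unt nv nh)) :
    Fintype.card (AdjPair G) = 2 * G.edgeSet.ncard := by
  classical
  have h := G.dart_card_eq_twice_card_edges
  rw [← Set.ncard_coe_finset, SimpleGraph.coe_edgeFinset] at h
  rw [← h]
  exact Fintype.card_congr ⟨fun p => ⟨p.1, p.2⟩, fun d => ⟨d.toProd, d.adj⟩, fun _ => rfl,
    fun _ => rfl⟩

theorem card_units_le (G : SimpleGraph (Unt nv nh)) (hG : G.Connected) :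
    nv + nh ≤ G.edgeSet.ncard + 1 := by
  have := hG.card_vert_le_card_edgeSet_add_one
  rw [Nat.card_eq_fintype_card, Fintype.card_sum, Fintype.card_fin, Fintype.card_fin] at this
  exact this

theorem sum_units (F : (Unt nv nh → Bool) → ℝ) :
    ∑ s, F s = ∑ v : Config nv, ∑ h : Config nh, F (Sum.elim v h) := by
  rw [← (Equiv.sumArrowEquivProdArrow (Fin nv) (Fin nh) Bool).symm.sum_comp,
    Fintype.sum_prod_type]
  rfl

variable (I : Instance nv nh N) (x : Config nv)

theorem sum_boltzmann_false (F : (Unt nv nh → Bool) → ℝ) :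
    ∑ s, boltzmann I false x s * F s = ∑ s, Real.exp (-energyAt I.θ s) * F s := by
  refine Finset.sum_congr rfl fun s _ => ?_
  have hs : Compatible false x s := fun h => by simp at h
  rw [boltzmann, if_pos hs]

theorem sum_boltzmann_true (F : (Unt nv nh → Bool) → ℝ) :
    ∑ s, boltzmann I true x s * F s =
      ∑ h : Config nh, Real.exp (-energy I.θ x h) * F (Sum.elim x h) := by
  rw [sum_units, Finset.sum_eq_single x]
  · refine Finset.sum_congr rfl fun h _ => ?_
    have hs : Compatible true x (Sum.elim x h : Unt nv nh → Bool) := fun _ i => rfl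
    rw [boltzmann, if_pos hs]
    rfl
  · intro v _ hv
    refine Finset.sum_eq_zero fun h _ => ?_
    rw [boltzmann, if_neg, zero_mul]
    exact fun hc => hv (funext fun i => hc rfl i)
  · exact fun h => absurd (Finset.mem_univ x) h

theorem sum_boltzmann_false_div (c : Coord nv nh) :
    (∑ s, boltzmann I false x s * bit (coordVal c s)) / ∑ s, boltzmann I false x s =
      modelMean I.θ c := by
  have := sum_boltzmann_false I x fun _ => 1
  simp only [mul_one] at this
  rw [sum_boltzmann_false, this, ← partition_eq_sum]
  rfl

theorem sum_boltzmann_true_div (c : Coord nv nh) :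
    (∑ s, boltzmann I true x s * bit (coordVal c s)) / ∑ s, boltzmann I true x s =
      dataMean I.θ c x := by
  have := sum_boltzmann_true I x fun _ => 1
  simp only [mul_one] at this
  rw [sum_boltzmann_true, this]
  rfl

theorem bernoulliProd_nonneg {n : ℕ} {μ : Fin n → ℝ} (h : ∀ i, μ i ∈ Set.Icc 0 1) (s : Config n) :
    0 ≤ bernoulliProd μ s := by
  refine Finset.prod_nonneg fun i _ => ?_
  have := h i
  split_ifs
  · exact this.1
  · linarith [this.2]

theorem sum_bernoulliProd {n : ℕ} (μ : Fin n → ℝ) : ∑ s, bernoulliProd μ s = 1 :=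
  sum_prod_bern μ

theorem prod_mfParam_false (s : Unt nv nh → Bool) :
    (∏ u, if isFree false u then bern (I.mfParam false x u) (s u) else 1) =
      bernoulliProd I.μ (fun i => s (.inl i)) * bernoulliProd I.ν fun j => s (.inr j) := by
  rw [Fintype.prod_sum_type]
  rfl

theorem prod_mfParam_true (s : Unt nv nh → Bool) :
    (∏ u, if isFree true u then bern (I.mfParam true x u) (s u) else 1) =
      bernoulliProd (I.νx x) fun j => s (.inr j) := by
  rw [Fintype.prod_sum_type]
  simp only [isFree, Sum.isRight_inl, Sum.isRight_inr, Bool.not_true, Bool.or_false,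
    Bool.false_eq_true, if_false, if_true, Finset.prod_const_one, one_mul]
  rfl

variable {I x} {κ κ' : ℝ}

theorem meanFieldBound_false (hm : IsMeanField I.θ I.μ I.ν) (hk : KappaBound I.θ I.μ I.ν κ')
    (hκ : κ' ≤ κ) : MeanFieldBound κ I false x where
  param_mem u _ := by
    rcases u with i | j
    · exact hm.1 i
    · exact hm.2.1 j
  z_pos := Real.exp_pos _
  z_le := by
    have h0 : ∀ s : Config nv × Config nh, 0 ≤ bernoulliProd I.μ s.1 * bernoulliProd I.ν s.2 :=
      fun s => mul_nonneg (bernoulliProd_nonneg hm.1 _) (bernoulliProd_nonneg hm.2.1 _)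
    have h1 : ∑ s : Config nv × Config nh, bernoulliProd I.μ s.1 * bernoulliProd I.ν s.2 = 1 := by
      rw [Fintype.sum_prod_type]
      simp only [← Finset.mul_sum, sum_bernoulliProd, mul_one]
    have h := exp_sum_mul_log_div_le (fun s : Config nv × Config nh =>
      bernoulliProd I.μ s.1 * bernoulliProd I.ν s.2) (fun s => Real.exp (-energy I.θ s.1 s.2))
      h0 h1 fun _ => Real.exp_pos _
    rw [Fintype.sum_prod_type, Fintype.sum_prod_type] at h
    have e := sum_boltzmann_false I x fun _ => 1
    simp only [mul_one] at e
    rw [e, sum_units]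
    exact h
  le_mul s _ := by
    rw [prod_mfParam_false]
    have h := hk (fun i => s (.inl i)) fun j => s (.inr j)
    have hZ : 0 < zQ I.θ I.μ I.ν := Real.exp_pos _
    rw [div_le_iff₀ hZ] at h
    refine h.trans ?_
    have hQ : 0 ≤ bernoulliProd I.μ (fun i => s (.inl i)) * bernoulliProd I.ν fun j => s (.inr j) :=
      mul_nonneg (bernoulliProd_nonneg hm.1 _) (bernoulliProd_nonneg hm.2.1 _)
    calc _ ≤ κ * (bernoulliProd I.μ (fun i => s (.inl i)) *
          bernoulliProd I.ν fun j => s (.inr j)) * zQ I.θ I.μ I.ν := by gcongr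
      _ = κ * zQ I.θ I.μ I.ν * (bernoulliProd I.μ (fun i => s (.inl i)) *
          bernoulliProd I.ν fun j => s (.inr j)) := by ring

theorem meanFieldBound_true (hm : IsClampedMeanField I.θ x (I.νx x))
    (hk : ClampedKappaBound I.θ x (I.νx x) κ') (hκ : κ' ≤ κ) : MeanFieldBound κ I true x where
  param_mem u hu := by
    rcases u with i | j
    · simp [isFree] at hu
    · exact hm.1 j
  z_pos := Real.exp_pos _
  z_le := by
    have h := exp_sum_mul_log_div_le (bernoulliProd (I.νx x)) (fun h => Real.exp (-energy I.θ x h))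
      (bernoulliProd_nonneg hm.1) (sum_bernoulliProd _) fun _ => Real.exp_pos _
    have e := sum_boltzmann_true I x fun _ => 1
    simp only [mul_one] at e
    rw [e]
    exact h
  le_mul s hs := by
    rw [prod_mfParam_true]
    have h := hk fun j => s (.inr j)
    have hZ : 0 < clampedZQ I.θ x (I.νx x) := Real.exp_pos _
    rw [div_le_iff₀ hZ] at h
    have hx : energyAt I.θ s = energy I.θ x fun j => s (.inr j) := by
      unfold energyAt
      rw [funext (hs rfl)]
    rw [hx]
    refine h.trans ?_
    have hQ := bernoulliProd_nonneg hm.1 fun j => s (.inr j)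
    calc _ ≤ κ * (bernoulliProd (I.νx x) fun j => s (.inr j)) * clampedZQ I.θ x (I.νx x) := by
          gcongr
      _ = κ * clampedZQ I.θ x (I.νx x) * (bernoulliProd (I.νx x) fun j => s (.inr j)) := by ring

/-- The constant `κ` is at least `1`, since the variational partition function is at most the
partition function. -/
theorem one_le_of_kappaBound (hm : IsMeanField I.θ I.μ I.ν) (hk : KappaBound I.θ I.μ I.ν κ) :
    1 ≤ κ := by
  have H := meanFieldBound_false (x := fun _ => false) hm hk le_rfl
  have h1 := H.z_le
  have hZ := H.z_pos
  have e := sum_boltzmann_false I (fun _ => false) fun _ => 1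
  simp only [mul_one] at e
  rw [e] at h1
  have h2 : ∑ s, Real.exp (-energyAt I.θ s) ≤ κ * I.mfZ false fun _ => false := by
    refine (Finset.sum_le_sum fun s _ => H.le_mul s fun h => by simp at h).trans ?_
    rw [← Finset.mul_sum]
    have : (∑ s : Unt nv nh → Bool, ∏ u, if isFree false u then
        bern (I.mfParam false (fun _ => false) u) (s u) else 1) = 1 := by
      have h : ∀ u : Unt nv nh, isFree false u = true := fun u => by simp [isFree]
      simp only [h, if_true]
      exact sum_prod_bern _
    rw [this, mul_one]
  have h3 := h1.trans h2
  by_contra hlt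
  push Not at hlt
  have := mul_lt_mul_of_pos_right hlt hZ
  linarith

/-- The number of binary places for an accuracy `2 ^ (-J)` on a graph with `E` edges. -/
def precision (J E : ℕ) : ℕ := J + Nat.clog 2 (11 * E)

/-- The number of binary digits. -/
def digits (J E : ℕ) (W κ : ℝ) : ℕ :=
  precision J E + Nat.clog 2 ⌈14 * E + 8 * (E * W) + κ⌉₊ + 1

/-- The number of trials. -/
def trials (J : ℕ) (κ : ℝ) : ℕ := ⌈3 * κ * J⌉₊ + 1

instance (J E : ℕ) (W κ : ℝ) : NeZero (digits J E W κ) := ⟨Nat.succ_ne_zero _⟩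

theorem log_mfZ_le {σ : Bool} (H : MeanFieldBound κ I σ x) {e₀ : ℝ}
    (he : ∀ s, |energyAt I.θ s| ≤ e₀) : Real.log (I.mfZ σ x) ≤ (nv + nh) + e₀ := by
  rw [Real.log_le_iff_le_exp H.z_pos]
  refine H.z_le.trans ?_
  have h1 : ∀ s, boltzmann I σ x s ≤ Real.exp e₀ := by
    intro s
    unfold boltzmann
    split_ifs
    · exact Real.exp_le_exp.2 ((neg_le_abs _).trans (he s))
    · exact (Real.exp_pos _).le
  refine (Finset.sum_le_sum fun s _ => h1 s).trans ?_
  rw [Finset.sum_const, Finset.card_univ, Fintype.card_fun, Fintype.card_bool, Fintype.card_sum,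
    Fintype.card_fin, Fintype.card_fin, nsmul_eq_mul, Real.exp_add]
  refine mul_le_mul_of_nonneg_right ?_ (Real.exp_pos _).le
  push_cast
  have : (2 : ℝ) ≤ Real.exp 1 := by have := Real.add_one_le_exp (1 : ℝ); linarith
  calc (2 : ℝ) ^ (nv + nh) ≤ Real.exp 1 ^ (nv + nh) := pow_le_pow_left₀ (by norm_num) this _
    _ = Real.exp (nv + nh) := by rw [← Real.exp_nat_mul]; push_cast; ring_nf

/-- With the above parameters the distribution of the value of the first accepted trial is accurate
to `2 * 2 ^ (-J)`. -/
theorem abs_resultProb_sub_le_pow {G : SimpleGraph (Unt nv nh)} (hG : G.Connected)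
    (hE : 0 < G.edgeSet.ncard) {W : ℝ} (hW0 : 0 ≤ W) (hθ : WeightsOn G I.θ)
    (hW : ∀ a, |I.θ a| ≤ W) (c : Coord nv nh) (J : ℕ) (hκ : 0 < κ) {σ : Bool}
    (H : MeanFieldBound κ I σ x) :
    |(samplerSpec (termEnum G) c (precision J G.edgeSet.ncard) (digits J G.edgeSet.ncard W κ)
        κ).resultProb (precision J G.edgeSet.ncard) (digits J G.edgeSet.ncard W κ) (trials J κ)
          I σ x -
        (∑ s, boltzmann I σ x s * bit (coordVal c s)) / ∑ s, boltzmann I σ x s| ≤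
      2 * (1 / 2) ^ J := by
  have hadj := card_adjPair G
  have hn := card_units_le G hG
  set E := G.edgeSet.ncard with hEdef
  have hT := numTerms_eq G
  rw [hadj] at hT
  have hn' : (nv : ℝ) + nh ≤ E + 1 := by exact_mod_cast hn
  have hE1 : (1 : ℝ) ≤ E := by exact_mod_cast hE
  have hT' : (numTerms G : ℝ) = 1 + 3 * (nv + nh) + 2 * E := by exact_mod_cast hT
  set f := precision J E with hf
  set l := digits J E W κ with hl
  have hEW : 0 ≤ (E : ℝ) * W := by positivity
  have he : ∀ s, |energyAt I.θ s| ≤ 4 * (E * W) := by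
    intro s
    refine (abs_energyAt_le G I.θ hθ hW0 hW s).trans ?_
    rw [hadj]
    push_cast
    nlinarith
  have hlogκ : Real.log κ ≤ κ := (Real.log_le_sub_one_of_pos hκ).trans (by linarith)
  have hB : Real.log (I.mfZ σ x) + Real.log κ + 4 * (E * W) ≤ 2 * E + 8 * (E * W) + κ := by
    have := log_mfZ_le H he
    linarith
  have hf11 : (2 : ℝ) ^ J * (11 * E) ≤ 2 ^ f := by
    rw [hf, precision, pow_add]
    refine mul_le_mul_of_nonneg_left ?_ (by positivity)
    exact_mod_cast Nat.le_pow_clog (by norm_num : 1 < 2) (11 * E)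
  have hf1 : (1 : ℝ) ≤ 2 ^ f := one_le_pow₀ (by norm_num)
  -- The width `l` leaves room for the exponent and all rounding errors.
  have hlB : (2 : ℝ) ^ f * (14 * E + 8 * (E * W) + κ) ≤ 2 ^ l := by
    have h1 : (⌈14 * E + 8 * (E * W) + κ⌉₊ : ℝ) ≤
        2 ^ Nat.clog 2 ⌈14 * (E : ℝ) + 8 * (E * W) + κ⌉₊ := by
      exact_mod_cast Nat.le_pow_clog (by norm_num : 1 < 2) ⌈14 * (E : ℝ) + 8 * (E * W) + κ⌉₊
    have h2 := Nat.le_ceil (14 * (E : ℝ) + 8 * (E * W) + κ)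
    rw [hl, digits, ← hf, pow_succ, pow_add]
    have h3 : (2 : ℝ) ^ f * (14 * E + 8 * (E * W) + κ) ≤
        2 ^ f * 2 ^ Nat.clog 2 ⌈14 * (E : ℝ) + 8 * (E * W) + κ⌉₊ :=
      mul_le_mul_of_nonneg_left (h2.trans h1) (by positivity)
    have h4 : (0 : ℝ) ≤ 2 ^ f * 2 ^ Nat.clog 2 ⌈14 * (E : ℝ) + 8 * (E * W) + κ⌉₊ := by positivity
    linarith
  have hl' : (2 : ℝ) ^ f * (2 * E + 8 * (E * W) + κ) + (nv + nh) + numTerms G + 1 ≤ 2 ^ l := by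
    refine le_trans ?_ hlB
    have : (nv + nh) + numTerms G + 1 ≤ 12 * (E : ℝ) := by rw [hT']; linarith
    nlinarith
  have hmain := abs_resultProb_sub_le c (K := trials J κ) hθ hκ H he hB (by positivity) hl'
  refine hmain.trans ?_
  have hpow : ((1 : ℝ) / 2) ^ J = 1 / 2 ^ J := by rw [div_pow, one_pow]
  have hJ : (0 : ℝ) < 2 ^ J := by positivity
  have h1 : (numTerms G : ℝ) / 2 ^ f ≤ (1 / 2) ^ J := by
    rw [hpow, div_le_div_iff₀ (by positivity) hJ, one_mul]
    refine le_trans ?_ hf11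
    rw [mul_comm]
    refine mul_le_mul_of_nonneg_left ?_ hJ.le
    rw [hT']; linarith
  have h2 : Real.exp (-(trials J κ * (Real.exp (-((nv + nh + numTerms G) / 2 ^ f)) / κ))) ≤
      (1 / 2) ^ J := by
    have hx : ((nv : ℝ) + nh + numTerms G) / 2 ^ f ≤ 1 := by
      rw [div_le_one (by positivity)]
      have : (1 : ℝ) ≤ 2 ^ J := one_le_pow₀ (by norm_num)
      nlinarith
    have h3 : (1 : ℝ) / 3 ≤ Real.exp (-((nv + nh + numTerms G) / 2 ^ f)) := by
      have h4 : Real.exp (-1) ≤ Real.exp (-(((nv : ℝ) + nh + numTerms G) / 2 ^ f)) :=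
        Real.exp_le_exp.2 (neg_le_neg hx)
      have h5 := Real.exp_neg_one_gt_d9
      linarith
    have hK : 3 * κ * J ≤ trials J κ := by
      unfold trials
      push_cast
      have := Nat.le_ceil (3 * κ * J)
      linarith
    have h6 : (J : ℝ) ≤ trials J κ * (Real.exp (-((nv + nh + numTerms G) / 2 ^ f)) / κ) := by
      have h7 : 1 / 3 / κ ≤ Real.exp (-((nv + nh + numTerms G) / 2 ^ f)) / κ :=
        div_le_div_of_nonneg_right h3 hκ.le
      calc (J : ℝ) = 3 * κ * J * (1 / 3 / κ) := by field_simp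
        _ ≤ trials J κ * (Real.exp (-((nv + nh + numTerms G) / 2 ^ f)) / κ) :=
          mul_le_mul hK h7 (by positivity) (by positivity)
    calc _ ≤ Real.exp (-(J : ℝ)) := Real.exp_le_exp.2 (neg_le_neg h6)
      _ = Real.exp (-1) ^ J := by rw [← Real.exp_nat_mul]; ring_nf
      _ ≤ (1 / 2) ^ J := by
        refine pow_le_pow_left₀ (Real.exp_pos _).le ?_ J
        have := Real.exp_neg_one_lt_d9
        linarith
  linarith

end

/-! ### The algorithm -/

section

variable {nv nh N l K T : ℕ} [NeZero l]

theorem resultProb_mem (Sp : SamplerSpec nv nh T) (f K : ℕ) (I : Instance nv nh N) (σ : Bool)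
    (x : Config nv) : 0 ≤ Sp.resultProb f l K I σ x ∧ Sp.resultProb f l K I σ x ≤ 1 := by
  have hp : ∀ j : TrialCoin nv nh l, 0 ≤ trialCoinProb f j ∧ trialCoinProb f j ≤ 1 := by
    rintro (⟨u, b⟩ | b)
    · exact coinProb_mem f (.coinA (0 : Fin 1) u b : Wire nv nh 0 l 1 0)
    · exact coinProb_mem f (.coinB (0 : Fin 1) b : Wire nv nh 0 l 1 0)
  have h0 : ∀ a, 0 ≤ Sp.trialDist f l I σ x a := by
    intro a
    refine Finset.sum_nonneg fun c _ => ?_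
    split_ifs
    · exact prod_bern_nonneg (fun j => (hp j).1) (fun j => (hp j).2) c
    · exact le_rfl
  have hy : ∀ y : Fin K → Bool × Bool, 0 ≤ ∏ k, Sp.trialDist f l I σ x (y k) :=
    fun y => Finset.prod_nonneg fun k _ => h0 _
  refine ⟨Finset.sum_nonneg fun y _ => mul_nonneg (hy y) (by split_ifs <;> norm_num), ?_⟩
  have h1 : ∑ y : Fin K → Bool × Bool, ∏ k, Sp.trialDist f l I σ x (y k) = 1 := by
    rw [sum_prod_eq_prod_sum fun (_ : Fin K) a => Sp.trialDist f l I σ x a]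
    simp [sum_trialDist]
  rw [← h1]
  exact Finset.sum_le_sum fun y _ => mul_le_of_le_one_right (hy y) (by split_ifs <;> norm_num)

/-- The sampling circuit. -/
def SamplerSpec.prepOps (Sp : SamplerSpec nv nh T) (N f : ℕ) :
    List (Op nv nh N (Wire nv nh (Nat.clog 2 N) l K T)) :=
  coinOps (coinProb f) Finset.univ.toList ++ Sp.classicalOps.map Op.cls

theorem SamplerSpec.prepOps_costs (Sp : SamplerSpec nv nh T) (N f E : ℕ) :
    opQueries (Sp.prepOps N f : List (Op nv nh N (Wire nv nh (Nat.clog 2 N) l K T))) = 1 ∧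
      opCost E (Sp.prepOps N f : List (Op nv nh N (Wire nv nh (Nat.clog 2 N) l K T))) ≤
        4 * Fintype.card (Wire nv nh (Nat.clog 2 N) l K T) + 1 + 4 * (E * l) := by
  have h1 : ∀ (p : Wire nv nh (Nat.clog 2 N) l K T → ℝ) ws,
      opQueries (coinOps p ws : List (Op nv nh N _)) = 0 ∧
      opCost E (coinOps p ws : List (Op nv nh N _)) = ws.length := by
    intro p ws
    induction ws with
    | nil => exact ⟨rfl, rfl⟩
    | cons w ws ih =>
      obtain ⟨ih1, ih2⟩ := ih
      constructor
      · change 0 + opQueries (coinOps p ws : List (Op nv nh N _)) = 0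
        rw [ih1]
      · change 1 + opCost E (coinOps p ws : List (Op nv nh N _)) = _
        rw [ih2, List.length_cons, add_comm]
  have h2 := netlist_costs (N := N) E (Sp.srcs N)
    (rankedWires (wireRank : Wire nv nh (Nat.clog 2 N) l K T → ℕ))
  have h3 := length_netlist_ranked_le (N := N) (Sp.srcs N)
    (wireRank : Wire nv nh (Nat.clog 2 N) l K T → ℕ) (Sp.length_srcs_le N)
  unfold prepOps
  rw [opQueries_append, opCost_append, (h1 _ _).1, (h1 _ _).2, Finset.length_toList,
    Finset.card_univ]
  constructor
  · change 0 + (1 + (0 + opQueries ((netlist (N := N) (Sp.srcs N)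
      (rankedWires (wireRank : Wire nv nh (Nat.clog 2 N) l K T → ℕ))).map Op.cls))) = 1
    rw [h2.1]
  · change _ + (1 + (E * (4 * l) + opCost E ((netlist (N := N) (Sp.srcs N)
      (rankedWires (wireRank : Wire nv nh (Nat.clog 2 N) l K T → ℕ))).map Op.cls))) ≤ _
    rw [h2.2]
    have : E * (4 * l) = 4 * (E * l) := by ring
    omega

/-- The probability that the sampling circuit sets the flag. -/
def SamplerSpec.flagProb (Sp : SamplerSpec nv nh T) (f l K : ℕ) [NeZero l]
    (I : Instance nv nh N) : ℝ :=
  1 / 8 * (1 / 2 ^ Nat.clog 2 N * ∑ p,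
    (Sp.resultProb f l K I true (I.x p) + (1 - Sp.resultProb f l K I false (I.x p))))

theorem two_pow_clog_lt {n : ℕ} (hn : 0 < n) : 2 ^ Nat.clog 2 n < 2 * n := by
  rcases Nat.lt_or_ge 1 n with h | h
  · have h1 := Nat.pow_pred_clog_lt_self (by norm_num : 1 < 2) h
    have h2 : 0 < Nat.clog 2 n := Nat.clog_pos (by norm_num) h
    obtain ⟨c, hc⟩ : ∃ c, Nat.clog 2 n = c + 1 := ⟨_, (Nat.succ_pred_eq_of_pos h2).symm⟩
    rw [hc] at h1 ⊢
    rw [pow_succ]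
    simp at h1
    omega
  · have : n = 1 := by omega
    subst this
    simp

theorem flagProb_mem (Sp : SamplerSpec nv nh T) (f K : ℕ) (I : Instance nv nh N) :
    0 ≤ Sp.flagProb f l K I ∧ Sp.flagProb f l K I ≤ 1 / 4 := by
  have hm : (0 : ℝ) < 2 ^ Nat.clog 2 N := by positivity
  have h0 : 0 ≤ ∑ p, (Sp.resultProb f l K I true (I.x p) +
      (1 - Sp.resultProb f l K I false (I.x p))) := by
    refine Finset.sum_nonneg fun p _ => ?_
    linarith [(resultProb_mem (l := l) Sp f K I true (I.x p)).1,
      (resultProb_mem (l := l) Sp f K I false (I.x p)).2]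
  have h1 : ∑ p, (Sp.resultProb f l K I true (I.x p) +
      (1 - Sp.resultProb f l K I false (I.x p))) ≤ 2 * N := by
    refine (Finset.sum_le_sum (g := fun _ => (2 : ℝ)) fun p _ => ?_).trans (by simp [mul_comm])
    linarith [(resultProb_mem (l := l) Sp f K I true (I.x p)).2,
      (resultProb_mem (l := l) Sp f K I false (I.x p)).1]
  have hNm : (N : ℝ) ≤ 2 ^ Nat.clog 2 N := by
    exact_mod_cast Nat.le_pow_clog (by norm_num : 1 < 2) N
  unfold SamplerSpec.flagProb
  refine ⟨by positivity, ?_⟩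
  have : 1 / 2 ^ Nat.clog 2 N * ∑ p, (Sp.resultProb f l K I true (I.x p) +
      (1 - Sp.resultProb f l K I false (I.x p))) ≤ 2 := by
    rw [one_div, inv_mul_le_iff₀ hm]
    linarith
  linarith

/-- The circuit for a copy of the sampling circuit that is amplified by `k` Grover iterations, and
the statistics of its flag. -/
theorem sum_groverOps_prepOps (hN : 0 < N) (Sp : SamplerSpec nv nh T) (f : ℕ)
    (I : Instance nv nh N) {θ : ℝ} (hθ : Sp.flagProb f l K I = Real.sin θ ^ 2) (k : ℕ) (b : Bool) :
    ∑ s, ‖run I (groverOps (Sp.prepOps N f : List (Op nv nh N (Wire nv nh (Nat.clog 2 N) l K T)))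
        .flag k) zeroState s‖ ^ 2 * (if s (.inl .flag) = b then (1 : ℝ) else 0) =
      bern (Real.sin ((2 * (k : ℝ) + 1) * θ) ^ 2) b := by
  have hflag := bexp_flag (l := l) (K := K) hN Sp f I
  refine sum_groverOps I _ _ θ ?_ ?_ k b
  · rw [← hθ, SamplerSpec.flagProb, ← hflag]
    exact sum_run_coins_cls I (coinProb f) (fun w => (coinProb_mem f w).1)
      (fun w => (coinProb_mem f w).2) _ fun s => if s .flag then 1 else 0
  · rw [Real.cos_sq', ← hθ, SamplerSpec.flagProb, ← hflag, ← bexp_one_sub]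
    refine (sum_run_coins_cls I (coinProb f) (fun w => (coinProb_mem f w).1)
      (fun w => (coinProb_mem f w).2) _ fun s => if s .flag then 0 else 1).trans ?_
    refine bexp_congr fun s => ?_
    split_ifs <;> norm_num

/-- The estimation algorithm: copies of the sampling circuit with various numbers of Grover
iterations, whose flags are measured. -/
def SamplerSpec.algorithm (Sp : SamplerSpec nv nh T) (N f l K : ℕ) [NeZero l] {S : ℕ}
    (k : Fin S → ℕ) (post : ℝ → Config S → ℝ) : QAlgorithm nv nh N :=
  copiesAlgorithm (fun s => groverOps (Sp.prepOps N f :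
    List (Op nv nh N (Wire nv nh (Nat.clog 2 N) l K T))) .flag (k s)) (.inl .flag) post

theorem algorithm_costs (Sp : SamplerSpec nv nh T) (f K : ℕ) {S J E : ℕ} (k : Fin S → ℕ)
    (hk : ∀ s, k s < 2 ^ (J + 4)) (post : ℝ → Config S → ℝ) (hK : 1 ≤ K) (hE : 1 ≤ E)
    (hn : nv + nh ≤ 2 * E) (hT : T ≤ 11 * E) :
    (Sp.algorithm N f l K k post).queries ≤ S * 2 ^ (J + 5) ∧
      (Sp.algorithm N f l K k post).cost E ≤
        S * 2 ^ (J + 5) * (1208 * (K * E * (l + Nat.clog 2 N))) := by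
  have hl : 1 ≤ l := Nat.one_le_iff_ne_zero.2 (NeZero.ne l)
  obtain ⟨hq, hc⟩ := copiesAlgorithm_costs (fun s => groverOps (Sp.prepOps N f :
    List (Op nv nh N (Wire nv nh (Nat.clog 2 N) l K T))) .flag (k s)) (.inl .flag) post E
  obtain ⟨hq1, hc1⟩ := Sp.prepOps_costs (l := l) (K := K) N f E
  have hk' : ∀ s, 2 * k s + 1 ≤ 2 ^ (J + 5) := by
    intro s
    have := hk s
    rw [pow_succ 2 (J + 4)]
    omega
  have hcard := card_wire_le (m := Nat.clog 2 N) hl hK hE hn hT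
  have hEl : E * l ≤ K * E * (l + Nat.clog 2 N) :=
    Nat.mul_le_mul (Nat.le_mul_of_pos_left E hK) (Nat.le_add_right _ _)
  have h1 : 1 ≤ K * E * (l + Nat.clog 2 N) :=
    Nat.one_le_iff_ne_zero.2 (by positivity)
  constructor
  · refine hq.trans_le ?_
    refine (Finset.sum_le_sum (g := fun _ => 2 ^ (J + 5)) fun s _ => ?_).trans (by simp)
    rw [opQueries_groverOps, hq1, mul_one]
    exact hk' s
  · refine hc.trans_le ?_
    refine (Finset.sum_le_sum (g := fun _ => 2 ^ (J + 5) *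
      (1208 * (K * E * (l + Nat.clog 2 N)))) fun s _ => ?_).trans (by simp [mul_assoc])
    refine (opCost_groverOps_le E _ _ _).trans (Nat.mul_le_mul (hk' s) ?_)
    omega

/-- The success probability of the algorithm, when the post-processing turns an accurate estimate of
the probability of the flag into an output in `Z`. -/
theorem le_outputProb_algorithm (hN : 0 < N) (Sp : SamplerSpec nv nh T) (f K : ℕ) {S J : ℕ} {η : ℝ}
    (k : Fin S → ℕ) (est : (Fin S → Bool) → ℝ)
    (hest : ∀ θ : ℝ, 0 ≤ θ → θ ≤ Real.pi / 6 →
      bexp (fun s => Real.sin ((2 * (k s : ℝ) + 1) * θ) ^ 2)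
        (fun x => if |est x - Real.sin θ ^ 2| ≤ (1 / 2) ^ J then 0 else 1) ≤ η)
    (post : ℝ → Config S → ℝ) (I : Instance nv nh N) (w : ℝ) (Z : Set ℝ)
    (hZ : ∀ x, |est x - Sp.flagProb f l K I| ≤ (1 / 2) ^ J → post w x ∈ Z) :
    1 - η ≤ (Sp.algorithm N f l K k post).outputProb I w Z := by
  obtain ⟨hP0, hP1⟩ := flagProb_mem (l := l) Sp f K I
  set P := Sp.flagProb f l K I with hP
  -- The flag has probability at most `1 / 4`, so that `θ ≤ π / 6`.
  set θ := Real.arcsin (Real.sqrt P) with hθ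
  have hs1 : Real.sqrt P ≤ 1 / 2 := by
    rw [Real.sqrt_le_left (by norm_num)]
    linarith
  have hsin : Real.sin θ = Real.sqrt P :=
    Real.sin_arcsin (by linarith [Real.sqrt_nonneg P]) (by linarith)
  have hPsin : P = Real.sin θ ^ 2 := by rw [hsin, Real.sq_sqrt hP0]
  have hθ0 : 0 ≤ θ := Real.arcsin_nonneg.2 (Real.sqrt_nonneg P)
  have hθ1 : θ ≤ Real.pi / 6 := by
    have : Real.arcsin (1 / 2) = Real.pi / 6 := by
      rw [← Real.sin_pi_div_six]
      exact Real.arcsin_sin (by linarith [Real.pi_pos]) (by linarith [Real.pi_pos])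
    rw [← this]
    exact Real.monotone_arcsin hs1
  have h := hest θ hθ0 hθ1
  rw [← hPsin] at h
  have hout := outputProb_copiesAlgorithm I (fun s => groverOps (Sp.prepOps N f :
    List (Op nv nh N (Wire nv nh (Nat.clog 2 N) l K T))) .flag (k s)) (.inl .flag) post w Z
      (fun s => Real.sin ((2 * (k s : ℝ) + 1) * θ) ^ 2)
      fun s b => sum_groverOps_prepOps hN Sp f I hPsin (k s) b
  rw [SamplerSpec.algorithm, hout]
  calc 1 - η ≤ 1 - bexp (fun s => Real.sin ((2 * (k s : ℝ) + 1) * θ) ^ 2)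
        (fun x => if |est x - P| ≤ (1 / 2) ^ J then 0 else 1) := by linarith
    _ = bexp (fun s => Real.sin ((2 * (k s : ℝ) + 1) * θ) ^ 2)
        (fun x => 1 - if |est x - P| ≤ (1 / 2) ^ J then 0 else 1) := (bexp_one_sub _ _).symm
    _ ≤ _ := by
      refine bexp_mono (fun s => sq_nonneg _) (fun s => Real.sin_sq_le_one _) fun x => ?_
      by_cases hx : |est x - P| ≤ (1 / 2) ^ J
      · rw [if_pos hx, if_pos (hZ x hx)]
        norm_num
      · rw [if_neg hx]
        split_ifs <;> norm_num

end

/-! ### Accuracy and resources of the gradient estimation -/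

section

variable {nv nh N : ℕ}

/-- An algorithm without quantum operations. -/
def emptyAlgorithm (nv nh N : ℕ) (post : ℝ → ℝ) : QAlgorithm nv nh N where
  q := 0
  circuit := []
  m := 0
  measured := Function.Embedding.refl _
  post w _ := post w

theorem outputProb_emptyAlgorithm (post : ℝ → ℝ) (I : Instance nv nh N) (w : ℝ) (S : Set ℝ)
    (h : post w ∈ S) : (emptyAlgorithm nv nh N post).outputProb I w S = 1 := by
  unfold QAlgorithm.outputProb
  have : ∀ s : Config 0, s = fun _ => false := fun s => Subsingleton.elim _ _
  simp [emptyAlgorithm, QAlgorithm.finalState, h, Subsingleton.elim _ (fun _ : Fin 0 => false)]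
  rfl

/-- The error of the estimate of a gradient component that is computed from an estimate of the
probability of the flag. -/
theorem abs_estimate_sub_le {R D R' M : Fin N → ℝ} (hN : 0 < N) {J : ℕ}
    (hR : ∀ p, |R p - D p| ≤ 2 * (1 / 2) ^ J) (hR' : ∀ p, |R' p - M p| ≤ 2 * (1 / 2) ^ J) {e : ℝ}
    (he : |e - 1 / 8 * (1 / 2 ^ Nat.clog 2 N * ∑ p, (R p + (1 - R' p)))| ≤ (1 / 2) ^ J) :
    |(8 * (2 ^ Nat.clog 2 N / N) * e - 1) - 1 / N * ∑ p, (D p - M p)| ≤ 20 * (1 / 2) ^ J := by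
  have hm : (0 : ℝ) < 2 ^ Nat.clog 2 N := by positivity
  have hN' : (0 : ℝ) < N := by exact_mod_cast hN
  have hmN : (2 : ℝ) ^ Nat.clog 2 N / N ≤ 2 := by
    rw [div_le_iff₀ hN']
    have := two_pow_clog_lt hN
    exact_mod_cast this.le
  set P := 1 / 8 * (1 / 2 ^ Nat.clog 2 N * ∑ p, (R p + (1 - R' p))) with hP
  have e1 : 8 * (2 ^ Nat.clog 2 N / N) * P - 1 = 1 / N * ∑ p, (R p - R' p) := by
    rw [hP]
    have : ∑ p, (R p + (1 - R' p)) = ∑ p, (R p - R' p) + N := by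
      simp only [← add_sub_assoc, add_sub_right_comm, Finset.sum_add_distrib]
      simp
    rw [this]
    field_simp
    ring
  have e2 : (8 * (2 ^ Nat.clog 2 N / N) * e - 1) - 1 / N * ∑ p, (D p - M p) =
      8 * (2 ^ Nat.clog 2 N / N) * (e - P) +
        1 / N * ∑ p, ((R p - D p) - (R' p - M p)) := by
    have : ∑ p, ((R p - D p) - (R' p - M p)) = ∑ p, (R p - R' p) - ∑ p, (D p - M p) := by
      rw [← Finset.sum_sub_distrib]
      exact Finset.sum_congr rfl fun p _ => by ring
    rw [this, mul_sub (1 / (N : ℝ)), ← e1]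
    ring
  rw [e2]
  have h1 : |8 * (2 ^ Nat.clog 2 N / N) * (e - P)| ≤ 16 * (1 / 2) ^ J := by
    rw [abs_mul, abs_of_nonneg (by positivity)]
    exact mul_le_mul (by linarith) he (abs_nonneg _) (by norm_num)
  have h2 : |1 / N * ∑ p, ((R p - D p) - (R' p - M p))| ≤ 4 * (1 / 2) ^ J := by
    rw [abs_mul, abs_of_nonneg (by positivity), one_div, inv_mul_le_iff₀ hN']
    refine (Finset.abs_sum_le_sum_abs _ _).trans ?_
    refine (Finset.sum_le_sum (g := fun _ => 4 * (1 / 2 : ℝ) ^ J) fun p _ => ?_).trans (by simp)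
    refine (abs_sub _ _).trans ?_
    linarith [hR p, hR' p]
  exact (abs_add_le _ _).trans (by linarith)

theorem clog_le_two_mul_log {n : ℕ} (hn : 0 < n) {X : ℝ} (hX : 2 * (n : ℝ) ≤ X) :
    (Nat.clog 2 n : ℝ) ≤ 2 * Real.log X := by
  have h1 : ((2 : ℝ)) ^ Nat.clog 2 n ≤ X := by
    have := two_pow_clog_lt hn
    refine le_trans ?_ hX
    exact_mod_cast this.le
  have h2 := Real.log_le_log (by positivity) h1
  rw [Real.log_pow] at h2
  have h3 := Real.log_two_gt_d9
  have h4 : (0 : ℝ) ≤ Nat.clog 2 n := Nat.cast_nonneg _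
  nlinarith

/-- The number of bits for the accuracy `δ` of a gradient component multiplied by `r`. -/
def gradientBits (r δ : ℝ) : ℕ := Nat.clog 2 ⌈20 * |r| / δ⌉₊

variable {r δ : ℝ}

theorem two_pow_gradientBits_le (hδ : 0 < δ) (hr : δ < |r|) :
    (2 : ℝ) ^ gradientBits r δ ≤ 42 * (|r| / δ) := by
  have h1 : 1 < |r| / δ := by rwa [one_lt_div hδ]
  have hpos : 0 < 20 * |r| / δ := by rw [mul_div_assoc]; linarith
  have h2 : ((2 : ℝ)) ^ gradientBits r δ ≤ 2 * ⌈20 * |r| / δ⌉₊ := by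
    exact_mod_cast (two_pow_clog_lt (Nat.ceil_pos.2 hpos)).le
  have h3 := Nat.ceil_lt_add_one hpos.le
  rw [mul_div_assoc] at h3 h2
  linarith

theorem mul_half_pow_gradientBits_le (hδ : 0 < δ) :
    |r| * (20 * (1 / 2) ^ gradientBits r δ) ≤ δ := by
  have h1 : 20 * |r| / δ ≤ (2 : ℝ) ^ gradientBits r δ := by
    refine (Nat.le_ceil _).trans ?_
    exact_mod_cast Nat.le_pow_clog (by norm_num : 1 < 2) ⌈20 * |r| / δ⌉₊
  have h2 : (0 : ℝ) < 2 ^ gradientBits r δ := by positivity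
  rw [div_le_iff₀ hδ] at h1
  rw [div_pow, one_pow]
  rw [mul_one_div, mul_div_assoc', div_le_iff₀ h2]
  linarith

/-- The coefficient of the logarithmic bound on the number of bits. -/
def bitsCoeff (r : ℝ) : ℝ := 4 * Real.log (42 * |r| + 1) + 4

theorem bitsCoeff_pos (r : ℝ) : 0 < bitsCoeff r := by
  have : 0 ≤ Real.log (42 * |r| + 1) := Real.log_nonneg (by linarith [abs_nonneg r])
  unfold bitsCoeff
  linarith

theorem half_le_log {X : ℝ} (hX : 2 ≤ X) : 1 / 2 ≤ Real.log X := by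
  have h1 := Real.log_le_log (by norm_num) hX
  have h2 := Real.log_two_gt_d9
  linarith

theorem gradientBits_le (hδ : 0 < δ) (hr : δ < |r|) {κ : ℝ} (hκ : 1 ≤ κ) :
    (gradientBits r δ : ℝ) + 1 ≤ bitsCoeff r * Real.log (2 + κ / δ) := by
  have hρ : 0 < κ / δ := by positivity
  have hr0 := abs_nonneg r
  have h1 : (2 : ℝ) ^ gradientBits r δ ≤ (42 * |r| + 1) * (2 + κ / δ) := by
    have h2 : |r| / δ ≤ |r| * (κ / δ) := by
      rw [mul_div_assoc']
      exact div_le_div_of_nonneg_right (le_mul_of_one_le_right hr0 hκ) hδ.le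
    have h3 := two_pow_gradientBits_le hδ hr
    nlinarith
  have h2 := Real.log_le_log (by positivity) h1
  rw [Real.log_pow, Real.log_mul (by positivity) (by positivity)] at h2
  have h3 := Real.log_two_gt_d9
  have h4 : (0 : ℝ) ≤ gradientBits r δ := Nat.cast_nonneg _
  have h5 : 0 ≤ Real.log (42 * |r| + 1) := Real.log_nonneg (by linarith)
  have h6 := half_le_log (X := 2 + κ / δ) (by linarith)
  unfold bitsCoeff
  nlinarith

/-- The coefficient of the logarithmic bound on the size of registers. -/
def widthCoeff (r : ℝ) : ℝ := bitsCoeff r + 12 * Real.log (46 + 2 * |r|) + 8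

theorem digits_add_clog_le (hδ : 0 < δ) (hr : δ < |r|) {κ W : ℝ} (hκ : 1 ≤ κ) (hW : 0 ≤ W) {E : ℕ}
    (hE : 0 < E) (hN : 0 < N) :
    (digits (gradientBits r δ) E W κ + Nat.clog 2 N : ℕ) ≤
      widthCoeff r * Real.log (2 + E + N + W + κ / δ) := by
  have hρ : 0 < κ / δ := by positivity
  have hr0 := abs_nonneg r
  have hE' : (1 : ℝ) ≤ E := by exact_mod_cast hE
  have hN' : (1 : ℝ) ≤ N := by exact_mod_cast hN
  set X := 2 + (E : ℝ) + N + W + κ / δ with hX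
  have hX2 : 2 ≤ X := by linarith
  have hXX : X ≤ X ^ 2 := by nlinarith
  have hlog := half_le_log hX2
  have hq : 0 < 46 + 2 * |r| := by linarith
  have b1 : (gradientBits r δ : ℝ) + 1 ≤ bitsCoeff r * Real.log X := by
    refine (gradientBits_le hδ hr hκ).trans ?_
    refine mul_le_mul_of_nonneg_left ?_ (bitsCoeff_pos r).le
    exact Real.log_le_log (by linarith) (by linarith)
  have b2 : (Nat.clog 2 (11 * E) : ℝ) ≤ 2 * (Real.log (46 + 2 * |r|) + Real.log X) := by
    rw [← Real.log_mul hq.ne' (by linarith)]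
    refine clog_le_two_mul_log (by omega) ?_
    push_cast
    nlinarith
  have b3 : (Nat.clog 2 N : ℝ) ≤ 2 * (Real.log (46 + 2 * |r|) + Real.log X) := by
    rw [← Real.log_mul hq.ne' (by linarith)]
    refine clog_le_two_mul_log hN ?_
    nlinarith
  -- The bound on `κ` by the logarithm of `κ / δ` uses `δ < |r|`.
  have b4 : (Nat.clog 2 ⌈14 * (E : ℝ) + 8 * (E * W) + κ⌉₊ : ℝ) ≤
      2 * (Real.log (46 + 2 * |r|) + 2 * Real.log X) := by
    have e : 2 * Real.log X = Real.log (X ^ 2) := by rw [Real.log_pow]; norm_num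
    rw [e, ← Real.log_mul hq.ne' (by positivity)]
    have hpos : 0 < 14 * (E : ℝ) + 8 * (E * W) + κ := by positivity
    refine clog_le_two_mul_log (Nat.ceil_pos.2 hpos) ?_
    have h1 := Nat.ceil_lt_add_one hpos.le
    have h2 : κ ≤ |r| * X ^ 2 := by
      calc κ = δ * (κ / δ) := by field_simp
        _ ≤ |r| * X := mul_le_mul hr.le (by linarith) hρ.le hr0
        _ ≤ |r| * X ^ 2 := mul_le_mul_of_nonneg_left hXX hr0
    have h3 : (E : ℝ) * W ≤ X ^ 2 := by
      rw [pow_two]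
      exact mul_le_mul (by linarith) (by linarith) hW (by linarith)
    have h4 : (E : ℝ) ≤ X ^ 2 := by linarith
    have h5 : 1 ≤ X ^ 2 := by linarith
    nlinarith
  have hq' : 0 ≤ Real.log (46 + 2 * |r|) := Real.log_nonneg (by linarith)
  unfold digits precision widthCoeff
  push_cast
  nlinarith

theorem widthCoeff_pos (r : ℝ) : 0 < widthCoeff r := by
  have h := bitsCoeff_pos r
  have : 0 ≤ Real.log (46 + 2 * |r|) := Real.log_nonneg (by linarith [abs_nonneg r])
  unfold widthCoeff
  linarith

theorem trials_le (hδ : 0 < δ) (hr : δ < |r|) {κ : ℝ} (hκ : 1 ≤ κ) :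
    (trials (gradientBits r δ) κ : ℝ) ≤ 3 * κ * (bitsCoeff r * Real.log (2 + κ / δ)) := by
  have h1 := gradientBits_le hδ hr hκ
  have h2 : (trials (gradientBits r δ) κ : ℝ) ≤ 3 * κ * gradientBits r δ + 2 := by
    unfold trials
    push_cast
    have := Nat.ceil_lt_add_one (show 0 ≤ 3 * κ * (gradientBits r δ : ℝ) by positivity)
    linarith
  have h3 := mul_le_mul_of_nonneg_left h1 (show (0 : ℝ) ≤ 3 * κ by linarith)
  linarith

/-- The constant of the resource bounds. -/
def costConst (r : ℝ) (a : ℕ) : ℝ :=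
  a * bitsCoeff r * (1 + 5376 * |r| + 4870656 * |r| * bitsCoeff r * widthCoeff r)

theorem costConst_nonneg (r : ℝ) (a : ℕ) : 0 ≤ costConst r a := by
  have h1 := (bitsCoeff_pos r).le
  have h2 := (widthCoeff_pos r).le
  have h3 := abs_nonneg r
  unfold costConst
  positivity

/-- The resource bounds for `S` copies of the sampling circuit. -/
theorem resource_bounds (hδ : 0 < δ) (hr : δ < |r|) {κ W : ℝ} (hκ : 1 ≤ κ) (hW : 0 ≤ W) {E : ℕ}
    (hE : 0 < E) (hN : 0 < N) {J a S q t : ℕ} (hJ : J = gradientBits r δ) (hS : S ≤ a * (J + 1))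
    (hq : q ≤ S * 2 ^ (J + 5))
    (ht : t ≤ S * 2 ^ (J + 5) * (1208 * (trials J κ * E * (digits J E W κ + Nat.clog 2 N)))) :
    (q : ℝ) ≤ costConst r a * (κ / δ) * Real.log (2 + κ / δ) ^ 3 ∧
      (t : ℝ) ≤ costConst r a * (E * κ / δ) * Real.log (2 + E + N + W + κ / δ) ^ 3 ∧
      (S : ℝ) ≤ costConst r a * Real.log (2 + κ / δ) := by
  subst hJ
  have hρ : 0 < κ / δ := by positivity
  have hr0 := abs_nonneg r
  set u := bitsCoeff r with hu
  set v := widthCoeff r with hv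
  have hu0 : 0 < u := bitsCoeff_pos r
  have hv0 : 0 < v := widthCoeff_pos r
  set Λ := Real.log (2 + κ / δ) with hΛ
  set Λ' := Real.log (2 + E + N + W + κ / δ) with hΛ'
  have hΛ1 : 1 / 2 ≤ Λ := half_le_log (by linarith)
  have hΛΛ : Λ ≤ Λ' := by
    have h1 : (0 : ℝ) ≤ E := Nat.cast_nonneg _
    have h2 : (0 : ℝ) ≤ N := Nat.cast_nonneg _
    exact Real.log_le_log (by linarith) (by linarith)
  have ha0 : (0 : ℝ) ≤ a := Nat.cast_nonneg _
  have hS' : (S : ℝ) ≤ a * (u * Λ) := by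
    have : (S : ℝ) ≤ a * (gradientBits r δ + 1) := by exact_mod_cast hS
    exact this.trans (mul_le_mul_of_nonneg_left (gradientBits_le hδ hr hκ) ha0)
  have hpow : (2 : ℝ) ^ (gradientBits r δ + 5) ≤ 1344 * (|r| / δ) := by
    have := two_pow_gradientBits_le hδ hr
    rw [pow_add]
    norm_num
    linarith
  have hSq : (S : ℝ) * 2 ^ (gradientBits r δ + 5) ≤ a * (u * Λ) * (1344 * (|r| / δ)) :=
    mul_le_mul hS' hpow (by positivity) (by positivity)
  refine ⟨?_, ?_, ?_⟩
  · have h1 : (q : ℝ) ≤ S * 2 ^ (gradientBits r δ + 5) := by exact_mod_cast hq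
    have h2 : |r| / δ ≤ |r| * (κ / δ) := by
      rw [mul_div_assoc']
      exact div_le_div_of_nonneg_right (le_mul_of_one_le_right hr0 hκ) hδ.le
    have h3 : Λ ≤ 4 * Λ ^ 3 := by nlinarith [sq_nonneg (Λ - 1 / 2)]
    calc (q : ℝ) ≤ a * (u * Λ) * (1344 * (|r| / δ)) := h1.trans hSq
      _ ≤ a * (u * (4 * Λ ^ 3)) * (1344 * (|r| * (κ / δ))) := by gcongr
      _ = a * u * (5376 * |r|) * (κ / δ) * Λ ^ 3 := by ring
      _ ≤ costConst r a * (κ / δ) * Λ ^ 3 := by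
        unfold costConst
        rw [← hu, ← hv]
        gcongr
        have : 0 ≤ 4870656 * |r| * u * v := by positivity
        linarith
  · have h1 : (t : ℝ) ≤ S * 2 ^ (gradientBits r δ + 5) * (1208 * (trials (gradientBits r δ) κ * E *
        (digits (gradientBits r δ) E W κ + Nat.clog 2 N : ℕ))) := by exact_mod_cast ht
    have hK := trials_le hδ hr hκ
    have hD := digits_add_clog_le hδ hr hκ hW hE hN
    rw [← hu, ← hΛ] at hK
    rw [← hv, ← hΛ'] at hD
    have hΛ'0 : 0 ≤ Λ' := by linarith
    have hκ0 : 0 ≤ κ := by linarith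
    calc (t : ℝ) ≤ a * (u * Λ) * (1344 * (|r| / δ)) *
          (1208 * (3 * κ * (u * Λ) * E * (v * Λ'))) := by
          refine h1.trans (mul_le_mul hSq ?_ (by positivity) (by positivity))
          gcongr
      _ ≤ a * (u * Λ') * (1344 * (|r| / δ)) * (1208 * (3 * κ * (u * Λ') * E * (v * Λ'))) := by
          gcongr
      _ = a * u * (4870656 * |r| * u * v) * (E * κ / δ) * Λ' ^ 3 := by ring
      _ ≤ costConst r a * (E * κ / δ) * Λ' ^ 3 := by
        unfold costConst
        rw [← hu, ← hv]
        gcongr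
        have : 0 ≤ 5376 * |r| := by positivity
        linarith
  · calc (S : ℝ) ≤ a * u * 1 * Λ := by linarith
      _ ≤ costConst r a * Λ := by
        unfold costConst
        rw [← hu, ← hv]
        gcongr
        have h1 : 0 ≤ 5376 * |r| := by positivity
        have h2 : 0 ≤ 4870656 * |r| * u * v := by positivity
        linarith

theorem dataMean_mem (θ : Params nv nh) (c : Coord nv nh) (x : Config nv) :
    0 ≤ dataMean θ c x ∧ dataMean θ c x ≤ 1 := by
  have hb : ∀ b, 0 ≤ bit b ∧ bit b ≤ 1 := by intro b; cases b <;> simp [bit]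
  have hZ := clampedPartition_pos θ x
  refine ⟨div_nonneg (Finset.sum_nonneg fun h _ => mul_nonneg (Real.exp_pos _).le (hb _).1) hZ.le,
    (div_le_one hZ).2 (Finset.sum_le_sum fun h _ => ?_)⟩
  exact mul_le_of_le_one_right (Real.exp_pos _).le (hb _).2

theorem modelMean_mem (θ : Params nv nh) (c : Coord nv nh) :
    0 ≤ modelMean θ c ∧ modelMean θ c ≤ 1 := by
  have hb : ∀ b, 0 ≤ bit b ∧ bit b ≤ 1 := by intro b; cases b <;> simp [bit]
  have hZ := partition_pos θ
  refine ⟨div_nonneg (Finset.sum_nonneg fun h _ => mul_nonneg (Real.exp_pos _).le (hb _).1) hZ.le,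
    (div_le_one hZ).2 ?_⟩
  rw [partition_eq_sum]
  exact Finset.sum_le_sum fun h _ => mul_le_of_le_one_right (Real.exp_pos _).le (hb _).2

end

end

end QBM

theorem mainTheorem2 (r η : ℝ) (hη : 0 < η) :
    ∃ (C : ℝ) (k : ℕ), ∀ (nv nh N : ℕ) (G : SimpleGraph (Fin nv ⊕ Fin nh))
      (c : QBM.Coord nv nh) (lam W κ κmax δ : ℝ),
      G.Connected → 0 < G.edgeSet.ncard → 0 < N → 0 ≤ W → 0 < κ → 0 < κmax → 0 < δ →
      ∃ A : QBM.QAlgorithm nv nh N,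
        (A.queries : ℝ) ≤ C * ((κ + κmax) / δ) * Real.log (2 + (κ + κmax) / δ) ^ k ∧
        (A.cost G.edgeSet.ncard : ℝ) ≤ C * (G.edgeSet.ncard * (κ + κmax) / δ) *
          Real.log (2 + G.edgeSet.ncard + N + W + (κ + κmax) / δ) ^ k ∧
        (A.m : ℝ) ≤ C * Real.log (2 + (κ + κmax) / δ) ∧
        ∀ (I : QBM.Instance nv nh N) (κx : Fin N → ℝ),
          QBM.WeightsOn G I.θ → (∀ a, |I.θ a| ≤ W) →
          QBM.IsMeanField I.θ I.μ I.ν →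
          (∀ p, QBM.IsClampedMeanField I.θ (I.x p) (I.νx (I.x p))) →
          QBM.KappaBound I.θ I.μ I.ν κ →
          (∀ p, QBM.ClampedKappaBound I.θ (I.x p) (I.νx (I.x p)) (κx p)) →
          IsGreatest (Set.range κx) κmax →
          ∃ g : ℝ,
            HasDerivAt (fun t => QBM.objective lam I.x (Function.update I.θ c t)) g (I.θ c) ∧
            1 - η ≤ A.outputProb I (I.θ c) {z | |z - r * g| ≤ δ} := by
  obtain ⟨a, ha⟩ := QBM.exists_phase_estimator hη
  refine ⟨QBM.costConst r a, 3, ?_⟩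
  intro nv nh N G c lam W κ κmax δ hG hE hN hW0 hκ hκmax hδ
  have hC := QBM.costConst_nonneg r a
  have hρ : 0 < (κ + κmax) / δ := by positivity
  have hlog0 : 0 ≤ Real.log (2 + (κ + κmax) / δ) := Real.log_nonneg (by linarith)
  by_cases htriv : |r| ≤ δ ∨ κ + κmax < 1
  · -- The gradient without the regularization is at most `1`, so that the regularization alone is
    -- accurate enough; and no machine satisfies the promises if `κ + κmax < 1`.
    refine ⟨QBM.emptyAlgorithm nv nh N fun w => -(r * if c.isWeight then lam * w else 0),
      ?_, ?_, ?_, ?_⟩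
    · simp only [QBM.QAlgorithm.queries, QBM.emptyAlgorithm, List.map_nil, List.sum_nil,
        Nat.cast_zero]
      positivity
    · have : 0 ≤ Real.log (2 + G.edgeSet.ncard + N + W + (κ + κmax) / δ) :=
        Real.log_nonneg (by
          have h1 : (0 : ℝ) ≤ G.edgeSet.ncard := Nat.cast_nonneg _
          have h2 : (0 : ℝ) ≤ N := Nat.cast_nonneg _
          linarith)
      simp only [QBM.QAlgorithm.cost, QBM.emptyAlgorithm, List.map_nil, List.sum_nil,
        Nat.cast_zero]
      positivity
    · simp only [QBM.emptyAlgorithm, Nat.cast_zero]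
      positivity
    · intro I κx hθ hW hm hmx hk hkx hmax
      refine ⟨_, QBM.hasDerivAt_objective lam I.x I.θ c, ?_⟩
      have hκ1 := QBM.one_le_of_kappaBound hm hk
      have hr : |r| ≤ δ := htriv.resolve_right (by linarith)
      rw [QBM.outputProb_emptyAlgorithm]
      · linarith
      · have hN' : (0 : ℝ) < N := by exact_mod_cast hN
        have h1 : |1 / N * ∑ p, (QBM.dataMean I.θ c (I.x p) - QBM.modelMean I.θ c)| ≤ 1 := by
          rw [abs_mul, abs_of_nonneg (by positivity), one_div, inv_mul_le_iff₀ hN']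
          refine (Finset.abs_sum_le_sum_abs _ _).trans ?_
          refine (Finset.sum_le_sum (g := fun _ => (1 : ℝ)) fun p _ => ?_).trans (by simp)
          have h2 := QBM.dataMean_mem I.θ c (I.x p)
          have h3 := QBM.modelMean_mem I.θ c
          rw [abs_le]
          constructor <;> linarith
        have e : ∀ u v : ℝ, -(r * u) - r * (v - u) = -(r * v) := fun u v => by ring
        rw [Set.mem_ofPred_eq, e, abs_neg, abs_mul]
        exact (mul_le_of_le_one_right (abs_nonneg r) h1).trans hr
  push Not at htriv
  obtain ⟨hr, hκ1⟩ := htriv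
  obtain ⟨J, hJ⟩ : ∃ J, J = QBM.gradientBits r δ := ⟨_, rfl⟩
  obtain ⟨S, k, est, hS, hk, hest⟩ := ha J
  set E := G.edgeSet.ncard with hEdef
  have hn := QBM.card_units_le G hG
  have hT := QBM.numTerms_eq G
  rw [QBM.card_adjPair G] at hT
  set f := QBM.precision J E with hf
  set l := QBM.digits J E W (κ + κmax) with hl
  set K := QBM.trials J (κ + κmax) with hK
  set Sp := QBM.samplerSpec (QBM.termEnum G) c f l (κ + κmax) with hSp
  -- The flag has probability `1 / 8 * (N / 2 ^ clog N) * (1 + g)`, where `g` is the derivative without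
  -- the regularization term.
  set post : ℝ → QBM.Config S → ℝ := fun w x =>
    r * (8 * (2 ^ Nat.clog 2 N / N) * est x - 1) - r * if c.isWeight then lam * w else 0 with hpost
  obtain ⟨hq, ht⟩ := QBM.algorithm_costs (N := N) (l := l) Sp f K k hk post (Nat.le_add_left 1 _) hE
    (by omega) (by omega)
  have hres := QBM.resource_bounds hδ hr hκ1 hW0 hE hN hJ hS hq ht
  refine ⟨Sp.algorithm N f l K k post, hres.1, hres.2.1, hres.2.2, ?_⟩
  intro I κx hθ hW hm hmx hk' hkx hmax
  refine ⟨_, QBM.hasDerivAt_objective lam I.x I.θ c, ?_⟩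
  refine QBM.le_outputProb_algorithm hN Sp f K k est hest post I (I.θ c) _ fun x hx => ?_
  have hκpos : 0 < κ + κmax := by positivity
  have hR : ∀ p, |Sp.resultProb f l K I true (I.x p) - QBM.dataMean I.θ c (I.x p)| ≤
      2 * (1 / 2) ^ J := by
    intro p
    have hkp : κx p ≤ κ + κmax := by
      have := hmax.2 ⟨p, rfl⟩
      linarith
    rw [← QBM.sum_boltzmann_true_div]
    exact QBM.abs_resultProb_sub_le_pow hG hE hW0 hθ hW c J hκpos
      (QBM.meanFieldBound_true (hmx p) (hkx p) hkp)
  have hR' : ∀ p, |Sp.resultProb f l K I false (I.x p) - QBM.modelMean I.θ c| ≤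
      2 * (1 / 2) ^ J := by
    intro p
    rw [← QBM.sum_boltzmann_false_div I (I.x p)]
    exact QBM.abs_resultProb_sub_le_pow hG hE hW0 hθ hW c J hκpos
      (QBM.meanFieldBound_false hm hk' (by linarith))
  have hmain := QBM.abs_estimate_sub_le hN hR hR' (e := est x) hx
  have e : ∀ u v w : ℝ, r * u - r * v - r * (w - v) = r * (u - w) := fun u v w => by ring
  rw [Set.mem_ofPred_eq, hpost, e, abs_mul]
  refine (mul_le_mul_of_nonneg_left hmain (abs_nonneg r)).trans ?_
  rw [hJ]
  exact QBM.mul_half_pow_gradientBits_le hδ
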